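/- Logarithms are to the base $2$. For integers $n, a$ with $n\equiv 1 \pmod 4$, $0\le a<n$ and Jacobi symbol $\left(\frac{a}{n}\right)=-1$, let $k=\nu_2(n-1)$ be the exponent of $2$ in $n-1$ and let $s=\lceil 2\log\log n\rceil$. **Algorithm 1**, on such an input, is the following procedure. 1. (a) Let $A=a^{(n-1)/2^k}$. If $A^{2^{k-1}}\not\equiv -1\pmod n$, output *composite*. (b) If $k>\frac12\log n$, output *prime*. 2. If $n=d^e$ for some positive integers $d,e$ with $e>1$, output *composite*. 3. Set $m=1$, $\mathcal S=\{1\}$, $\mathcal S'=\{1\}$. While $|\mathcal S|<2^{\max(s-k,0)}$: while $m^{2^k}\bmod n\in\mathcal S'$, replace $m$ by $m+1$; then, if $m>|\mathcal S|2^k+1$, output *composite*; if $\gcd(m,n)>1$, output *composite*; if $\gcd(m^{2^k}-s',n)>1$ for some $s'\in\mathcal S'$, output *composite*; then add $m$ to $\mathcal S$ and $m^{2^k}\bmod n$ to $\mathcal S'$. 4. For all $m\in\mathcal S$: if $(1+mx)^n\not\equiv 1+mx^n \pmod{(n,\,x^{2^s}-a)}$, output *composite*. Finally output *prime*. Time is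 counted in steps of a program of a first-order Lisp on binary trees, in which each of the primitive operations (reading or binding a variable, $\mathrm{nil}$, $\mathrm{cons}$, $\mathrm{hd}$, $\mathrm{tl}$, branching on $\mathrm{nil}$, calling a recursive function) costs one step and numbers are lists of binary digits; no arithmetic operation is primitive. A program *implements* Algorithm 1 if on input $(n,a,s)$, for every $(n,a)$ as above, it halts with the output of Algorithm 1 together with the list, in order, of the quantities that the steps of Algorithm 1 compute (the residues mod $n$ of $A$ and $A^{2^{k-1}}$, the truth values of the tests in 1(b) and 2, the values of $|\mathcal S|$, $m$, $m^{2^k}\bmod n$, $|\mathcal S|2^k+1$, the gcd's with the elements $s'$ that they belong to, and in Step 4 each $m$ with the coefficients of the remainders of $(1+mx)^n$ and $1+mx^n$ modulo $(n,x^{2^s}-a)$). For a set $D$ of inputs, $T=\tilde O(g)$ on $D$ means that $T\le g\cdot q(\log g)$ on $D$ for some real polynomial $q$ (that is, $T=O(g\,\mathrm{poly}(\log g))$). **Theorem 3.2.** Algorithm 1 halts on every such input, and there is a program implementing it whose running time is $$\tilde O\!\left(2^{-\min(s,k)}(\log n)^6\right),$$ uniformly over all inputs $(n,a)$. This running time is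 $\tilde O((\log n)^6)$ on the inputs with $k=2$, and $\tilde O((\log n)^4)$ on the inputs with $k\ge s$. -/

import Mathlib

/-! ### Machine model: first-order Lisp over binary trees, unit cost per primitive operation

Arithmetic is not primitive: the only operations are `cons`, `hd`, `tl`, the test for `nil`,
reading a variable, binding a variable, and calling a (possibly recursive) function. Each is a
bounded number of pointer operations, so for a fixed program the cost below is the running time on a
pointer machine up to a constant factor. -/

namespace Lisp

/-- The data: binary trees with one kind of leaf. -/
inductive Data : Type
  | nil : Data
  | cons : Data → Data → Data

/-- `hd nil = nil`. -/
def Data.hd : Data → Data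
  | .nil => .nil
  | .cons x _ => x

/-- `tl nil = nil`. -/
def Data.tl : Data → Data
  | .nil => .nil
  | .cons _ y => y

/-- Expressions. Variables are de Bruijn indices into the list of current values;
`bind e b` evaluates `e` and makes its value variable `0` of `b`; `cond c t e` is `t` if `c` is
not `nil` and `e` otherwise; `call f e` applies the `f`-th function of the program. -/
inductive Expr : Type
  | var : ℕ → Expr
  | nil : Expr
  | cons : Expr → Expr → Expr
  | hd : Expr → Expr
  | tl : Expr → Expr
  | cond : Expr → Expr → Expr → Expr
  | bind : Expr → Expr → Expr
  | call : ℕ → Expr → Expr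

/-- A program is a finite list of bodies of one-argument functions; in each body variable `0` is the
argument. Function `0` is the main function. -/
abbrev Program : Type := List Expr

/-- `Eval P env e v t`: with the functions of `P` and the values `env` of the variables, the
evaluation of `e` halts with value `v` after `t` steps. -/
inductive Eval (P : Program) : List Data → Expr → Data → ℕ → Prop
  | var (env : List Data) (i : ℕ) : Eval P env (.var i) (env.getD i .nil) 1
  | nil (env : List Data) : Eval P env .nil .nil 1
  | cons {env : List Data} {e₁ e₂ : Expr} {v₁ v₂ : Data} {t₁ t₂ : ℕ} :
      Eval P env e₁ v₁ t₁ → Eval P env e₂ v₂ t₂ →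
        Eval P env (.cons e₁ e₂) (.cons v₁ v₂) (t₁ + t₂ + 1)
  | hd {env : List Data} {e : Expr} {v : Data} {t : ℕ} :
      Eval P env e v t → Eval P env (.hd e) v.hd (t + 1)
  | tl {env : List Data} {e : Expr} {v : Data} {t : ℕ} :
      Eval P env e v t → Eval P env (.tl e) v.tl (t + 1)
  | cond_true {env : List Data} {c e₁ e₂ : Expr} {x y v : Data} {t t' : ℕ} :
      Eval P env c (.cons x y) t → Eval P env e₁ v t' →
        Eval P env (.cond c e₁ e₂) v (t + t' + 1)
  | cond_false {env : List Data} {c e₁ e₂ : Expr} {v : Data} {t t' : ℕ} :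
      Eval P env c .nil t → Eval P env e₂ v t' →
        Eval P env (.cond c e₁ e₂) v (t + t' + 1)
  | bind {env : List Data} {e b : Expr} {v w : Data} {t t' : ℕ} :
      Eval P env e v t → Eval P (v :: env) b w t' →
        Eval P env (.bind e b) w (t + t' + 1)
  | call {env : List Data} {f : ℕ} {e b : Expr} {v w : Data} {t t' : ℕ} :
      Eval P env e v t → P[f]? = some b → Eval P [v] b w t' →
        Eval P env (.call f e) w (t + t' + 1)

/-- On input `x` the program `P` halts with output `y` after `t` steps. -/
def Program.HaltsWith (P : Program) (x y : Data) (t : ℕ) : Prop :=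
  Eval P [x] (.call 0 (.var 0)) y t

/-- A bit: `nil` is false, `cons nil nil` is true. -/
def encBool : Bool → Data
  | false => .nil
  | true => .cons .nil .nil

/-- A list, given an encoding of its entries. -/
def encList {α : Type} (enc : α → Data) : List α → Data
  | [] => .nil
  | x :: l => .cons (enc x) (encList enc l)

/-- A natural number is encoded in binary, as the list of its bits, least significant bit first. -/
def encNat (n : ℕ) : Data := encList encBool n.bits

end Lisp

/-! ### The algorithm -/

namespace AlgOne

open Polynomial

/-- `k = ν₂(n - 1)`. -/
def k (n : ℕ) : ℕ := padicValNat 2 (n - 1)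

/-- `s = ⌈2 log log n⌉`, logarithms to the base 2. -/
noncomputable def s (n : ℕ) : ℕ := ⌈2 * Real.logb 2 (Real.logb 2 n)⌉₊

/-- The inputs: `n ≡ 1 (mod 4)` and a residue `a` modulo `n` with Jacobi symbol `(a / n) = -1`. -/
def Valid : Set (ℕ × ℕ) := {x | x.1 % 4 = 1 ∧ x.2 < x.1 ∧ jacobiSym (x.2 : ℤ) x.1 = -1}

/-- The points of the algorithm at which something is computed or tested. The lists `S` and `S'`
hold the elements of the two sets in order of insertion; `todo` is what a "for" still has to do. -/
inductive State : Type
  | step1a : State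
  | step1b : State
  | step2 : State
  /-- the test `|S| < 2 ^ max (s - k) 0` of the outer loop -/
  | outer (m : ℕ) (S S' : List ℕ) : State
  /-- the test `m ^ 2 ^ k mod n ∈ S'` of the inner loop -/
  | inner (m : ℕ) (S S' : List ℕ) : State
  /-- the test `m > |S| 2 ^ k + 1` -/
  | bound (m : ℕ) (S S' : List ℕ) : State
  /-- the test `(m, n) > 1` -/
  | gcd (m : ℕ) (S S' : List ℕ) : State
  /-- the tests `(m ^ 2 ^ k - s', n) > 1` -/
  | diff (m : ℕ) (S S' todo : List ℕ) : State
  /-- the polynomial congruences -/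
  | step4 (todo : List ℕ) : State
  /-- the output: `true` for prime, `false` for composite -/
  | done (prime : Bool) : State

/-- `(1 + m x) ^ n` over `ℤ / n`. -/
noncomputable def lhs (n m : ℕ) : (ZMod n)[X] := (1 + C (m : ZMod n) * X) ^ n

/-- `1 + m x ^ n` over `ℤ / n`. -/
noncomputable def rhs (n m : ℕ) : (ZMod n)[X] := 1 + C (m : ZMod n) * X ^ n

/-- `x ^ 2 ^ s - a` over `ℤ / n`. -/
noncomputable def modulus (n a : ℕ) : (ZMod n)[X] := X ^ 2 ^ s n - C (a : ZMod n)

/-- The coefficients of the remainder of `f` modulo `x ^ 2 ^ s - a`, constant coefficient first, as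
least non-negative residues modulo `n`. -/
noncomputable def remainder (n a : ℕ) (f : (ZMod n)[X]) : List ℕ :=
  (List.range (2 ^ s n)).map fun i => ((f %ₘ modulus n a).coeff i).val

open Classical in
/-- One step of the algorithm on input `n, a`: the list of the numbers which the step computes (`1`
and `0` for the truth values in Steps 1b and 2), and the next state. -/
noncomputable def step (n a : ℕ) : State → Option (List ℕ × State)
  | .step1a =>
      let A := a ^ ((n - 1) / 2 ^ k n)
      some ([A % n, A ^ 2 ^ (k n - 1) % n],
        if (A : ℤ) ^ 2 ^ (k n - 1) ≡ -1 [ZMOD n] then .step1b else .done false)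
  | .step1b =>
      if (k n : ℝ) > 1 / 2 * Real.logb 2 n then some ([1], .done true) else some ([0], .step2)
  | .step2 =>
      if ∃ d e : ℕ, 0 < d ∧ 1 < e ∧ n = d ^ e then some ([1], .done false)
      else some ([0], .outer 1 [1] [1])
  | .outer m S S' =>
      some ([S.length], if S.length < 2 ^ (s n - k n) then .inner m S S' else .step4 S)
  | .inner m S S' =>
      some ([m, m ^ 2 ^ k n % n],
        if m ^ 2 ^ k n % n ∈ S' then .inner (m + 1) S S' else .bound m S S')
  | .bound m S S' =>
      some ([S.length * 2 ^ k n + 1],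
        if m > S.length * 2 ^ k n + 1 then .done false else .gcd m S S')
  | .gcd m S S' =>
      some ([Nat.gcd m n], if Nat.gcd m n > 1 then .done false else .diff m S S' S')
  | .diff m S S' (s' :: todo) =>
      some ([s', Int.gcd ((m : ℤ) ^ 2 ^ k n - s') n],
        if Int.gcd ((m : ℤ) ^ 2 ^ k n - s') n > 1 then .done false else .diff m S S' todo)
  | .diff m S S' [] => some ([], .outer m (S ++ [m]) (S' ++ [m ^ 2 ^ k n % n]))
  | .step4 (m :: todo) =>
      some (m :: (remainder n a (lhs n m) ++ remainder n a (rhs n m)),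
        if modulus n a ∣ lhs n m - rhs n m then .step4 todo else .done false)
  | .step4 [] => some ([], .done true)
  | .done _ => none

/-- `Runs n a σ w b`: started in the state `σ`, the algorithm halts with output `b`, and `w` lists
what its steps compute, in order. -/
inductive Runs (n a : ℕ) : State → List (List ℕ) → Bool → Prop
  | done (b : Bool) : Runs n a (.done b) [] b
  | step {σ σ' : State} {r : List ℕ} {w : List (List ℕ)} {b : Bool} :
      step n a σ = some (r, σ') → Runs n a σ' w b → Runs n a σ (r :: w) b

/-- The input of an implementation: `n`, `a` and the parameter `s = ⌈2 log log n⌉`, in binary. -/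
noncomputable def input (n a : ℕ) : Lisp.Data :=
  .cons (Lisp.encNat n) (.cons (Lisp.encNat a) (Lisp.encNat (s n)))

/-- The output of an implementation: the verdict and the record of the computation. -/
def output (b : Bool) (w : List (List ℕ)) : Lisp.Data :=
  .cons (Lisp.encBool b) (Lisp.encList (Lisp.encList Lisp.encNat) w)

/-- `P` carries out the algorithm, with running time `T`: on each admissible input the algorithm
halts, and `P` produces its verdict together with everything it computes on the way, in order,
after exactly `T (n, a)` steps. -/
def Implements (P : Lisp.Program) (T : ℕ × ℕ → ℕ) : Prop :=
  ∀ n a : ℕ, (n, a) ∈ Valid → ∃ (w : List (List ℕ)) (b : Bool),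
    Runs n a .step1a w b ∧ P.HaltsWith (input n a) (output b w) (T (n, a))

end AlgOne

/-- `T = Õ(g)` on `D`, that is, `T = O(g poly(log g))`. -/
def SoftO {ι : Type} (D : Set ι) (T : ι → ℕ) (g : ι → ℝ) : Prop :=
  ∃ q : Polynomial ℝ, ∀ x ∈ D, (T x : ℝ) ≤ g x * q.eval (Real.logb 2 (g x))

/-! Write `L` for the bit length of `n`, `D = 2 ^ s` and `N = 2 ^ max (s - k) 0`. By the choice of
`s`, `D` lies between `(log n) ^ 2` and twice that, and `N = D * 2 ^ (-min s k)`. Hence the claim is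
a bound `N * D * L ^ 2`, up to powers of `s = O(log log n)`.

Step 4 dominates. It tests at most `N` congruences, each by `O(L)` products in `(ℤ / n)[x] / (x ^ D
- a)`. By Kronecker substitution such a product is one multiplication of integers of `O(D * L)` bits
together with `O(D)` reductions modulo `n` (`pml_run`), and the reductions use a precomputed
reciprocal of `n` (`red_run`). With quasi-linear multiplication the total is `N * L * (D * L)`.

The search of Step 3 ends because of `le_of_forall_mem`: modulo a prime divisor of `n` every element
of `S'` has at most `2 ^ k` roots of order `2 ^ k`, so if the powers of all numbers below `m` lie in
`S'`, then `m ≤ |S| * 2 ^ k + 1 ≤ 2 ^ s`. As `m` is never reset, all rounds together make at most `2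
^ s` successful membership tests. These tests, the at most about `N ^ 2` greatest common divisors,
and the perfect power test of cost about `L ^ 4` with `L ^ 2 = O(D)`, all stay below `N * D * L ^ 2`
(`totalT_le`).

What remains is quasi-linear multiplication on a machine without arithmetic or random access
(`nuss_ok`, `mul_run`). Products modulo `x ^ 2 ^ j + 1` are computed by Nussbaumer's recursion. With
`m * r = 2 ^ j` and `y = x ^ m`, the factors become polynomials of degree less than `m` in `x` over
a ring in which `y ^ r = -1`. There `y` is a root of unity of order `2 * r` by which one multiplies
by rotating a list, so that a fast Fourier transform in `x` needs only additions and rotations, and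
its pointwise products are again of the same kind with `j` halved. Nothing is ever divided by `2`:
the result is `2 ^ esc j` times the product, and the power of `2` is dropped at the very end.
Nothing is ever negated either: since `-1 = y ^ r`, lists of `2 * r` natural numbers suffice.
Correctness is stated for every commutative ring with an element `x` such that `x ^ 2 ^ j = -1`,
which is what the recursion passes on.

Each function of the program carries a specification `Sp` (its value and a bound for its time),
proved by symbolic execution of the body and induction on the data. -/

namespace Lisp

/-! ### Symbolic execution of programs, and the encoding of numbers -/

/-- The value of a variable. -/
def look : List Data → ℕ → Data
  | [], _ => .nil
  | x :: _, 0 => x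
  | _ :: l, i + 1 => look l i

theorem look_eq (env : List Data) (i : ℕ) : look env i = env.getD i .nil := by
  induction env generalizing i with
  | nil => simp [look]
  | cons x l ih => cases i <;> simp [look, ih]

/-- Case distinction between `nil` and `cons`. -/
def Data.cs : Data → Prop → Prop → Prop
  | .nil, p, _ => p
  | .cons _ _, _, q => q

/-- The call of function `f` with argument `v` halts with a value and a running time in `Q`. -/
def Call (P : Program) (f : ℕ) (v : Data) (Q : Data → ℕ → Prop) : Prop :=
  ∃ b w t, P[f]? = some b ∧ Eval P [v] b w t ∧ Q w t

/-- Weakest precondition of an expression, for a postcondition on value and running time. -/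
def wp (P : Program) : Expr → List Data → (Data → ℕ → Prop) → Prop
  | .var i, env, Q => Q (look env i) 1
  | .nil, _, Q => Q .nil 1
  | .cons a b, env, Q => wp P a env fun v t => wp P b env fun w t' => Q (.cons v w) (t + t' + 1)
  | .hd a, env, Q => wp P a env fun v t => Q v.hd (t + 1)
  | .tl a, env, Q => wp P a env fun v t => Q v.tl (t + 1)
  | .cond c a b, env, Q => wp P c env fun v t =>
      v.cs (wp P b env fun w t' => Q w (t + t' + 1)) (wp P a env fun w t' => Q w (t + t' + 1))
  | .bind a b, env, Q => wp P a env fun v t => wp P b (v :: env) fun w t' => Q w (t + t' + 1)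
  | .call f a, env, Q => wp P a env fun v t => Call P f v fun w t' => Q w (t + t' + 1)

/-- The recursion of `wp` is structural because a call is not unfolded: `Call` refers back to `Eval`
for the body. Recursive functions are therefore treated by induction on their arguments, outside of
`wp`. -/
theorem wp_sound {P : Program} {e : Expr} : ∀ {env : List Data} {Q : Data → ℕ → Prop},
    wp P e env Q → ∃ v t, Eval P env e v t ∧ Q v t := by
  induction e with
  | var i => intro env Q h; rw [wp, look_eq] at h; exact ⟨_, _, .var env i, h⟩
  | nil => intro env Q h; exact ⟨_, _, .nil env, h⟩
  | cons a b iha ihb =>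
    intro env Q h
    obtain ⟨v, t, h1, h2⟩ := iha h
    obtain ⟨w, t', h3, h4⟩ := ihb h2
    exact ⟨_, _, .cons h1 h3, h4⟩
  | hd a iha => intro env Q h; obtain ⟨v, t, h1, h2⟩ := iha h; exact ⟨_, _, .hd h1, h2⟩
  | tl a iha => intro env Q h; obtain ⟨v, t, h1, h2⟩ := iha h; exact ⟨_, _, .tl h1, h2⟩
  | cond c a b ihc iha ihb =>
    intro env Q h
    obtain ⟨v, t, h1, h2⟩ := ihc h
    cases v with
    | nil => obtain ⟨w, t', h3, h4⟩ := ihb h2; exact ⟨_, _, .cond_false h1 h3, h4⟩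
    | cons x y => obtain ⟨w, t', h3, h4⟩ := iha h2; exact ⟨_, _, .cond_true h1 h3, h4⟩
  | bind a b iha ihb =>
    intro env Q h
    obtain ⟨v, t, h1, h2⟩ := iha h
    obtain ⟨w, t', h3, h4⟩ := ihb h2
    exact ⟨_, _, .bind h1 h3, h4⟩
  | call f a iha =>
    intro env Q h
    obtain ⟨v, t, h1, b, w, t', hb, h3, h4⟩ := iha h
    exact ⟨_, _, .call h1 hb h3, h4⟩

theorem wp_mono {P : Program} {e : Expr} : ∀ {env : List Data} {Q Q' : Data → ℕ → Prop},
    wp P e env Q → (∀ v t, Q v t → Q' v t) → wp P e env Q' := by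
  induction e with
  | var i => intro env Q Q' h h'; exact h' _ _ h
  | nil => intro env Q Q' h h'; exact h' _ _ h
  | cons a b iha ihb | bind a b iha ihb =>
    intro env Q Q' h h'
    exact iha h fun v t hv => ihb hv fun w t' hw => h' _ _ hw
  | hd a iha | tl a iha => intro env Q Q' h h'; exact iha h fun v t hv => h' _ _ hv
  | cond c a b ihc iha ihb =>
    intro env Q Q' h h'
    refine ihc h fun v t hv => ?_
    cases v with
    | nil => exact ihb hv fun w t' hw => h' _ _ hw
    | cons x y => exact iha hv fun w t' hw => h' _ _ hw
  | call f a iha =>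
    intro env Q Q' h h'
    refine iha h fun v t hv => ?_
    obtain ⟨b, w, t', hb, h1, h2⟩ := hv
    exact ⟨b, w, t', hb, h1, h' _ _ h2⟩

/-- The call of function `f` with argument `v` halts with value `w` after at most `T` steps. -/
def Sp (P : Program) (f : ℕ) (v w : Data) (T : ℕ) : Prop :=
  Call P f v fun w' t => w' = w ∧ t ≤ T

theorem Sp.mk {P : Program} {f : ℕ} {b : Expr} {v w : Data} {T : ℕ} (hb : P[f]? = some b)
    (h : wp P b [v] fun w' t => w' = w ∧ t ≤ T) : Sp P f v w T := by
  obtain ⟨w', t, h1, h2⟩ := wp_sound h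
  exact ⟨b, w', t, hb, h1, h2⟩

/-- The rule by which a specification enters a symbolic execution. Only an upper bound for the time
is known, so what follows has to hold for every `t ≤ T`. -/
theorem Sp.bind {P : Program} {f : ℕ} {v w : Data} {T : ℕ} {Q : Data → ℕ → Prop}
    (h : Sp P f v w T) (hQ : ∀ t ≤ T, Q w t) : Call P f v Q := by
  obtain ⟨b, w', t, hb, h1, rfl, h3⟩ := h
  exact ⟨b, _, t, hb, h1, hQ t h3⟩

theorem Sp.mono {P : Program} {f : ℕ} {v w : Data} {T T' : ℕ} (h : Sp P f v w T) (hT : T ≤ T') :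
    Sp P f v w T' := h.bind fun _ ht => ⟨rfl, ht.trans hT⟩

/-- Component `i` of a tuple (not the last one). -/
def nth : ℕ → Expr → Expr
  | 0, e => .hd e
  | i + 1, e => nth i (.tl e)

/-- What follows the first `i` components of a tuple. -/
def rest : ℕ → Expr → Expr
  | 0, e => e
  | i + 1, e => rest i (.tl e)

/-- The expression which builds a tuple. -/
def args : List Expr → Expr
  | [] => .nil
  | [e] => e
  | e :: e' :: l => .cons e (args (e' :: l))

/-- Component `i` of the argument. -/
def arg (i : ℕ) : Expr := nth i (.var 0)

/-- The argument from component `i` on. -/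
def argR (i : ℕ) : Expr := rest i (.var 0)

/-- A tuple of data. -/
def tup : List Data → Data
  | [] => .nil
  | [e] => e
  | e :: e' :: l => .cons e (tup (e' :: l))

/-- The truth value `true`. -/
def tru : Expr := .cons .nil .nil

/-- Number of entries of a list. -/
def Data.sp : Data → ℕ
  | .nil => 0
  | .cons _ y => y.sp + 1

/-- Number of constructors. -/
def Data.nodes : Data → ℕ
  | .nil => 1
  | .cons x y => x.nodes + y.nodes + 1

/-- Unary numbers. -/
def un : ℕ → Data
  | 0 => .nil
  | n + 1 => .cons .nil (un n)

@[simp] theorem sp_un (n : ℕ) : (un n).sp = n := by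
  induction n with
  | zero => rfl
  | succ n ih => simp [un, Data.sp, ih]

theorem encNat_zero : encNat 0 = .nil := by simp [encNat, encList]

theorem encNat_pos {x : ℕ} (h : x ≠ 0) :
    encNat x = .cons (encBool x.bodd) (encNat (x / 2)) := by
  unfold encNat
  conv_lhs => rw [← Nat.bit_bodd_div2 x]
  rw [Nat.bits_append_bit, Nat.div2_val]
  · rfl
  · intro h2
    by_contra h3
    apply h
    rw [← Nat.bit_bodd_div2 x, h2]
    simp at h3
    simp [h3]

@[simp] theorem hd_encNat (x : ℕ) : (encNat x).hd = encBool x.bodd := by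
  by_cases h : x = 0
  · subst h; rw [encNat_zero]; rfl
  · rw [encNat_pos h]; rfl

@[simp] theorem tl_encNat (x : ℕ) : (encNat x).tl = encNat (x / 2) := by
  by_cases h : x = 0
  · subst h; rw [encNat_zero]; rfl
  · rw [encNat_pos h]; rfl

@[simp] theorem cs_encNat (x : ℕ) (p q : Prop) : (encNat x).cs p q ↔ if x = 0 then p else q := by
  by_cases h : x = 0
  · subst h; rw [encNat_zero]; simp [Data.cs]
  · rw [encNat_pos h]; simp [Data.cs, h]

@[simp] theorem cs_encBool (b : Bool) (p q : Prop) :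
    (encBool b).cs p q ↔ if b then q else p := by
  cases b <;> simp [encBool, Data.cs]

/-- The side condition excludes `2 * 0 + 0`, whose encoding is `nil` and not a list with a
superfluous leading bit. For the same reason the program appends bits through `bitBody` and not by
`cons`. -/
theorem encNat_bit (b : Bool) (x : ℕ) (h : x ≠ 0 ∨ b = true) :
    encNat (2 * x + b.toNat) = .cons (encBool b) (encNat x) := by
  rw [encNat_pos (by rcases h with h | h <;> [skip; subst h] <;> simp <;> omega)]
  have : (2 * x + b.toNat) / 2 = x := by cases b <;> simp <;> omega
  rw [this]
  cases b <;> simp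

theorem sp_encNat (x : ℕ) : (encNat x).sp = x.size := by
  induction x using Nat.strong_induction_on with
  | _ x ih =>
    by_cases hx : x = 0
    · subst hx; simp [encNat_zero, Data.sp]
    · rw [encNat_pos hx, Data.sp, ih _ (by omega)]
      conv_rhs => rw [← Nat.bit_bodd_div2 x]
      rw [Nat.size_bit (by rwa [Nat.bit_bodd_div2]), Nat.div2_val]

/-- Needed because the cost of the equality test is measured in nodes; a bit takes at most `3`
nodes, and the `cons` that holds it one more. -/
theorem nodes_encNat_lt {b : ℕ} : ∀ {x : ℕ}, x < 2 ^ b → (encNat x).nodes ≤ 4 * b + 1 := by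
  induction b with
  | zero => intro x h; have : x = 0 := by omega
            subst this; simp [encNat_zero, Data.nodes]
  | succ b ih =>
    intro x h
    by_cases hx : x = 0
    · subst hx; simp [encNat_zero, Data.nodes]
    · rw [encNat_pos hx, Data.nodes]
      have := ih (x := x / 2) (by omega)
      have : (encBool x.bodd).nodes ≤ 3 := by cases x.bodd <;> simp [encBool, Data.nodes]
      omega

theorem encNat_injective : Function.Injective encNat := by
  intro x
  induction x using Nat.strong_induction_on with
  | _ x ih =>
    intro y h
    by_cases hx : x = 0
    · by_cases hy : y = 0
      · rw [hx, hy]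
      · rw [hx, encNat_zero, encNat_pos hy] at h; cases h
    · by_cases hy : y = 0
      · rw [hy, encNat_zero, encNat_pos hx] at h; cases h
      · rw [encNat_pos hx, encNat_pos hy] at h
        injection h with h1 h2
        have h2 := ih _ (by omega) h2
        have h1 : x.bodd = y.bodd := by
          revert h1; cases x.bodd <;> cases y.bodd <;> simp [encBool]
        rw [← Nat.bit_bodd_div2 x, ← Nat.bit_bodd_div2 y, h1, Nat.div2_val, Nat.div2_val, h2]

theorem encList_injective {α : Type} {enc : α → Data} (h : Function.Injective enc) :
    Function.Injective (encList enc) := by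
  intro x
  induction x with
  | nil => intro y hy; cases y with
    | nil => rfl
    | cons a l => cases hy
  | cons a l ih => intro y hy; cases y with
    | nil => cases hy
    | cons a' l' => injection hy with h1 h2; rw [h h1, ih h2]

@[simp] theorem sp_encList {α : Type} (enc : α → Data) (l : List α) :
    (encList enc l).sp = l.length := by
  induction l with
  | nil => rfl
  | cons a l ih => simp [encList, Data.sp, ih]

@[simp] theorem hd_cons (x y : Data) : (Data.cons x y).hd = x := rfl
@[simp] theorem tl_cons (x y : Data) : (Data.cons x y).tl = y := rfl
@[simp] theorem hd_nil : Data.nil.hd = .nil := rfl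
@[simp] theorem tl_nil : Data.nil.tl = .nil := rfl
@[simp] theorem cs_cons (x y : Data) (p q : Prop) : (Data.cons x y).cs p q = q := rfl
@[simp] theorem cs_nil (p q : Prop) : Data.nil.cs p q = p := rfl

theorem encNat_one : encNat 1 = .cons (.cons .nil .nil) .nil := by
  rw [encNat_pos one_ne_zero, Nat.div_eq_of_lt (by norm_num), encNat_zero]; rfl

/-- The rules of symbolic execution. -/
theorem exec :
    (∀ P i env Q, wp P (.var i) env Q = Q (look env i) 1) ∧
    (∀ P env Q, wp P .nil env Q = Q .nil 1) ∧
    (∀ P a b env Q, wp P (.cons a b) env Q =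
      wp P a env fun v t => wp P b env fun w t' => Q (.cons v w) (t + t' + 1)) ∧
    (∀ P a env Q, wp P (.hd a) env Q = wp P a env fun v t => Q v.hd (t + 1)) ∧
    (∀ P a env Q, wp P (.tl a) env Q = wp P a env fun v t => Q v.tl (t + 1)) ∧
    (∀ P c a b env Q, wp P (.cond c a b) env Q = wp P c env fun v t =>
      v.cs (wp P b env fun w t' => Q w (t + t' + 1)) (wp P a env fun w t' => Q w (t + t' + 1))) ∧
    (∀ P a b env Q, wp P (.bind a b) env Q =
      wp P a env fun v t => wp P b (v :: env) fun w t' => Q w (t + t' + 1)) ∧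
    (∀ P f a env Q, wp P (.call f a) env Q =
      wp P a env fun v t => Call P f v fun w t' => Q w (t + t' + 1)) ∧
    (∀ x l, look (x :: l) 0 = x) ∧ (∀ x l i, look (x :: l) (i + 1) = look l i) ∧
    (∀ e, args [e] = e) ∧ (∀ e e' l, args (e :: e' :: l) = .cons e (args (e' :: l))) ∧
    (∀ e, tup [e] = e) ∧ (∀ e e' l, tup (e :: e' :: l) = .cons e (tup (e' :: l))) ∧
    (∀ i, arg i = nth i (.var 0)) ∧ (∀ i, argR i = rest i (.var 0)) ∧
    (∀ e, nth 0 e = .hd e) ∧ (∀ i e, nth (i + 1) e = nth i (.tl e)) ∧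
    (∀ e, rest 0 e = e) ∧ (∀ i e, rest (i + 1) e = rest i (.tl e)) ∧
    (tru = .cons .nil .nil) ∧
    (∀ x y, (Data.cons x y).hd = x) ∧ (∀ x y, (Data.cons x y).tl = y) ∧
    (Data.nil.hd = .nil) ∧ (Data.nil.tl = .nil) ∧
    (∀ x y p q, (Data.cons x y).cs p q = q) ∧ (∀ p q, Data.nil.cs p q = p) ∧
    (∀ x, (encNat x).hd = encBool x.bodd) ∧ (∀ x, (encNat x).tl = encNat (x / 2)) ∧
    (∀ x p q, (encNat x).cs p q = if x = 0 then p else q) ∧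
    (∀ b p q, (encBool b).cs p q = if b then q else p) := by
  refine ⟨?_, ?_, ?_, ?_, ?_, ?_, ?_, ?_, ?_, ?_, ?_, ?_, ?_, ?_, ?_, ?_, ?_, ?_, ?_, ?_, ?_, ?_, ?_,
    ?_, ?_, ?_, ?_, hd_encNat, tl_encNat, fun x p q => propext (cs_encNat x p q),
    fun b p q => propext (cs_encBool b p q)⟩ <;> intros <;> rfl

end Lisp


namespace Lisp

/-! ### Elementary arithmetic -/

abbrev fBit : ℕ := 1
abbrev fAdd : ℕ := 2
abbrev fSub : ℕ := 3
abbrev fLt : ℕ := 4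
abbrev fMulS : ℕ := 5
abbrev fEq : ℕ := 6

/-- `(b, x) ↦ 2 x + b` -/
def bitBody : Expr := .cond (.tl (.var 0)) (.var 0) (.cond (.hd (.var 0)) (.var 0) .nil)

/-- Negation. -/
def notE (a : Expr) : Expr := .cond a .nil tru

/-- The sum of three bits. -/
def xorE (a b c : Expr) : Expr := .cond a (.cond b c (notE c)) (.cond b (notE c) c)

def addRec : Expr := .call fBit (args [xorE (arg 0) (.hd (arg 1)) (.hd (argR 2)),
  .call fAdd (args [.cond (arg 0) (.cond (.hd (arg 1)) tru (.hd (argR 2)))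
    (.cond (.hd (arg 1)) (.hd (argR 2)) .nil), .tl (arg 1), .tl (argR 2)])])

/-- `(c, x, y) ↦ x + y + c` -/
def addBody : Expr := .cond (arg 1) addRec (.cond (argR 2) addRec
  (.cond (arg 0) (.cons tru .nil) .nil))

/-- `(c, x, y) ↦ x - y - c` -/
def subBody : Expr := .cond (arg 1) (.call fBit (args [xorE (arg 0) (.hd (arg 1)) (.hd (argR 2)),
  .call fSub (args [.cond (.hd (arg 1)) (.cond (arg 0) (.hd (argR 2)) .nil)
    (.cond (arg 0) tru (.hd (argR 2))), .tl (arg 1), .tl (argR 2)])])) .nil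

def ltRec : Expr := .call fLt (args [.cond (.hd (arg 1)) (.cond (.hd (argR 2)) (arg 0) .nil)
  (.cond (.hd (argR 2)) tru (arg 0)), .tl (arg 1), .tl (argR 2)])

/-- `(c, x, y) ↦ (x < y + c)` -/
def ltBody : Expr := .cond (arg 1) ltRec (.cond (argR 2) ltRec (arg 0))

/-- `(x, y) ↦ x y`, by the school method -/
def mulSBody : Expr := .cond (arg 0) (.call fAdd (args [.nil, .cond (.hd (arg 0)) (argR 1) .nil,
  .call fBit (args [.nil, .call fMulS (args [.tl (arg 0), argR 1])])])) .nil

/-- Equality of data. -/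
def eqBody : Expr := .cond (arg 0)
  (.cond (argR 1) (.cond (.call fEq (args [.hd (arg 0), .hd (argR 1)]))
    (.call fEq (args [.tl (arg 0), .tl (argR 1)])) .nil) .nil)
  (.cond (argR 1) .nil tru)

/-- Specifications are proved for any program with the given bodies at the given places. Each layer
is thus independent of the later ones, and the concrete list of functions is inspected only once,
after the last layer. -/
class HasArith (P : Program) : Prop where
  bit : P[fBit]? = some bitBody
  add : P[fAdd]? = some addBody
  sub : P[fSub]? = some subBody
  lt : P[fLt]? = some ltBody
  mulS : P[fMulS]? = some mulSBody
  eq : P[fEq]? = some eqBody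

variable {P : Program} [HasArith P]

theorem bit_spec (b : Bool) (x : ℕ) :
    Sp P fBit (tup [encBool b, encNat x]) (encNat (2 * x + b.toNat)) 15 := by
  refine Sp.mk HasArith.bit ?_
  simp only [bitBody, exec]
  split_ifs with h1 h2
  · subst h1; subst h2; simp [encNat_zero, encBool, encNat_one]
  · subst h1; simp at h2; subst h2; simp [encNat_zero]
  · rw [encNat_bit b x (.inl h1)]; simp

theorem bodd_toNat_add (x : ℕ) : 2 * (x / 2) + x.bodd.toNat = x := by
  have := Nat.bodd_add_div2 x
  rw [Nat.div2_val] at this; omega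

theorem add_spec (b : ℕ) : ∀ (c : Bool) (x y : ℕ), x < 2 ^ b → y < 2 ^ b →
    Sp P fAdd (tup [encBool c, encNat x, encNat y]) (encNat (x + y + c.toNat)) (90 * (b + 1)) := by
  induction b with
  | zero =>
    intro c x y hx hy
    obtain rfl : x = 0 := by omega
    obtain rfl : y = 0 := by omega
    refine Sp.mk HasArith.add ?_
    cases c <;> simp [addBody, exec, encNat_zero, encNat_one]
  | succ b ih =>
    intro c x y hx hy
    refine Sp.mk HasArith.add ?_
    -- Two branches of `addBody` run this same expression, according to which of `x` and `y` is
    -- nonzero.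
    have key : wp P addRec [tup [encBool c, encNat x, encNat y]] fun w t =>
        w = encNat (x + y + c.toNat) ∧ t ≤ 90 * (b + 1) + 70 := by
      have hx2 := bodd_toNat_add x
      have hy2 := bodd_toNat_add y
      have hb (c : Bool) := ih c (x / 2) (y / 2) (by omega) (by omega)
      simp only [addRec, xorE, notE, exec]
      cases hxb : x.bodd <;> cases hyb : y.bodd <;> cases c <;>
        simp only [hxb, hyb, Bool.false_eq_true, if_true, if_false, Bool.toNat_true,
          Bool.toNat_false] at hx2 hy2 ⊢ <;>
        (first | refine (hb true).bind fun t ht => ?_ | refine (hb false).bind fun t ht => ?_) <;>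
        (first
          | (refine (bit_spec false _).bind fun t' ht' => ⟨?_, by omega⟩)
          | (refine (bit_spec true _).bind fun t' ht' => ⟨?_, by omega⟩)) <;>
        congr 1 <;> simp only [Bool.toNat_true, Bool.toNat_false] <;> omega
    simp only [addBody, exec]
    split_ifs with h1 h2 h3
    · subst h1 h2 h3; simp [encNat_one]; omega
    · subst h1 h2; simp at h3; subst h3; simp [encNat_zero]; omega
    · exact wp_mono key fun w t h => ⟨h.1, by omega⟩
    · exact wp_mono key fun w t h => ⟨h.1, by omega⟩

theorem sub_spec (b : ℕ) : ∀ (c : Bool) (x y : ℕ), x < 2 ^ b → y + c.toNat ≤ x →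
    Sp P fSub (tup [encBool c, encNat x, encNat y]) (encNat (x - (y + c.toNat)))
      (90 * (b + 1)) := by
  induction b with
  | zero =>
    intro c x y hx hy
    obtain rfl : x = 0 := by omega
    refine Sp.mk HasArith.sub ?_
    simp [subBody, exec, encNat_zero]
  | succ b ih =>
    intro c x y hx hy
    refine Sp.mk HasArith.sub ?_
    by_cases h : x = 0
    · subst h; simp [subBody, exec, encNat_zero]; omega
    have hx2 := bodd_toNat_add x
    have hy2 := bodd_toNat_add y
    have hb (c : Bool) := ih c (x / 2) (y / 2) (by omega)
    simp only [subBody, xorE, notE, exec, h, if_false]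
    cases hxb : x.bodd <;> cases hyb : y.bodd <;> cases c <;>
      simp only [hxb, hyb, Bool.false_eq_true, if_true, if_false, Bool.toNat_true,
        Bool.toNat_false] at hx2 hy2 hy ⊢ <;>
      (first
        | (refine Sp.bind (hb true ?_) fun t ht => ?_; (simp; omega))
        | (refine Sp.bind (hb false ?_) fun t ht => ?_; (simp; omega))) <;>
      (first
        | (refine (bit_spec false _).bind fun t' ht' => ⟨?_, by omega⟩)
        | (refine (bit_spec true _).bind fun t' ht' => ⟨?_, by omega⟩)) <;>
      congr 1 <;> simp only [Bool.toNat_true, Bool.toNat_false] <;> omega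

theorem lt_spec (b : ℕ) : ∀ (c : Bool) (x y : ℕ), x < 2 ^ b → y < 2 ^ b →
    Sp P fLt (tup [encBool c, encNat x, encNat y]) (encBool (decide (x < y + c.toNat)))
      (60 * (b + 1)) := by
  induction b with
  | zero =>
    intro c x y hx hy
    obtain rfl : x = 0 := by omega
    obtain rfl : y = 0 := by omega
    refine Sp.mk HasArith.lt ?_
    cases c <;> simp [ltBody, exec]
  | succ b ih =>
    intro c x y hx hy
    refine Sp.mk HasArith.lt ?_
    have key : wp P ltRec [tup [encBool c, encNat x, encNat y]] fun w t =>
        w = encBool (decide (x < y + c.toNat)) ∧ t ≤ 60 * (b + 1) + 50 := by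
      have hx2 := bodd_toNat_add x
      have hy2 := bodd_toNat_add y
      have hb (c : Bool) := ih c (x / 2) (y / 2) (by omega) (by omega)
      simp only [ltRec, exec]
      cases hxb : x.bodd <;> cases hyb : y.bodd <;> cases c <;>
        simp only [hxb, hyb, Bool.false_eq_true, if_true, if_false, Bool.toNat_true,
          Bool.toNat_false] at hx2 hy2 ⊢ <;>
        (first
          | (refine (hb true).bind fun t ht => ⟨?_, by omega⟩)
          | (refine (hb false).bind fun t ht => ⟨?_, by omega⟩)) <;>
        congr 1 <;> simp only [Bool.toNat_true, Bool.toNat_false, decide_eq_decide] <;> omega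
    simp only [ltBody, exec]
    split_ifs with h1 h2
    · subst h1 h2; cases c <;> simp <;> omega
    · exact wp_mono key fun w t h => ⟨h.1, by omega⟩
    · exact wp_mono key fun w t h => ⟨h.1, by omega⟩

/-- Quadratic time is harmless: this product is applied only to the coefficients at the bottom of
the fast multiplication, whose length is logarithmic in that of the factors. -/
theorem mulS_spec (p q : ℕ) : ∀ (x y : ℕ), x < 2 ^ p → y < 2 ^ q →
    Sp P fMulS (tup [encNat x, encNat y]) (encNat (x * y)) (140 * (p + 1) * (p + q + 1)) := by
  induction p with
  | zero =>
    intro x y hx hy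
    obtain rfl : x = 0 := by omega
    refine Sp.mk HasArith.mulS ?_
    simp [mulSBody, exec, encNat_zero]; omega
  | succ p ih =>
    intro x y hx hy
    refine Sp.mk HasArith.mulS ?_
    by_cases h : x = 0
    · subst h; simp [mulSBody, exec, encNat_zero]; nlinarith
    have hx2 := bodd_toNat_add x
    have hb := ih (x / 2) y (by omega) hy
    have hlt : 2 * (x / 2 * y) + false.toNat < 2 ^ (p + 1 + q) := by
      rw [pow_add]
      simp only [Bool.toNat_false, add_zero]
      calc 2 * (x / 2 * y) = (2 * (x / 2)) * y := by ring
        _ ≤ x * y := Nat.mul_le_mul_right _ (by omega)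
        _ < _ := Nat.mul_lt_mul'' hx hy
    have hy2 : y < 2 ^ (p + 1 + q) := hy.trans_le (Nat.pow_le_pow_right (by norm_num) (by omega))
    have hT : 140 * (p + 1 + 1) * (p + 1 + q + 1) = 140 * (p + 1) * (p + q + 1) + 140 * (p + 1)
      + 140 * (p + 1 + q + 1) := by ring
    simp only [mulSBody, exec, h, if_false]
    cases hxb : x.bodd <;>
      simp only [hxb, Bool.false_eq_true, if_true, if_false, Bool.toNat_true,
        Bool.toNat_false] at hx2 ⊢ <;>
      refine hb.bind fun t ht => ?_ <;> refine (bit_spec false _).bind fun t' ht' => ?_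
    · rw [← encNat_zero]
      refine (add_spec (p + 1 + q) false 0 _ (by positivity) hlt).bind fun t'' ht'' => ⟨?_, ?_⟩
      · congr 1; simp; rw [← mul_assoc]; congr 1
      · omega
    · refine (add_spec (p + 1 + q) false y _ hy2 hlt).bind fun t'' ht'' => ⟨?_, ?_⟩
      · congr 1; simp; conv_rhs => rw [← hx2]
        ring
      · omega

/-- The two trees are descended together and the descent stops where either of them ends, so the
time is controlled by the first tree alone. -/
theorem eq_spec [DecidableEq Data] : ∀ (x y : Data), Sp P fEq (tup [x, y])
    (encBool (decide (x = y))) (30 * x.nodes) := by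
  intro x
  induction x with
  | nil =>
    intro y; refine Sp.mk HasArith.eq ?_
    cases y <;> simp [eqBody, exec, encBool, Data.nodes]
  | cons a b iha ihb =>
    intro y; refine Sp.mk HasArith.eq ?_
    cases y with
    | nil => simp [eqBody, exec, encBool, Data.nodes]; omega
    | cons a' b' =>
      simp only [eqBody, exec, Data.nodes]
      refine (iha a').bind fun t ht => ?_
      simp only [exec]
      by_cases h : a = a'
      · subst h
        simp only [decide_true, if_true]
        refine (ihb b').bind fun t ht => ⟨?_, by omega⟩
        simp
      · simp [h, encBool]; omega

end Lisp


namespace Lisp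

/-! ### Lists -/

/-- Concatenation of lists. -/
def Data.app : Data → Data → Data
  | .nil, d => d
  | .cons x y, d => .cons x (y.app d)

/-- Removal of the first entries of a list. -/
def Data.drop : ℕ → Data → Data
  | 0, d => d
  | n + 1, d => Data.drop n d.tl

/-- The first entries of a list, continued by `nil`. -/
def Data.take : ℕ → Data → Data
  | 0, _ => .nil
  | n + 1, d => .cons d.hd (Data.take n d.tl)

theorem app_encList {α : Type} (enc : α → Data) (l l' : List α) :
    (encList enc l).app (encList enc l') = encList enc (l ++ l') := by
  induction l with
  | nil => rfl
  | cons a l ih => simp [encList, Data.app, ih]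

theorem app_un (m n : ℕ) : (un m).app (un n) = un (m + n) := by
  induction m with
  | zero => simp [un, Data.app]
  | succ m ih => rw [Nat.add_right_comm]; simp [un, Data.app, ih]

theorem sp_app (d d' : Data) : (d.app d').sp = d.sp + d'.sp := by
  induction d with
  | nil => simp [Data.app, Data.sp]
  | cons a l _ ih => simp [Data.app, Data.sp, ih]; omega

theorem drop_nil (u : ℕ) : Data.drop u .nil = .nil := by
  induction u with
  | zero => rfl
  | succ u ih => simp [Data.drop, ih]

theorem drop_encList {α : Type} (enc : α → Data) (u : ℕ) (l : List α) :
    (encList enc l).drop u = encList enc (l.drop u) := by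
  induction u generalizing l with
  | zero => rfl
  | succ u ih => cases l <;> simp [encList, Data.drop, ih, drop_nil]

theorem take_encList {α : Type} (enc : α → Data) (u : ℕ) (l : List α) (h : u ≤ l.length) :
    (encList enc l).take u = encList enc (l.take u) := by
  induction u generalizing l with
  | zero => rfl
  | succ u ih => cases l with
    | nil => simp at h
    | cons a l => simp at h; simp [encList, Data.take, ih l h]

theorem drop_un (u n : ℕ) : (un n).drop u = un (n - u) := by
  induction u generalizing n with
  | zero => rfl
  | succ u ih => cases n <;> simp [un, Data.drop, ih, drop_nil]

theorem drop_encNat (u x : ℕ) : (encNat x).drop u = encNat (x / 2 ^ u) := by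
  induction u generalizing x with
  | zero => simp [Data.drop]
  | succ u ih => simp [Data.drop, ih, pow_succ', Nat.div_div_eq_div_mul]

/-- A unary number is at the same time a list of empty lists; in this way the unary `m` serves as
the initial list of `m` empty columns in `colsBody`. -/
theorem un_eq_encList {α : Type} (enc : List α → Data) (h : enc [] = .nil) (n : ℕ) :
    un n = encList enc (List.replicate n []) := by
  induction n with
  | zero => rfl
  | succ n ih => simp [un, List.replicate_succ, encList, ih, h]

abbrev fApp : ℕ := 7
abbrev fDrop : ℕ := 8
abbrev fTake : ℕ := 9
abbrev fHalf : ℕ := 10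
abbrev fPw : ℕ := 11

def appBody : Expr :=
  .cond (arg 0) (.cons (.hd (arg 0)) (.call fApp (args [.tl (arg 0), argR 1]))) (argR 1)

def dropBody : Expr := .cond (arg 0) (.call fDrop (args [.tl (arg 0), .tl (argR 1)])) (argR 1)

def takeBody : Expr := .cond (arg 0)
  (.cons (.hd (argR 1)) (.call fTake (args [.tl (arg 0), .tl (argR 1)]))) .nil

/-- Half of the length of a list, in unary. -/
def halfBody : Expr := .cond (.var 0)
  (.cond (.tl (.var 0)) (.cons .nil (.call fHalf (.tl (.tl (.var 0))))) .nil) .nil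

/-- The power of `2` whose exponent is the length of a list, in unary. -/
def pwBody : Expr := .cond (.var 0)
  (.bind (.call fPw (.tl (.var 0))) (.call fApp (args [.var 0, .var 0]))) (.cons .nil .nil)

class HasList (P : Program) : Prop extends HasArith P where
  app : P[fApp]? = some appBody
  drop : P[fDrop]? = some dropBody
  take : P[fTake]? = some takeBody
  half : P[fHalf]? = some halfBody
  pw : P[fPw]? = some pwBody

section
variable {P : Program} [HasList P]

theorem app_spec (x y : Data) : Sp P fApp (tup [x, y]) (x.app y) (20 * (x.sp + 1)) := by
  induction x with
  | nil => exact Sp.mk HasList.app (by simp [appBody, exec, Data.app, Data.sp])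
  | cons a l _ ih =>
    refine Sp.mk HasList.app ?_
    simp only [appBody, exec, Data.sp]
    exact ih.bind fun t ht => ⟨rfl, by omega⟩

theorem drop_spec (u d : Data) : Sp P fDrop (tup [u, d]) (d.drop u.sp) (20 * (u.sp + 1)) := by
  induction u generalizing d with
  | nil => exact Sp.mk HasList.drop (by simp [dropBody, exec, Data.drop, Data.sp])
  | cons a l _ ih =>
    refine Sp.mk HasList.drop ?_
    simp only [dropBody, exec, Data.sp]
    exact (ih _).bind fun t ht => ⟨rfl, by omega⟩

theorem take_spec (u d : Data) : Sp P fTake (tup [u, d]) (d.take u.sp) (20 * (u.sp + 1)) := by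
  induction u generalizing d with
  | nil => exact Sp.mk HasList.take (by simp [takeBody, exec, Data.take, Data.sp])
  | cons a l _ ih =>
    refine Sp.mk HasList.take ?_
    simp only [takeBody, exec, Data.sp]
    exact (ih _).bind fun t ht => ⟨rfl, by omega⟩

theorem half_spec : ∀ d : Data, Sp P fHalf d (un (d.sp / 2)) (20 * (d.sp + 1))
  | .nil => Sp.mk HasList.half (by simp [halfBody, exec, Data.sp, un])
  | .cons a .nil => Sp.mk HasList.half (by simp [halfBody, exec, Data.sp, un])
  | .cons a (.cons b l) => by
    refine Sp.mk HasList.half ?_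
    simp only [halfBody, exec, Data.sp]
    refine (half_spec l).bind fun t ht => ⟨?_, by omega⟩
    rw [show (l.sp + 1 + 1) / 2 = l.sp / 2 + 1 by omega]; rfl

theorem pw_spec (d : Data) : Sp P fPw d (un (2 ^ d.sp)) (70 * 2 ^ d.sp) := by
  induction d with
  | nil => exact Sp.mk HasList.pw (by simp [pwBody, exec, Data.sp, un])
  | cons a l _ ih =>
    refine Sp.mk HasList.pw ?_
    simp only [pwBody, exec, Data.sp]
    refine ih.bind fun t ht => ?_
    refine (app_spec _ _).bind fun t' ht' => ⟨?_, ?_⟩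
    · rw [app_un, pow_succ, mul_two]
    · rw [sp_un] at ht'
      have := Nat.one_le_two_pow (n := l.sp)
      rw [pow_succ]; omega

end

/-! ### Polynomials as lists of coefficients -/

/-- The value at `x` of the polynomial with given coefficients. -/
def ev {R : Type*} [CommSemiring R] (x : R) : List ℕ → R
  | [] => 0
  | a :: l => a + x * ev x l

theorem ev_append {R : Type*} [CommSemiring R] (x : R) (l l' : List ℕ) :
    ev x (l ++ l') = ev x l + x ^ l.length * ev x l' := by
  induction l with
  | nil => simp [ev]
  | cons a l ih => simp [ev, ih, pow_succ]; ring

theorem ev_map {R S : Type*} [CommSemiring R] [CommSemiring S] (f : R →+* S) (x : R) (l : List ℕ) :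
    f (ev x l) = ev (f x) l := by
  induction l with
  | nil => simp [ev]
  | cons a l ih => simp [ev, ih]

theorem ev_replicate_zero {R : Type*} [CommSemiring R] (x : R) (n : ℕ) :
    ev x (List.replicate n 0) = 0 := by
  induction n with
  | zero => rfl
  | succ n ih => simp [List.replicate_succ, ev, ih]

/-- Addition of polynomials of the same length. -/
def vadd (l l' : List ℕ) : List ℕ := List.zipWith (· + ·) l l'

theorem ev_vadd {R : Type*} [CommSemiring R] (x : R) : ∀ (l l' : List ℕ), l.length = l'.length →
    ev x (vadd l l') = ev x l + ev x l'
  | [], [], _ => by simp [vadd, ev]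
  | a :: l, b :: l', h => by
    have ih := ev_vadd x l l' (by simpa using h)
    simp only [vadd] at ih
    simp [vadd, ev, ih]; ring

theorem length_vadd {l l' : List ℕ} (h : l.length = l'.length) : (vadd l l').length = l.length := by
  simp [vadd, h]

/-- All entries are less than `2 ^ b`. -/
def Bd (b : ℕ) (l : List ℕ) : Prop := ∀ x ∈ l, x < 2 ^ b

theorem Bd.mono {b b' : ℕ} {l : List ℕ} (h : Bd b l) (hb : b ≤ b') : Bd b' l :=
  fun x hx => (h x hx).trans_le (Nat.pow_le_pow_right (by norm_num) hb)

theorem vadd_lt {M M' : ℕ} : ∀ {l l' : List ℕ}, (∀ x ∈ l, x < M) → (∀ x ∈ l', x < M') →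
    ∀ x ∈ vadd l l', x < M + M'
  | [], _, _, _ => by intro x hx; simp [vadd] at hx
  | _ :: _, [], _, _ => by intro x hx; simp [vadd] at hx
  | a :: l, a' :: l', h, h' => by
    have ih := vadd_lt (l := l) (l' := l') (fun x hx => h x (by simp [hx]))
      (fun x hx => h' x (by simp [hx]))
    intro x hx
    simp only [vadd, List.zipWith_cons_cons, List.mem_cons] at hx
    rcases hx with rfl | hx
    · have := h a (by simp); have := h' a' (by simp); omega
    · exact ih x hx

theorem Bd.vadd {b : ℕ} {l l' : List ℕ} (h : Bd b l) (hl : Bd b l') : Bd (b + 1) (vadd l l') := by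
  intro x hx
  rw [pow_succ, mul_two]; exact vadd_lt h hl x hx

/-- Rotation to the left. -/
def lrot (d : ℕ) (l : List ℕ) : List ℕ := l.drop d ++ l.take d

@[simp] theorem length_lrot (d : ℕ) (l : List ℕ) : (lrot d l).length = l.length := by
  simp [lrot]; omega

theorem Bd.lrot {b : ℕ} {l : List ℕ} (d : ℕ) (h : Bd b l) : Bd b (lrot d l) := by
  intro x hx
  rcases List.mem_append.1 hx with hx | hx
  · exact h x (List.mem_of_mem_drop hx)
  · exact h x (List.mem_of_mem_take hx)

/-- If `y ^ l.length = 1`, the positions in `l` matter only cyclically, and moving every entry `d`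
places down divides the value by `y ^ d`. Multiplication by powers of this root of unity thus costs
a few list operations and no arithmetic. -/
theorem ev_lrot {R : Type*} [CommRing R] {y z : R} (hyz : y * z = 1) {d : ℕ} {l : List ℕ}
    (hd : d ≤ l.length) (hl : y ^ l.length = 1) : ev y (lrot d l) = z ^ d * ev y l := by
  have h1 : ev y l = ev y (l.take d) + y ^ d * ev y (l.drop d) := by
    conv_lhs => rw [← List.take_append_drop d l, ev_append]
    simp [hd]
  have h3 : y ^ (l.length - d) = z ^ d := by
    have : y ^ (l.length - d) * y ^ d = 1 := by rw [← pow_add, Nat.sub_add_cancel hd, hl]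
    calc y ^ (l.length - d) = y ^ (l.length - d) * (y * z) ^ d := by rw [hyz]; simp
      _ = (y ^ (l.length - d) * y ^ d) * z ^ d := by rw [mul_pow]; ring
      _ = z ^ d := by rw [this, one_mul]
  have h4 : z ^ d * y ^ d = 1 := by rw [← mul_pow, mul_comm, hyz, one_pow]
  rw [lrot, ev_append, List.length_drop, h3, h1, mul_add, ← mul_assoc, h4]; ring

/-- Cyclic convolution. -/
def conv : List ℕ → List ℕ → List ℕ
  | [], g => g.map (0 * ·)
  | a :: f, g => vadd (g.map (a * ·)) (lrot (g.length - 1) (conv f g))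

@[simp] theorem length_conv (f g : List ℕ) : (conv f g).length = g.length := by
  induction f with
  | nil => simp [conv]
  | cons a f ih => rw [conv, length_vadd] <;> simp [ih]

theorem ev_scale {R : Type*} [CommSemiring R] (x : R) (a : ℕ) (l : List ℕ) :
    ev x (l.map (a * ·)) = a * ev x l := by
  induction l with
  | nil => simp [ev]
  | cons b l ih => simp only [List.map_cons, ev, ih]; push_cast; ring

theorem ev_conv {R : Type*} [CommRing R] {y z : R} (hyz : y * z = 1) {f g : List ℕ}
    (hg : y ^ g.length = 1) (hg0 : g ≠ []) : ev y (conv f g) = ev y f * ev y g := by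
  have hl : 0 < g.length := List.length_pos_iff.2 hg0
  induction f with
  | nil => rw [conv, ev_scale]; simp [ev]
  | cons a f ih =>
    -- Rotation to the left by all places but one is multiplication by `y`, which makes `conv`
    -- Horner's scheme.
    have h3 : z ^ (g.length - 1) = y := by
      have h5 : z ^ g.length = 1 := by
        have : (y * z) ^ g.length = 1 := by rw [hyz, one_pow]
        rwa [mul_pow, hg, one_mul] at this
      calc z ^ (g.length - 1) = z ^ (g.length - 1) * (y * z) := by rw [hyz, mul_one]
        _ = y * z ^ (g.length - 1 + 1) := by ring
        _ = y := by rw [Nat.sub_add_cancel hl, h5, mul_one]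
    rw [conv, ev_vadd _ _ _ (by simp), ev_scale, ev_lrot hyz (by simp) (by simp [hg]), ih, h3, ev]
    ring

theorem Bd.scale {p q a : ℕ} {l : List ℕ} (ha : a < 2 ^ p) (h : Bd q l) :
    Bd (p + q) (l.map (a * ·)) := by
  intro x hx
  obtain ⟨y, hy, rfl⟩ := List.mem_map.1 hx
  rw [pow_add]; exact Nat.mul_lt_mul'' ha (h y hy)

/-- An entry of the convolution is a sum of `f.length` products of entries; the additional summand
keeps the inequality strict when `f` is empty. -/
theorem conv_lt {b : ℕ} {f g : List ℕ} (hf : Bd b f) (hg : Bd b g) :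
    ∀ x ∈ conv f g, x < (f.length + 1) * 2 ^ (2 * b) := by
  induction f with
  | nil =>
    intro x hx
    simp [conv] at hx
    simp [hx.2]
  | cons a f ih =>
    have ih := ih fun x hx => hf x (by simp [hx])
    have h1 := Bd.scale (hf a (by simp)) hg
    intro x hx
    rw [two_mul, pow_add] at *
    have := vadd_lt h1 (fun y hy => ih y
      ((List.mem_append.1 hy).elim List.mem_of_mem_drop List.mem_of_mem_take)) x hx
    rw [pow_add] at this
    simp only [List.length_cons]
    linarith

end Lisp


namespace Lisp

/-! ### Lists of polynomials -/

/-- A list of polynomials of length `l` with coefficients less than `2 ^ b`. -/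
def Mat (l b : ℕ) (us : List (List ℕ)) : Prop := ∀ u ∈ us, u.length = l ∧ Bd b u

theorem Mat.mono {l b b' : ℕ} {us : List (List ℕ)} (h : Mat l b us) (hb : b ≤ b') : Mat l b' us :=
  fun u hu => ⟨(h u hu).1, (h u hu).2.mono hb⟩

theorem Mat.of_cons {l b : ℕ} {u : List ℕ} {us : List (List ℕ)} (h : Mat l b (u :: us)) :
    u.length = l ∧ Bd b u ∧ Mat l b us :=
  ⟨(h u (by simp)).1, (h u (by simp)).2, fun v hv => h v (by simp [hv])⟩

theorem Mat.cons {l b : ℕ} {u : List ℕ} {us : List (List ℕ)} (h1 : u.length = l) (h2 : Bd b u)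
    (h3 : Mat l b us) : Mat l b (u :: us) := by
  intro v hv
  rcases List.mem_cons.1 hv with rfl | hv
  · exact ⟨h1, h2⟩
  · exact h3 v hv

theorem Mat.nil {l b : ℕ} : Mat l b [] := by simp [Mat]

theorem Mat.append {l b : ℕ} {us vs : List (List ℕ)} (h : Mat l b us) (h' : Mat l b vs) :
    Mat l b (us ++ vs) := fun u hu => (List.mem_append.1 hu).elim (h u) (h' u)

theorem Mat.take {l b : ℕ} {us : List (List ℕ)} (n : ℕ) (h : Mat l b us) : Mat l b (us.take n) :=
  fun u hu => h u (List.mem_of_mem_take hu)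

theorem Mat.drop {l b : ℕ} {us : List (List ℕ)} (n : ℕ) (h : Mat l b us) : Mat l b (us.drop n) :=
  fun u hu => h u (List.mem_of_mem_drop hu)

/-- The value of a polynomial in two variables. -/
def ev2 {R : Type*} [CommSemiring R] (x y : R) : List (List ℕ) → R
  | [] => 0
  | f :: l => ev y f + x * ev2 x y l

theorem ev2_append {R : Type*} [CommSemiring R] (x y : R) (l l' : List (List ℕ)) :
    ev2 x y (l ++ l') = ev2 x y l + x ^ l.length * ev2 x y l' := by
  induction l with
  | nil => simp [ev2]
  | cons a l ih => simp [ev2, ih, pow_succ]; ring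

theorem ev2_of_nil {R : Type*} [CommSemiring R] (x y : R) {l : List (List ℕ)}
    (h : ∀ u ∈ l, u = []) : ev2 x y l = 0 := by
  induction l with
  | nil => rfl
  | cons u l ih => rw [ev2, h u (by simp), ih fun v hv => h v (by simp [hv])]; simp [ev]

/-- `u + y ^ (-d) v`, entry by entry. -/
def mar (d : ℕ) (us vs : List (List ℕ)) : List (List ℕ) :=
  List.zipWith (fun u v => vadd u (lrot d v)) us vs

theorem mar_spec {l b d : ℕ} : ∀ {us vs : List (List ℕ)}, us.length = vs.length →
    Mat l b us → Mat l b vs → (mar d us vs).length = us.length ∧ Mat l (b + 1) (mar d us vs)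
  | [], [], _, _, _ => by simp [mar, Mat]
  | u :: us, v :: vs, h, hu, hv => by
    obtain ⟨hu1, hu2, hu3⟩ := hu.of_cons
    obtain ⟨hv1, hv2, hv3⟩ := hv.of_cons
    obtain ⟨h1, h2⟩ := mar_spec (d := d) (by simpa using h) hu3 hv3
    simp only [mar, List.zipWith_cons_cons, List.length_cons] at h1 h2 ⊢
    refine ⟨by rw [h1], Mat.cons ?_ (hu2.vadd (hv2.lrot d)) h2⟩
    rw [length_vadd] <;> simp [hu1, hv1]

/-- This one operation does three things in the transform: it reduces `u + X ^ h * v` modulo `X ^ h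
- z ^ d`, it adds for `d = 0`, and it subtracts when `z ^ d = -1`. -/
theorem ev2_mar {R : Type*} [CommRing R] (x : R) {y z : R} (hyz : y * z = 1) {l b d : ℕ}
    (hd : d ≤ l) (hl : y ^ l = 1) : ∀ {us vs : List (List ℕ)}, us.length = vs.length →
    Mat l b us → Mat l b vs → ev2 x y (mar d us vs) = ev2 x y us + z ^ d * ev2 x y vs
  | [], [], _, _, _ => by simp [mar, ev2]
  | u :: us, v :: vs, h, hu, hv => by
    obtain ⟨hu1, hu2, hu3⟩ := hu.of_cons
    obtain ⟨hv1, hv2, hv3⟩ := hv.of_cons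
    have ih := ev2_mar x hyz hd hl (by simpa using h) hu3 hv3
    simp only [mar, List.zipWith_cons_cons] at ih ⊢
    rw [ev2, ih, ev_vadd _ _ _ (by simp [hu1, hv1]), ev_lrot hyz (by omega) (by rwa [hv1]), ev2, ev2]
    ring

theorem mrot_spec {l b : ℕ} (d : ℕ) {us : List (List ℕ)} (h : Mat l b us) :
    Mat l b (us.map (lrot d)) := by
  intro u hu
  obtain ⟨v, hv, rfl⟩ := List.mem_map.1 hu
  exact ⟨by simp [(h v hv).1], (h v hv).2.lrot d⟩

theorem ev2_mrot {R : Type*} [CommRing R] (x : R) {y z : R} (hyz : y * z = 1) {l b d : ℕ}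
    (hd : d ≤ l) (hl : y ^ l = 1) {us : List (List ℕ)} (h : Mat l b us) :
    ev2 x y (us.map (lrot d)) = z ^ d * ev2 x y us := by
  induction us with
  | nil => simp [ev2]
  | cons u us ih =>
    obtain ⟨hu1, hu2, hu3⟩ := h.of_cons
    rw [List.map_cons, ev2, ih hu3, ev_lrot hyz (by omega) (by rwa [hu1]), ev2]
    ring

/-- The rows of length `m` of a list become the columns of a matrix. -/
def cols (m : ℕ) : ℕ → List ℕ → List (List ℕ)
  | 0, _ => List.replicate m []
  | c + 1, f => List.zipWith List.cons (f.take m) (cols m c (f.drop m))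

theorem zipCons_spec {l b : ℕ} : ∀ {row : List ℕ} {cs : List (List ℕ)}, row.length = cs.length →
    Bd b row → Mat l b cs → (List.zipWith List.cons row cs).length = cs.length ∧
      Mat (l + 1) b (List.zipWith List.cons row cs)
  | [], [], _, _, _ => by simp [Mat]
  | a :: row, u :: cs, h, hr, hc => by
    obtain ⟨hu1, hu2, hu3⟩ := hc.of_cons
    obtain ⟨h1, h2⟩ := zipCons_spec (row := row) (by simpa using h)
      (fun x hx => hr x (by simp [hx])) hu3
    refine ⟨by simp at h; simp [h], Mat.cons (by simp [hu1]) ?_ h2⟩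
    intro x hx
    rcases List.mem_cons.1 hx with rfl | hx
    · exact hr _ (by simp)
    · exact hu2 x hx

theorem ev2_zipCons {R : Type*} [CommSemiring R] (x y : R) :
    ∀ {row : List ℕ} {cs : List (List ℕ)}, row.length = cs.length →
    ev2 x y (List.zipWith List.cons row cs) = ev x row + y * ev2 x y cs
  | [], [], _ => by simp [ev2, ev]
  | a :: row, u :: cs, h => by
    have ih := ev2_zipCons x y (row := row) (cs := cs) (by simpa using h)
    simp only [List.zipWith_cons_cons, ev2, ih, ev]
    ring

theorem cols_spec {m b : ℕ} (c : ℕ) : ∀ {f : List ℕ}, f.length = m * c → Bd b f →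
    (cols m c f).length = m ∧ Mat c b (cols m c f) := by
  induction c with
  | zero => intro f hf hb; simp [cols, Mat, Bd]
  | succ c ih =>
    intro f hf hb
    obtain ⟨h1, h2⟩ := ih (f := f.drop m) (by simp [hf, mul_add])
      (fun x hx => hb x (List.mem_of_mem_drop hx))
    obtain ⟨h3, h4⟩ := zipCons_spec (row := f.take m)
      (by rw [h1]; simp [hf, mul_add]) (fun x hx => hb x (List.mem_of_mem_take hx)) h2
    exact ⟨by rw [cols, h3, h1], h4⟩

/-- The coefficient of `x ^ (i + m * j)` with `i < m` is entry `j` of column `i`, where it belongs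
to `x ^ i * (x ^ m) ^ j`. -/
theorem ev2_cols {R : Type*} [CommSemiring R] (x : R) {m : ℕ} (c : ℕ) : ∀ {f : List ℕ},
    f.length = m * c → ev2 x (x ^ m) (cols m c f) = ev x f := by
  induction c with
  | zero =>
    intro f hf
    have : f = [] := by simpa using hf
    subst this
    exact ev2_of_nil _ _ (by simp [cols])
  | succ c ih =>
    intro f hf
    have hl : (f.drop m).length = m * c := by simp [hf, mul_add]
    -- Only the length is wanted from `cols_spec`, so any bound for the entries will do.
    have h1 := (cols_spec (b := (f.drop m).sum + 1) c hl (fun x hx => by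
      have := List.single_le_sum (fun _ _ => Nat.zero_le _) x hx
      exact this.trans_lt ((Nat.lt_succ_self _).trans (Nat.lt_two_pow_self)))).1
    have ht : (f.take m).length = m := by simp [hf, mul_add]
    rw [cols, ev2_zipCons x _ (by rw [h1, ht]), ih hl]
    conv_rhs => rw [← List.take_append_drop m f, ev_append, ht]

/-- Inverse of `cols`. -/
def uncols : ℕ → List (List ℕ) → List ℕ
  | 0, _ => []
  | c + 1, cs => cs.map (·.headD 0) ++ uncols c (cs.map List.tail)

theorem heads_tails {R : Type*} [CommSemiring R] (x y : R) {c b : ℕ} {cs : List (List ℕ)}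
    (h : Mat (c + 1) b cs) : Bd b (cs.map (·.headD 0)) ∧ Mat c b (cs.map List.tail) ∧
      ev2 x y cs = ev x (cs.map (·.headD 0)) + y * ev2 x y (cs.map List.tail) := by
  induction cs with
  | nil => simp [Bd, Mat, ev, ev2]
  | cons u cs ih =>
    obtain ⟨hu1, hu2, hu3⟩ := h.of_cons
    obtain ⟨h1, h2, h3⟩ := ih hu3
    cases u with
    | nil => simp at hu1
    | cons a u =>
      refine ⟨?_, Mat.cons (by simpa using hu1) (fun x hx => hu2 x ?_) h2, ?_⟩
      · intro x hx
        rcases List.mem_cons.1 hx with rfl | hx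
        · exact hu2 _ (by simp)
        · exact h1 x hx
      · simp at hx; simp [hx]
      · simp only [List.map_cons, List.headD_cons, List.tail_cons, ev2, ev, h3]
        ring

theorem uncols_spec {b : ℕ} (c : ℕ) : ∀ {cs : List (List ℕ)}, Mat c b cs →
    (uncols c cs).length = cs.length * c ∧ Bd b (uncols c cs) := by
  induction c with
  | zero => intro cs _; simp [uncols, Bd]
  | succ c ih =>
    intro cs h
    obtain ⟨h1, h2, -⟩ := heads_tails (0 : ℕ) 0 h
    obtain ⟨h3, h4⟩ := ih h2
    refine ⟨?_, fun x hx => (List.mem_append.1 hx).elim (h1 x) (h4 x)⟩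
    simp only [uncols, List.length_append, List.length_map, h3]; ring

theorem ev_uncols {R : Type*} [CommSemiring R] (x : R) {b m : ℕ} (c : ℕ) :
    ∀ {cs : List (List ℕ)}, Mat c b cs → cs.length = m →
    ev x (uncols c cs) = ev2 x (x ^ m) cs := by
  induction c with
  | zero =>
    intro cs h _
    rw [ev2_of_nil _ _ fun u hu => by simpa using (h u hu).1]; rfl
  | succ c ih =>
    intro cs h hm
    obtain ⟨h1, h2, h3⟩ := heads_tails x (x ^ m) h
    rw [uncols, ev_append, h3, ih h2 (by simpa using hm)]; simp [hm]

end Lisp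


/-! ### Programs for coefficient lists and matrices, with running times -/

namespace Lisp

abbrev fVadd : ℕ := 12
abbrev fLrot : ℕ := 13
abbrev fMar : ℕ := 14
abbrev fMrot : ℕ := 15
abbrev fScale : ℕ := 16
abbrev fConv : ℕ := 17
abbrev fCols : ℕ := 18
abbrev fZc : ℕ := 19
abbrev fHeads : ℕ := 20
abbrev fTails : ℕ := 21
abbrev fUncols : ℕ := 22

def vaddBody : Expr := .cond (arg 0)
  (.cons (.call fAdd (args [.nil, .hd (arg 0), .hd (argR 1)]))
    (.call fVadd (args [.tl (arg 0), .tl (argR 1)]))) .nil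

def lrotBody : Expr := .call fApp (args [.call fDrop (.var 0), .call fTake (.var 0)])

def marBody : Expr := .cond (arg 1)
  (.cons (.call fVadd (args [.hd (arg 1), .call fLrot (args [arg 0, .hd (argR 2)])]))
    (.call fMar (args [arg 0, .tl (arg 1), .tl (argR 2)]))) .nil

def mrotBody : Expr := .cond (argR 1)
  (.cons (.call fLrot (args [arg 0, .hd (argR 1)])) (.call fMrot (args [arg 0, .tl (argR 1)]))) .nil

def scaleBody : Expr := .cond (argR 1)
  (.cons (.call fMulS (args [arg 0, .hd (argR 1)])) (.call fScale (args [arg 0, .tl (argR 1)]))) .nil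

def convBody : Expr := .cond (arg 0)
  (.call fVadd (args [.call fScale (args [.hd (arg 0), argR 1]),
    .call fLrot (args [.tl (argR 1), .call fConv (args [.tl (arg 0), argR 1])])]))
  (.call fScale (args [.nil, argR 1]))

def zcBody : Expr := .cond (arg 0)
  (.cons (.cons (.hd (arg 0)) (.hd (argR 1))) (.call fZc (args [.tl (arg 0), .tl (argR 1)]))) .nil

def colsBody : Expr := .cond (argR 1)
  (.call fZc (args [.call fTake (.var 0), .call fCols (args [arg 0, .call fDrop (.var 0)])])) (arg 0)

def headsBody : Expr :=
  .cond (.var 0) (.cons (.hd (.hd (.var 0))) (.call fHeads (.tl (.var 0)))) .nil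

def tailsBody : Expr :=
  .cond (.var 0) (.cons (.tl (.hd (.var 0))) (.call fTails (.tl (.var 0)))) .nil

def uncolsBody : Expr := .cond (arg 0)
  (.call fApp (args [.call fHeads (argR 1),
    .call fUncols (args [.tl (arg 0), .call fTails (argR 1)])])) .nil

class HasVec (P : Program) : Prop extends HasList P where
  vadd : P[fVadd]? = some vaddBody
  lrot : P[fLrot]? = some lrotBody
  mar : P[fMar]? = some marBody
  mrot : P[fMrot]? = some mrotBody
  scale : P[fScale]? = some scaleBody
  conv : P[fConv]? = some convBody
  cols : P[fCols]? = some colsBody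
  zc : P[fZc]? = some zcBody
  heads : P[fHeads]? = some headsBody
  tails : P[fTails]? = some tailsBody
  uncols : P[fUncols]? = some uncolsBody

/-- Encoding of a list of numbers. -/
abbrev E1 : List ℕ → Data := encList encNat

/-- Encoding of a list of lists of numbers. -/
abbrev E2 : List (List ℕ) → Data := encList (encList encNat)

variable {P : Program} [HasVec P]

theorem vadd_run {b : ℕ} : ∀ {f g : List ℕ}, f.length = g.length → Bd b f → Bd b g →
    Sp P fVadd (tup [E1 f, E1 g]) (E1 (vadd f g)) (130 * (b + 1) * (f.length + 1))
  | [], [], _, _, _ => Sp.mk HasVec.vadd (by simp [vaddBody, exec, encList, vadd]; omega)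
  | x :: f, y :: g, h, hf, hg => by
    refine Sp.mk HasVec.vadd ?_
    have ih := vadd_run (f := f) (g := g) (by simpa using h) (fun x hx => hf x (by simp [hx]))
      (fun x hx => hg x (by simp [hx]))
    simp only [vaddBody, exec, encList]
    refine (add_spec b false x y (hf x (by simp)) (hg y (by simp))).bind fun t ht => ?_
    refine ih.bind fun t' ht' => ⟨?_, ?_⟩
    · simp [vadd, encList]
    · simp only [List.length_cons]
      rw [mul_add _ (f.length + 1)]; omega

theorem lrot_run (u : Data) (l : List ℕ) (h : u.sp ≤ l.length) :
    Sp P fLrot (tup [u, E1 l]) (E1 (lrot u.sp l)) (100 * (l.length + 1)) := by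
  refine Sp.mk HasVec.lrot ?_
  simp only [lrotBody, exec]
  refine (drop_spec _ _).bind fun t ht => ?_
  refine (take_spec _ _).bind fun t' ht' => ?_
  refine (app_spec _ _).bind fun t'' ht'' => ?_
  rw [drop_encList, take_encList _ _ _ h, app_encList]
  rw [drop_encList, sp_encList, List.length_drop] at ht''
  exact ⟨rfl, by omega⟩

theorem mar_run {l b : ℕ} (u : Data) (hu : u.sp ≤ l) : ∀ {us vs : List (List ℕ)},
    us.length = vs.length → Mat l b us → Mat l b vs →
    Sp P fMar (tup [u, E2 us, E2 vs]) (E2 (mar u.sp us vs))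
      (300 * (b + 1) * (l + 1) * (us.length + 1))
  | [], [], _, _, _ => Sp.mk HasVec.mar (by
      simp [marBody, exec, encList, mar]
      have : 1 ≤ (b + 1) * (l + 1) := Nat.mul_pos (by simp) (by simp)
      rw [mul_assoc]; omega)
  | x :: us, y :: vs, h, h1, h2 => by
    obtain ⟨h11, h12, h13⟩ := h1.of_cons
    obtain ⟨h21, h22, h23⟩ := h2.of_cons
    refine Sp.mk HasVec.mar ?_
    have ih := mar_run u hu (by simpa using h) h13 h23
    simp only [marBody, exec, encList]
    refine (lrot_run u y (by omega)).bind fun t ht => ?_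
    refine (vadd_run (b := b) (by simp [h11, h21]) h12 (h22.lrot _)).bind fun t' ht' => ?_
    refine ih.bind fun t'' ht'' => ⟨?_, ?_⟩
    · simp [mar, encList]
    · have : l + 1 ≤ (b + 1) * (l + 1) := Nat.le_mul_of_pos_left _ (by simp)
      simp only [List.length_cons]
      rw [mul_add _ (us.length + 1), mul_one, mul_assoc 300 (b + 1)]
      rw [h11, mul_assoc] at ht'
      rw [h21] at ht
      rw [mul_assoc 300 (b + 1)] at ht''
      omega

theorem mrot_run {l b : ℕ} (u : Data) (hu : u.sp ≤ l) {us : List (List ℕ)} (h : Mat l b us) :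
    Sp P fMrot (tup [u, E2 us]) (E2 (us.map (lrot u.sp))) (130 * (l + 1) * (us.length + 1)) := by
  induction us with
  | nil => exact Sp.mk HasVec.mrot (by simp [mrotBody, exec, encList]; omega)
  | cons x us ih =>
    obtain ⟨h11, h12, h13⟩ := h.of_cons
    refine Sp.mk HasVec.mrot ?_
    simp only [mrotBody, exec, encList]
    refine (lrot_run u x (by omega)).bind fun t ht => ?_
    refine (ih h13).bind fun t'' ht'' => ⟨?_, ?_⟩
    · simp [encList]
    · simp only [List.length_cons]
      rw [mul_add _ (us.length + 1), mul_one]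
      rw [h11] at ht
      omega

theorem scale_run {b a : ℕ} (ha : a < 2 ^ b) {l : List ℕ} (h : Bd b l) :
    Sp P fScale (tup [encNat a, E1 l]) (E1 (l.map (a * ·))) (320 * (b + 1) ^ 2 * (l.length + 1)) := by
  have hb : 1 ≤ (b + 1) ^ 2 := Nat.one_le_pow _ _ (by simp)
  induction l with
  | nil => exact Sp.mk HasVec.scale (by simp [scaleBody, exec, encList]; omega)
  | cons x l ih =>
    refine Sp.mk HasVec.scale ?_
    simp only [scaleBody, exec, encList]
    refine (mulS_spec b b a x ha (h x (by simp))).bind fun t ht => ?_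
    refine (ih fun x hx => h x (by simp [hx])).bind fun t'' ht'' => ⟨?_, ?_⟩
    · simp [encList]
    · simp only [List.length_cons]
      rw [mul_add _ (l.length + 1), mul_one]
      have : 140 * (b + 1) * (b + b + 1) ≤ 280 * (b + 1) ^ 2 := by nlinarith
      omega

/-- Only the bottom of the recursion, with at most `4` coefficients, uses direct convolution. At
most a factor `2 ^ 3` then accrues beyond the `2 * b` bits of a product, whence the hypothesis on
`B`. -/
theorem conv_run {b B : ℕ} (hB : 2 * b + 3 ≤ B) {g : List ℕ} (hg : Bd b g) (hg0 : g ≠ []) :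
    ∀ {f : List ℕ}, f.length ≤ 4 → Bd b f → Sp P fConv (tup [E1 f, E1 g]) (E1 (conv f g))
      ((f.length + 1) * (700 * (B + 1) ^ 2 * (g.length + 1))) := by
  have hs : 320 * (b + 1) ^ 2 * (g.length + 1) ≤ 320 * ((B + 1) ^ 2 * (g.length + 1)) := by
    rw [mul_assoc]; gcongr; omega
  have hl : g.length + 1 ≤ (B + 1) ^ 2 * (g.length + 1) := Nat.le_mul_of_pos_left _ (by positivity)
  have hl2 : (B + 1) * (g.length + 1) ≤ (B + 1) ^ 2 * (g.length + 1) := by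
    gcongr; exact Nat.le_self_pow (by simp) _
  intro f
  induction f with
  | nil =>
    intro hf4 hf
    refine Sp.mk HasVec.conv ?_
    simp only [convBody, exec, encList]
    rw [← encNat_zero]
    refine (scale_run (b := b) (by positivity) hg).bind fun t ht => ⟨rfl, ?_⟩
    simp only [List.length_nil, zero_add, one_mul, mul_assoc]
    omega
  | cons a f ih =>
    intro hf4 hf
    refine Sp.mk HasVec.conv ?_
    cases g with
    | nil => simp at hg0
    | cons c g =>
      have hfb : Bd b f := fun x hx => hf x (by simp [hx])
      have hcv : Bd B (conv f (c :: g)) := by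
        intro x hx
        refine (conv_lt hfb hg x hx).trans_le (le_trans ?_ (Nat.pow_le_pow_right (by norm_num) hB))
        rw [pow_add, mul_comm]
        simp at hf4
        gcongr; omega
      have hsc : Bd B ((c :: g).map (a * ·)) :=
        (Bd.scale (hf a (by simp)) hg).mono (by omega)
      simp only [convBody, exec, encList]
      refine (scale_run (l := c :: g) (hf a (by simp)) hg).bind fun t ht => ?_
      refine (ih (by simp at hf4; omega) hfb).bind fun t1 ht1 => ?_
      refine (lrot_run (E1 g) _ (by simp)).bind fun t2 ht2 => ?_
      refine (vadd_run (b := B) (by simp) hsc (hcv.lrot _)).bind fun t3 ht3 => ⟨?_, ?_⟩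
      · simp [conv]
      · simp only [length_conv, List.length_map] at ht2 ht3
        rw [List.length_cons, add_mul (f.length + 1), one_mul]
        simp only [mul_assoc] at *
        omega

theorem zc_run : ∀ {row : List ℕ} {cs : List (List ℕ)}, row.length = cs.length →
    Sp P fZc (tup [E1 row, E2 cs]) (E2 (List.zipWith List.cons row cs)) (40 * (row.length + 1))
  | [], [], _ => Sp.mk HasVec.zc (by simp [zcBody, exec, encList])
  | x :: row, y :: cs, h => by
    refine Sp.mk HasVec.zc ?_
    simp only [zcBody, exec, encList]
    refine (zc_run (by simpa using h)).bind fun t ht => ⟨?_, ?_⟩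
    · simp [encList]
    · simp only [List.length_cons]; omega

theorem cols_run {m : ℕ} (hm : 0 < m) (c : ℕ) : ∀ {f : List ℕ}, f.length = m * c →
    Sp P fCols (tup [un m, E1 f]) (E2 (cols m c f)) (130 * (m + 1) * (c + 1)) := by
  induction c with
  | zero =>
    intro f hf
    obtain rfl : f = [] := by simpa using hf
    refine Sp.mk HasVec.cols ?_
    simp only [colsBody, exec, encList]
    refine ⟨?_, by omega⟩
    exact un_eq_encList E1 rfl m
  | succ c ih =>
    intro f hf
    have hl : (f.drop m).length = m * c := by simp [hf, mul_add]
    have ht : (f.take m).length = m := by simp [hf, mul_add]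
    have hb : Bd f.sum f := fun x hx =>
      (List.single_le_sum (fun _ _ => Nat.zero_le _) x hx).trans_lt Nat.lt_two_pow_self
    have hc := (cols_spec c hl fun x hx => hb x (List.mem_of_mem_drop hx)).1
    refine Sp.mk HasVec.cols ?_
    -- The program recurses until the list is exhausted, whereas `cols` counts `c` down; for `m > 0`
    -- both end together.
    have hf0 : f ≠ [] := by
      rintro rfl; simp at hf; omega
    obtain ⟨a, f', rfl⟩ := List.exists_cons_of_ne_nil hf0
    have e : E1 (a :: f') = .cons (encNat a) (E1 f') := rfl
    simp only [colsBody, exec]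
    rw [e]
    simp only [exec]
    rw [← e]
    refine (take_spec (un m) (E1 (a :: f'))).bind fun t ht => ?_
    refine (drop_spec (un m) (E1 (a :: f'))).bind fun t' ht' => ?_
    rw [take_encList _ _ _ (by rw [hf, sp_un]; nlinarith), drop_encList]
    simp only [sp_un] at ht ht' ⊢
    refine (ih hl).bind fun t1 ht1 => ?_
    refine (zc_run (by rw [hc]; assumption)).bind fun t2 ht2 => ⟨rfl, ?_⟩
    rw [mul_add _ (c + 1)]
    have : (List.take m (a :: f')).length = m := by assumption
    omega

theorem heads_run {c b : ℕ} {cs : List (List ℕ)} (h : Mat (c + 1) b cs) :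
    Sp P fHeads (E2 cs) (E1 (cs.map (·.headD 0))) (25 * (cs.length + 1)) := by
  induction cs with
  | nil => exact Sp.mk HasVec.heads (by simp [headsBody, exec, encList])
  | cons u cs ih =>
    obtain ⟨h1, h2, h3⟩ := h.of_cons
    cases u with
    | nil => simp at h1
    | cons a u =>
      refine Sp.mk HasVec.heads ?_
      simp only [headsBody, exec, encList]
      refine (ih h3).bind fun t ht => ⟨by simp [encList], by simp only [List.length_cons]; omega⟩

theorem tails_run {c b : ℕ} {cs : List (List ℕ)} (h : Mat (c + 1) b cs) :
    Sp P fTails (E2 cs) (E2 (cs.map List.tail)) (25 * (cs.length + 1)) := by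
  induction cs with
  | nil => exact Sp.mk HasVec.tails (by simp [tailsBody, exec, encList])
  | cons u cs ih =>
    obtain ⟨h1, h2, h3⟩ := h.of_cons
    cases u with
    | nil => simp at h1
    | cons a u =>
      refine Sp.mk HasVec.tails ?_
      simp only [tailsBody, exec, encList]
      refine (ih h3).bind fun t ht => ⟨by simp [encList], by simp only [List.length_cons]; omega⟩

theorem uncols_run {b : ℕ} (u : Data) : ∀ {cs : List (List ℕ)}, Mat u.sp b cs →
    Sp P fUncols (tup [u, E2 cs]) (E1 (uncols u.sp cs)) (130 * (cs.length + 1) * (u.sp + 1)) := by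
  induction u with
  | nil =>
    intro cs h
    exact Sp.mk HasVec.uncols (by simp [uncolsBody, exec, encList, uncols, Data.sp]; omega)
  | cons a u _ ih =>
    intro cs h
    simp only [Data.sp] at h
    refine Sp.mk HasVec.uncols ?_
    simp only [uncolsBody, exec, Data.sp]
    refine (heads_run h).bind fun t ht => ?_
    refine (tails_run h).bind fun t1 ht1 => ?_
    refine (ih (heads_tails (0 : ℕ) 0 h).2.1).bind fun t2 ht2 => ?_
    refine (app_spec _ _).bind fun t3 ht3 => ⟨?_, ?_⟩
    · rw [app_encList]; rfl
    · rw [mul_add _ (u.sp + 1)]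
      simp only [sp_encList, List.length_map] at ht2 ht3
      omega

end Lisp


namespace Lisp

open Polynomial

/-! ### Fast multiplication modulo `x ^ 2 ^ j + 1` -/

abbrev fPm : ℕ := 23
abbrev fPm2 : ℕ := 24
abbrev fPm3 : ℕ := 25
abbrev fNuss : ℕ := 26
abbrev fNuss2 : ℕ := 27
abbrev fNuss3 : ℕ := 28

/-- `(t, d, r, j, F, G) ↦ 2 ^ t F G` modulo `X ^ 2 ^ t - y ^ (-d)`, up to a power of `2` -/
def pmBody : Expr := .cond (arg 0)
  (.bind (.call fPw (.tl (arg 0))) (.bind (.call fHalf (nth 1 (.var 1)))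
    (.call fPm2 (args [.tl (nth 0 (.var 2)), .var 0, .call fApp (args [nth 2 (.var 2), .var 0]),
      nth 2 (.var 2), nth 3 (.var 2),
      .call fTake (args [.var 1, nth 4 (.var 2)]), .call fDrop (args [.var 1, nth 4 (.var 2)]),
      .call fTake (args [.var 1, rest 5 (.var 2)]), .call fDrop (args [.var 1, rest 5 (.var 2)])]))))
  (.cons (.call fNuss (args [arg 3, .hd (arg 4), .hd (argR 5)])) .nil)

def pm2Body : Expr := .call fPm3 (args [arg 1, arg 3,
  .call fPm (args [arg 0, arg 1, arg 3, arg 4, .call fMar (args [arg 1, arg 5, arg 6]),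
    .call fMar (args [arg 1, arg 7, argR 8])]),
  .call fPm (args [arg 0, arg 2, arg 3, arg 4, .call fMar (args [arg 2, arg 5, arg 6]),
    .call fMar (args [arg 2, arg 7, argR 8])])])

def pm3Body : Expr := .call fApp (args [.call fMar (args [.nil, arg 2, argR 3]),
  .call fMrot (args [.call fDrop (args [arg 0, .call fApp (args [arg 1, arg 1])]),
    .call fMar (args [arg 1, arg 2, argR 3])])])

/-- `(j, f, g) ↦ f g` modulo `x ^ 2 ^ j + 1`, up to a power of `2` -/
def nussBody : Expr := .cond (.tl (arg 0))
  (.bind (.call fHalf (arg 0)) (.bind (.call fHalf (.cons .nil (nth 0 (.var 1))))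
    (.bind (.call fPw (.var 1)) (.bind (.call fPw (.var 1))
      (.call fNuss2 (args [.var 3, .var 0, .var 2, .call fCols (args [.var 1, nth 1 (.var 4)]),
        .call fCols (args [.var 1, rest 2 (.var 4)])]))))))
  (.call fConv (argR 1))

def nuss2Body : Expr := .call fNuss3 (args [arg 1,
  .call fPm (args [arg 0, .nil, arg 1, arg 2, arg 3, argR 4]),
  .call fPm (args [arg 0, arg 1, arg 1, arg 2, arg 3, argR 4])])

def nuss3Body : Expr := .call fUncols (args [.call fApp (args [arg 0, arg 0]),
  .call fMar (args [.tl (.call fApp (args [arg 0, arg 0])),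
    .call fMar (args [.nil, arg 1, argR 2]), .call fMar (args [arg 0, arg 1, argR 2])])])

class HasFFT (P : Program) : Prop extends HasVec P where
  pm : P[fPm]? = some pmBody
  pm2 : P[fPm2]? = some pm2Body
  pm3 : P[fPm3]? = some pm3Body
  nuss : P[fNuss]? = some nussBody
  nuss2 : P[fNuss2]? = some nuss2Body
  nuss3 : P[fNuss3]? = some nuss3Body

/-- The exponent of the power of `2` with which `nussBody` multiplies the product. -/
def esc (j : ℕ) : ℕ := if h : j < 2 then 0 else esc ((j + 1) / 2) + (j / 2 + 1)
termination_by j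
decreasing_by omega

/-- The running time of `nussBody`, where `B` bounds the length of all numbers. -/
def nussT (B j : ℕ) : ℕ := 40000 * ((B + 1) ^ 2 * (2 ^ j * (j ^ 3 + 1)))

/-- The correctness of `nussBody`. -/
def NussOK (P : Program) (j : ℕ) : Prop :=
  ∀ (b : ℕ) (f g : List ℕ), f.length = 2 ^ (j + 1) → g.length = 2 ^ (j + 1) → Bd b f → Bd b g →
    ∃ h : List ℕ, h.length = 2 ^ (j + 1) ∧ Bd (2 * b + 5 * j + 3) h ∧
      (∀ (R : Type) [CommRing R] (x : R), x ^ 2 ^ j = -1 → ev x h = 2 ^ esc j * ev x f * ev x g) ∧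
      ∀ B, 2 * b + 5 * j + 3 ≤ B → Sp P fNuss (tup [un j, E1 f, E1 g]) (E1 h) (nussT B j)

/-- The reason for lists of twice the expected length: `2 * r` coefficients represent an element of
`ℤ[y] / (y ^ r + 1)` redundantly through `y ^ (2 * r) = 1`. Natural numbers then suffice as entries,
since multiplication by `-1 = y ^ r` is a rotation. -/
theorem pow_mul_eq_one {R : Type*} [CommRing R] {y : R} {r : ℕ} (h : y ^ r = -1) :
    y ^ (2 * r) = 1 := by
  rw [mul_comm, pow_mul, h]; norm_num

variable {P : Program} [HasFFT P]

/-- The recombination of two residues. If `z = y⁻¹` and `z ^ r = -1`, then `mar r` forms the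
difference `Q - Q'`, and rotation by `2 * r - d` divides it by `z ^ d`. -/
theorem pm3_run {l b r d : ℕ} {Q Q' : List (List ℕ)} (hl : l = 2 * r) (hd : d < 2 * r)
    (hQ : Mat l b Q) (hQ' : Mat l b Q') (hlen : Q.length = Q'.length) :
    Sp P fPm3 (tup [un d, un r, E2 Q, E2 Q'])
      (E2 (mar 0 Q Q' ++ (mar r Q Q').map (lrot (2 * r - d))))
      (860 * ((b + 2) * (l + 1) * (Q.length + 1))) := by
  refine Sp.mk HasFFT.pm3 ?_
  obtain ⟨h1, h2⟩ := mar_spec (d := r) hlen hQ hQ'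
  obtain ⟨h3, h4⟩ := mar_spec (d := 0) hlen hQ hQ'
  simp only [pm3Body, exec]
  refine (mar_run .nil (Nat.zero_le l) hlen hQ hQ').bind fun t1 ht1 => ?_
  refine (app_spec _ _).bind fun t2 ht2 => ?_
  refine (drop_spec _ _).bind fun t3 ht3 => ?_
  refine (mar_run (un r) (by rw [sp_un]; omega) hlen hQ hQ').bind fun t4 ht4 => ?_
  rw [app_un, drop_un, sp_un, sp_un]
  refine (mrot_run (un _) (by rw [sp_un]; omega) h2).bind fun t5 ht5 => ?_
  refine (app_spec _ _).bind fun t6 ht6 => ?_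
  rw [sp_un, app_encList] 
  refine ⟨by rw [two_mul]; rfl, ?_⟩
  rw [sp_un] at ht2 ht3
  rw [sp_encList] at ht6
  simp only [Data.sp] at ht6
  rw [h1] at ht5
  rw [h3] at ht6
  have e1 : (l + 1) * (Q.length + 1) ≤ (b + 2) * (l + 1) * (Q.length + 1) := by
    gcongr; exact Nat.le_mul_of_pos_left _ (by omega)
  have e2 : (l + 1) ≤ (l + 1) * (Q.length + 1) := Nat.le_mul_of_pos_right _ (by omega)
  have e3 : Q.length + 1 ≤ (l + 1) * (Q.length + 1) := Nat.le_mul_of_pos_left _ (by omega)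
  have e4 : (b + 1) * (l + 1) * (Q.length + 1) ≤ (b + 2) * (l + 1) * (Q.length + 1) := by
    gcongr; omega
  simp only [mul_assoc] at *
  omega

/-- Chinese remaindering for `X ^ (2 * h) - c ^ 2 = (X ^ h - c) * (X ^ h + c)`: the combination is
`2 * Q` where `X ^ h = c` and `2 * Q'` where `X ^ h = -c`. The factor `2` stays, as `2` need not be
invertible, and the quotient is given explicitly, as the two factors need not be coprime in `A`. -/
theorem dvd_butterfly {A : Type*} [CommRing A] {X c c' W Q Q' : A} {h : ℕ} (hc : c * c' = 1)
    (h1 : X ^ h - c ∣ Q - W) (h2 : X ^ h - (-c) ∣ Q' - W) :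
    X ^ (2 * h) - c ^ 2 ∣ (Q + Q') + X ^ h * (c' * (Q - Q')) - 2 * W := by
  obtain ⟨a, ha⟩ := h1
  obtain ⟨a', ha'⟩ := h2
  refine ⟨c' * (a - a'), ?_⟩
  have e1 : Q = W + (X ^ h - c) * a := by rw [← ha]; ring
  have e2 : Q' = W + (X ^ h + c) * a' := by
    have : X ^ h + c = X ^ h - (-c) := by ring
    rw [this, ← ha']; ring
  rw [e1, e2, mul_comm 2 h, pow_mul]
  linear_combination (c * (a - a') - X ^ h * (a + a')) * hc

/-- The running time of `pmBody`. -/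
def pmT (N B l t : ℕ) : ℕ := 2 ^ t * (N + 60) + t * (2 ^ t * (5000 * ((B + 1) * (l + 1))))

/-- The fast Fourier transform, by splitting `X ^ 2 ^ t - z ^ d` along the two square roots `z ^ (d
/ 2)` and `z ^ (2 ^ j + d / 2)` of `z ^ d`. The hypothesis `2 ^ t ∣ d` keeps all exponents even
until `t = 0`, and `t ≤ j` passes it on to the second root. At `t = 0` one product of the kind
`NussOK` is left. Each level adds one bit to the factors and one to the result. -/
theorem pm_run {j : ℕ} (hj : NussOK P j) (t : ℕ) :
    ∀ (b d : ℕ) (F G : List (List ℕ)), F.length = 2 ^ t → G.length = 2 ^ t →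
      Mat (2 * 2 ^ j) b F → Mat (2 * 2 ^ j) b G → t ≤ j → 2 ^ t ∣ d → d < 2 * 2 ^ j →
    ∃ Q : List (List ℕ), Q.length = 2 ^ t ∧ Mat (2 * 2 ^ j) (2 * (b + t) + 5 * j + 3 + t) Q ∧
      (∀ (A : Type) [CommRing A] (X y z : A), y * z = 1 → y ^ 2 ^ j = -1 →
        X ^ 2 ^ t - z ^ d ∣ ev2 X y Q - 2 ^ (t + esc j) * ev2 X y F * ev2 X y G) ∧
      ∀ B, 2 * (b + t) + 5 * j + 3 + t ≤ B →
        Sp P fPm (tup [un t, un d, un (2 ^ j), un j, E2 F, E2 G]) (E2 Q)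
          (pmT (nussT B j) B (2 * 2 ^ j) t) := by
  induction t with
  | zero =>
    intro b d F G hF hG mF mG _ _ hd
    obtain ⟨f, rfl⟩ := List.length_eq_one_iff.1 hF
    obtain ⟨g, rfl⟩ := List.length_eq_one_iff.1 hG
    obtain ⟨hf1, hf2, -⟩ := mF.of_cons
    obtain ⟨hg1, hg2, -⟩ := mG.of_cons
    obtain ⟨h, hh1, hh2, hh3, hh4⟩ := hj b f g (by rw [hf1]; ring) (by rw [hg1]; ring) hf2 hg2
    refine ⟨[h], rfl, Mat.cons (by rw [hh1]; ring) hh2 Mat.nil, ?_, ?_⟩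
    · intro A _ X y z hyz hy
      simp [ev2, hh3 A y hy]
    · intro B hB
      refine Sp.mk HasFFT.pm ?_
      simp only [pmBody, exec, un, encList]
      refine (hh4 B hB).bind fun t ht => ⟨rfl, ?_⟩
      simp [pmT]; omega
  | succ t ih =>
    intro b d F G hF hG mF mG htj hdvd hd
    set r := 2 ^ j with hr
    set h := 2 ^ t with hh
    have hr2 : 2 ^ t ∣ r := pow_dvd_pow 2 (by omega)
    have hd2 : d = 2 * (d / 2) := by
      have : 2 ∣ d := (Dvd.intro _ (pow_succ' 2 t).symm).trans hdvd
      omega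
    have hdt : 2 ^ t ∣ d / 2 := by
      rw [hd2, pow_succ'] at hdvd
      exact Nat.dvd_of_mul_dvd_mul_left (by norm_num) hdvd
    have hF' : F.length = 2 * h := by rw [hF, pow_succ']
    have hG' : G.length = 2 * h := by rw [hG, pow_succ']
    have lF1 : (F.take h).length = h := by simp [hF']; omega
    have lF2 : (F.drop h).length = h := by simp [hF']; omega
    have lG1 : (G.take h).length = h := by simp [hG']; omega
    have lG2 : (G.drop h).length = h := by simp [hG']; omega
    have mm (d : ℕ) := mar_spec (d := d) (by rw [lF1, lF2]) (mF.take h) (mF.drop h)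
    have mn (d : ℕ) := mar_spec (d := d) (by rw [lG1, lG2]) (mG.take h) (mG.drop h)
    obtain ⟨Q, q1, q2, q3, q4⟩ := ih (b + 1) (d / 2) _ _ ((mm (d / 2)).1.trans lF1)
      ((mn (d / 2)).1.trans lG1) (mm _).2 (mn _).2 (by omega) hdt (by omega)
    obtain ⟨Q', q1', q2', q3', q4'⟩ := ih (b + 1) (r + d / 2) _ _ ((mm (r + d / 2)).1.trans lF1)
      ((mn (r + d / 2)).1.trans lG1) (mm _).2 (mn _).2 (by omega) (dvd_add hr2 hdt) (by omega)
    have hlen : Q.length = Q'.length := by rw [q1, q1']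
    obtain ⟨h1, h2⟩ := mar_spec (d := r) hlen q2 q2'
    obtain ⟨h3, h4⟩ := mar_spec (d := 0) hlen q2 q2'
    refine ⟨mar 0 Q Q' ++ (mar r Q Q').map (lrot (2 * r - d / 2)), ?_, ?_, ?_, ?_⟩
    · rw [List.length_append, List.length_map, h1, h3, q1, pow_succ, mul_two]
    · exact (h4.append (mrot_spec _ h2)).mono (by omega)
    · intro A _ X y z hyz hy
      have hyl : y ^ (2 * r) = 1 := pow_mul_eq_one hy
      have hzr : z ^ r = -1 := by
        have : (y * z) ^ r = 1 := by rw [hyz, one_pow]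
        rw [mul_pow, hy] at this
        linear_combination -this
      have hzl : z ^ (2 * r) = 1 := pow_mul_eq_one hzr
      have hFe : ev2 X y F = ev2 X y (F.take h) + X ^ h * ev2 X y (F.drop h) := by
        conv_lhs => rw [← List.take_append_drop h F, ev2_append, lF1]
      have hGe : ev2 X y G = ev2 X y (G.take h) + X ^ h * ev2 X y (G.drop h) := by
        conv_lhs => rw [← List.take_append_drop h G, ev2_append, lG1]
      have d1 := q3 A X y z hyz hy
      have d2 := q3' A X y z hyz hy
      rw [ev2_mar X hyz (by omega) hyl (by rw [lF1, lF2]) (mF.take h) (mF.drop h),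
        ev2_mar X hyz (by omega) hyl (by rw [lG1, lG2]) (mG.take h) (mG.drop h)] at d1 d2
      -- The second branch has the root `z ^ (r + d / 2)`, which is the negative of the first
      -- because `z ^ r = -1`.
      rw [pow_add, hzr] at d2
      rw [ev2_append, ev2_mrot X hyz (by omega) hyl h2, ev2_mar X hyz (by omega) hyl hlen q2 q2',
        ev2_mar X hyz (by omega) hyl hlen q2 q2', h3, q1, hzr, hFe, hGe]
      set u := ev2 X y (F.take h)
      set v := ev2 X y (F.drop h)
      set u' := ev2 X y (G.take h)
      set v' := ev2 X y (G.drop h)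
      set c := z ^ (d / 2) with hc
      have hcc : c * z ^ (2 * r - d / 2) = 1 := by
        rw [hc, ← pow_add, show d / 2 + (2 * r - d / 2) = 2 * r by omega, hzl]
      set W := 2 ^ (t + esc j) * (u + X ^ h * v) * (u' + X ^ h * v') with hW
      -- `u + c * v` and `u' + c * v'` are the factors reduced modulo `X ^ h - c`, so the branch
      -- computed the full product `W` modulo `X ^ h - c`.
      have k1 : X ^ h - c ∣ ev2 X y Q - W := by
        have : ev2 X y Q - W = (ev2 X y Q - 2 ^ (t + esc j) * (u + c * v) * (u' + c * v'))
          - (X ^ h - c) * (2 ^ (t + esc j) * (v * (u' + X ^ h * v') + v' * (u + c * v))) := by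
          rw [hW]; ring
        rw [this]
        exact dvd_sub d1 (dvd_mul_right _ _)
      have k2 : X ^ h - (-c) ∣ ev2 X y Q' - W := by
        have : ev2 X y Q' - W = (ev2 X y Q' - 2 ^ (t + esc j) * (u + (-1) * c * v)
            * (u' + (-1) * c * v'))
          - (X ^ h - -c) * (2 ^ (t + esc j) * (v * (u' + X ^ h * v') + v' * (u + (-c) * v))) := by
          rw [hW]; ring
        rw [this]
        refine dvd_sub ?_ (dvd_mul_right _ _)
        rwa [neg_one_mul] at d2 ⊢
      have k3 := dvd_butterfly hcc k1 k2
      have e1 : z ^ d = c ^ 2 := by rw [hc, ← pow_mul]; congr 1; omega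
      rw [e1, pow_succ' 2 t, ← hh]
      convert k3 using 1
      rw [hW, show t + 1 + esc j = t + esc j + 1 by ring, pow_succ]
      ring
    · intro B hB
      refine Sp.mk HasFFT.pm ?_
      have hmar {d : ℕ} (hd : d ≤ 2 * r) (us : List (List ℕ)) (hl : us.length = 2 * h)
          (hm : Mat (2 * r) b us) : Sp P fMar (tup [un d, E2 (us.take h), E2 (us.drop h)])
            (E2 (mar d (us.take h) (us.drop h))) (300 * ((B + 1) * ((2 * r + 1) * (h + 1)))) := by
        have e1 : (us.take h).length = h := by simp [hl]; omega
        have e2 : (us.drop h).length = h := by simp [hl]; omega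
        have := mar_run (P := P) (un d) (by rwa [sp_un]) (e1.trans e2.symm) (hm.take h) (hm.drop h)
        rw [sp_un, e1] at this
        refine this.mono ?_
        simp only [mul_assoc]; gcongr; omega
      have pm2 : Sp P fPm2 (tup [un t, un (d / 2), un (r + d / 2), un r, un j, E2 (F.take h),
          E2 (F.drop h), E2 (G.take h), E2 (G.drop h)])
          (E2 (mar 0 Q Q' ++ (mar r Q Q').map (lrot (2 * r - d / 2))))
          (2 * pmT (nussT B j) B (2 * r) t + 2300 * ((B + 1) * ((2 * r + 1) * (h + 1)))) := by
        refine Sp.mk HasFFT.pm2 ?_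
        simp only [pm2Body, exec]
        refine (hmar (by omega) F hF' mF).bind fun t1 ht1 => ?_
        refine (hmar (by omega) G hG' mG).bind fun t2 ht2 => ?_
        refine (q4 B (by omega)).bind fun t3 ht3 => ?_
        refine (hmar (by omega) F hF' mF).bind fun t4 ht4 => ?_
        refine (hmar (by omega) G hG' mG).bind fun t5 ht5 => ?_
        refine (q4' B (by omega)).bind fun t6 ht6 => ?_
        refine (pm3_run rfl (by omega) q2 q2' hlen).bind fun t7 ht7 => ⟨rfl, ?_⟩
        have e1 : (2 * (b + 1 + t) + 5 * j + 3 + t + 2) * (2 * r + 1) * (Q.length + 1) ≤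
            (B + 1) * ((2 * r + 1) * (h + 1)) := by
          rw [q1, mul_assoc]; exact Nat.mul_le_mul (by omega) le_rfl
        have e2 : 1 ≤ (B + 1) * ((2 * r + 1) * (h + 1)) := Nat.mul_pos (by simp) (by simp)
        omega
      simp only [pmBody, exec, un]
      refine (pw_spec _).bind fun t1 ht1 => ?_
      refine (half_spec _).bind fun t2 ht2 => ?_
      rw [sp_un, sp_un]
      refine (app_spec _ _).bind fun t3 ht3 => ?_
      refine (take_spec _ _).bind fun t4 ht4 => ?_
      refine (drop_spec _ _).bind fun t5 ht5 => ?_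
      refine (take_spec _ _).bind fun t6 ht6 => ?_
      refine (drop_spec _ _).bind fun t7 ht7 => ?_
      rw [app_un, sp_un, take_encList _ _ _ (by omega), take_encList _ _ _ (by omega), drop_encList,
        drop_encList]
      refine pm2.bind fun t8 ht8 => ⟨rfl, ?_⟩
      simp only [sp_un] at *
      have e0 : h + 1 ≤ 2 * h := by have := Nat.one_le_two_pow (n := t); omega
      have e1 : (B + 1) * ((2 * r + 1) * (h + 1)) ≤ 2 * (h * ((B + 1) * (2 * r + 1))) := by
        calc _ ≤ (B + 1) * ((2 * r + 1) * (2 * h)) := by gcongr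
          _ = _ := by ring
      have e2 : h ≤ h * ((B + 1) * (2 * r + 1)) :=
        Nat.le_mul_of_pos_right _ (Nat.mul_pos (by simp) (by simp))
      have e3 : 2 * r + 1 ≤ h * ((B + 1) * (2 * r + 1)) := by
        rw [← mul_assoc]; exact Nat.le_mul_of_pos_left _ (Nat.mul_pos (by omega) (by simp))
      have e4 : pmT (nussT B j) B (2 * r) (t + 1) = 2 * pmT (nussT B j) B (2 * r) t +
          10000 * (h * ((B + 1) * (2 * r + 1))) := by
        simp only [pmT, pow_succ, ← hh]; ring
      omega

end Lisp


/-! ### Nussbaumer's recursion: from residues back to the product -/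

namespace Lisp

open Polynomial

/-- The divisor is monic, so the degree argument needs no assumption on `R`, in particular no
absence of zero divisors. -/
theorem eq_zero_of_X_pow_sub_C_dvd {R : Type*} [CommRing R] {n : ℕ} (hn : n ≠ 0) {a : R} {p : R[X]}
    (h : X ^ n - C a ∣ p) (hp : p.natDegree < n) : p = 0 := by
  rcases subsingleton_or_nontrivial R with hR | hR
  · exact Subsingleton.elim _ _
  · by_contra h0
    exact (monic_X_pow_sub_C a hn).not_dvd_of_natDegree_lt h0 (by rwa [natDegree_X_pow_sub_C]) h

/-- Because `n - 1` is truncated, the degree hypothesis alone would allow a nonzero constant `p` for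
`n = 0`; `h0` excludes it. -/
theorem natDegree_C_add_X_mul_le {R : Type*} [CommRing R] {a : R} {p : R[X]} {n : ℕ}
    (h : p.natDegree ≤ n - 1) (h0 : n = 0 → p = 0) : (C a + X * p).natDegree ≤ n := by
  refine (natDegree_add_le _ _).trans (max_le (by simp) ?_)
  by_cases hn : n = 0
  · simp [h0 hn]
  · refine natDegree_mul_le.trans ?_
    have : (X : R[X]).natDegree ≤ 1 := natDegree_X_le
    omega

theorem natDegree_ev2 {R : Type*} [CommRing R] (y : R) (l : List (List ℕ)) :
    (ev2 X (C y) l).natDegree ≤ l.length - 1 := by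
  induction l with
  | nil => simp [ev2]
  | cons f l ih =>
    rw [ev2, ← ev_map (C : R →+* R[X]), List.length_cons, Nat.add_sub_cancel]
    exact natDegree_C_add_X_mul_le ih fun h => by rw [List.length_eq_zero_iff.1 h]; rfl

theorem natDegree_ev {R : Type*} [CommRing R] (l : List ℕ) :
    (ev (X : R[X]) l).natDegree ≤ l.length - 1 := by
  induction l with
  | nil => simp [ev]
  | cons a l ih =>
    rw [ev, ← C_eq_natCast, List.length_cons, Nat.add_sub_cancel]
    exact natDegree_C_add_X_mul_le ih fun h => by rw [List.length_eq_zero_iff.1 h]; rfl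

theorem eval_ev2 {R : Type*} [CommRing R] (x y : R) (l : List (List ℕ)) :
    (ev2 X (C y) l).eval x = ev2 x y l := by
  induction l with
  | nil => simp [ev2]
  | cons f l ih => rw [ev2, ev2, ← ev_map (C : R →+* R[X])]; simp [ih]

theorem natDegree_two_pow_mul_le {R : Type*} [CommRing R] (k : ℕ) (p q : R[X]) :
    (2 ^ k * p * q).natDegree ≤ p.natDegree + q.natDegree := by
  have h : (2 ^ k : R[X]) = C (2 ^ k) := by rw [C_pow, map_ofNat]
  rw [h, mul_assoc]
  exact (natDegree_C_mul_le _ _).trans natDegree_mul_le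

/-- Both factors have degree less than `m` in `X`, so their product, of degree less than `2 * m`, is
determined modulo `X ^ (2 * m) - 1 = (X ^ m - 1) * (X ^ m + 1)`. The combination of the two residues
is therefore an identity in `R[X]`, and `x` may be substituted for `X`, with `x ^ m = y`. -/
theorem nuss_aux {R : Type*} [CommRing R] {x y : R} {m k : ℕ} (hm : 0 < m) (hy : y = x ^ m)
    {Q Q' F G : List (List ℕ)} (lQ : Q.length = m) (lQ' : Q'.length = m) (lF : F.length = m)
    (lG : G.length = m)
    (h1 : (X : R[X]) ^ m - 1 ∣ ev2 X (C y) Q - 2 ^ k * ev2 X (C y) F * ev2 X (C y) G)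
    (h2 : (X : R[X]) ^ m - (-1) ∣ ev2 X (C y) Q' - 2 ^ k * ev2 X (C y) F * ev2 X (C y) G) :
    (ev2 x y Q + ev2 x y Q') + y * (ev2 x y Q - ev2 x y Q')
      = 2 ^ (k + 1) * ev2 x y F * ev2 x y G := by
  have h3 := dvd_butterfly (A := R[X]) (mul_one 1) h1 h2
  have hdeg : ((ev2 X (C y) Q + ev2 X (C y) Q') + X ^ m * (1 * (ev2 X (C y) Q - ev2 X (C y) Q'))
      - 2 * (2 ^ k * ev2 X (C y) F * ev2 X (C y) G)).natDegree < 2 * m := by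
    have d1 := natDegree_ev2 y Q
    have d2 := natDegree_ev2 y Q'
    have d3 := natDegree_ev2 y F
    have d4 := natDegree_ev2 y G
    have d5 : ((X : R[X]) ^ m * (1 * (ev2 X (C y) Q - ev2 X (C y) Q'))).natDegree ≤
        m + (m - 1) := by
      refine natDegree_mul_le.trans (add_le_add (natDegree_X_pow_le _) ?_)
      rw [one_mul]
      exact (natDegree_sub_le _ _).trans (max_le (by omega) (by omega))
    have d6 : (2 * (2 ^ k * ev2 X (C y) F * ev2 X (C y) G)).natDegree ≤ (m - 1) + (m - 1) := by
      have := natDegree_two_pow_mul_le (k + 1) (ev2 X (C y) F) (ev2 X (C y) G)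
      rw [pow_succ', mul_assoc, mul_assoc] at this
      rw [mul_assoc (2 ^ k)]
      omega
    refine (natDegree_sub_le _ _).trans_lt (max_lt ((natDegree_add_le _ _).trans_lt (max_lt ?_ ?_)) ?_)
    · exact (natDegree_add_le _ _).trans_lt (max_lt (by omega) (by omega))
    · omega
    · omega
  rw [one_pow, ← C_1] at h3
  have h4 := eq_zero_of_X_pow_sub_C_dvd (R := R) (a := 1) (n := 2 * m) (by omega) h3
    (by rw [C_1]; exact hdeg)
  have h5 := congrArg (Polynomial.eval x) h4
  simp only [eval_sub, eval_add, eval_mul, eval_pow, eval_X, eval_ev2, eval_zero,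
    eval_C, eval_ofNat, ← hy] at h5
  rw [pow_succ]
  linear_combination h5

variable {P : Program} [HasFFT P]

/-- This evaluates `(Q + Q') + y * (Q - Q')`, the left side of `nuss_aux`; among `2 * r` places,
rotation by `2 * r - 1` is multiplication by `y`. -/
theorem nuss3_run {l b r : ℕ} {Q Q' : List (List ℕ)} (hr : 0 < r) (hl : l = 2 * r)
    (hQ : Mat l b Q) (hQ' : Mat l b Q') (hlen : Q.length = Q'.length) :
    Sp P fNuss3 (tup [un r, E2 Q, E2 Q'])
      (E1 (uncols (2 * r) (mar (2 * r - 1) (mar 0 Q Q') (mar r Q Q'))))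
      (1200 * ((b + 2) * ((l + 1) * (Q.length + 1)))) := by
  subst hl
  refine Sp.mk HasFFT.nuss3 ?_
  obtain ⟨h1, h2⟩ := mar_spec (d := r) hlen hQ hQ'
  obtain ⟨h3, h4⟩ := mar_spec (d := 0) hlen hQ hQ'
  obtain ⟨h5, h6⟩ := mar_spec (d := 2 * r - 1) (h3.trans h1.symm) h4 h2
  simp only [nuss3Body, exec]
  refine (app_spec _ _).bind fun t1 ht1 => ?_
  refine (app_spec _ _).bind fun t2 ht2 => ?_
  refine (mar_run .nil (Nat.zero_le _) hlen hQ hQ').bind fun t3 ht3 => ?_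
  refine (mar_run (un r) (by rw [sp_un]; omega) hlen hQ hQ').bind fun t4 ht4 => ?_
  rw [app_un, sp_un, ← two_mul]
  have e : (un (2 * r)).tl = un (2 * r - 1) := by
    rw [show 2 * r = (2 * r - 1) + 1 by omega]; rfl
  rw [e]
  have := mar_run (P := P) (un (2 * r - 1)) (by rw [sp_un]; omega) (h3.trans h1.symm) h4 h2
  refine this.bind fun t5 ht5 => ?_
  rw [sp_un]
  have := uncols_run (P := P) (un (2 * r)) (b := b + 1 + 1)
    (cs := mar (2 * r - 1) (mar 0 Q Q') (mar r Q Q')) (by rwa [sp_un])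
  rw [sp_un] at this
  refine this.bind fun t6 ht6 => ⟨rfl, ?_⟩
  rw [sp_un] at ht1 ht2
  rw [h3] at ht5
  rw [h5, h3] at ht6
  have e1 : (2 * r + 1) * (Q.length + 1) ≤ (b + 2) * ((2 * r + 1) * (Q.length + 1)) :=
    Nat.le_mul_of_pos_left _ (by omega)
  have e2 : (2 * r + 1) ≤ (2 * r + 1) * (Q.length + 1) := Nat.le_mul_of_pos_right _ (by omega)
  have e4 : (b + 1) * ((2 * r + 1) * (Q.length + 1)) ≤ (b + 2) * ((2 * r + 1) * (Q.length + 1)) := by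
    gcongr; omega
  have e5 : (Q.length + 1) * (2 * r + 1) = (2 * r + 1) * (Q.length + 1) := mul_comm _ _
  rw [show b + 1 + 1 = b + 2 from rfl] at ht5
  simp only [mul_assoc] at *
  omega

/-- Solves the recurrence for the time: two transforms whose products have the exponent `j` halved
and rounded up, and work proportional to `j` for their levels. A cube leaves room for the rounding.
-/
theorem cube_half {j : ℕ} (hj : 2 ≤ j) : 2 * (((j + 1) / 2) ^ 3 + 1) + j ≤ j ^ 3 + 1 := by
  obtain ⟨i, rfl | rfl⟩ := Nat.even_or_odd' j
  · rw [show (2 * i + 1) / 2 = i by omega]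
    have : 1 ≤ i := by omega
    nlinarith [pow_le_pow_left₀ (by norm_num) this 3, mul_self_nonneg i, pow_succ i 2]
  · rw [show (2 * i + 1 + 1) / 2 = i + 1 by omega]
    have : 1 ≤ i := by omega
    nlinarith [pow_le_pow_left₀ (by norm_num) this 3, mul_self_nonneg i, pow_succ i 2]

/-- With `j = i + k` split in halves, `y = x ^ 2 ^ i` satisfies `y ^ 2 ^ k = -1`, so products of
coefficients are instances for `k < j`. Since `i ≤ k`, there are enough roots of unity for
transforms of length `2 ^ i`. For `j < 2` there is no such reduction, and the convolution is
computed directly. -/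
theorem nuss_ok (j : ℕ) : NussOK P j := by
  induction j using Nat.strong_induction_on with
  | _ j ih =>
  intro b f g hf hg bf bg
  by_cases hj : j < 2
  · have hg0 : g ≠ [] := by
      rintro rfl; have := Nat.two_pow_pos (j + 1); rw [List.length_nil] at hg; omega
    have hl4 : 2 ^ (j + 1) ≤ 4 := by
      calc 2 ^ (j + 1) ≤ 2 ^ 2 := Nat.pow_le_pow_right (by norm_num) (by omega)
        _ = 4 := by norm_num
    refine ⟨conv f g, by simp [hg], ?_, ?_, ?_⟩
    · intro x hx
      refine (conv_lt bf bg x hx).trans_le ?_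
      rw [add_assoc, pow_add, mul_comm]
      gcongr
      calc f.length + 1 ≤ 2 ^ 3 := by omega
        _ ≤ _ := Nat.pow_le_pow_right (by norm_num) (by omega)
    · intro R _ x hx
      have h1 := pow_mul_eq_one hx
      have h2 : x * x ^ (2 * 2 ^ j - 1) = 1 := by
        rw [← pow_succ', Nat.sub_add_cancel (by have := Nat.one_le_two_pow (n := j); omega), h1]
      rw [ev_conv h2 (by rw [hg, pow_succ', h1]) hg0, esc]
      simp [hj]
    · intro B hB
      refine Sp.mk HasFFT.nuss ?_
      have hun : (un j).tl = .nil := by interval_cases j <;> rfl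
      simp only [nussBody, exec, hun]
      refine (conv_run (b := b) (B := B) (by omega) bg hg0 (by omega) bf).bind fun t ht => ⟨rfl, ?_⟩
      have e1 : (f.length + 1) * (700 * (B + 1) ^ 2 * (g.length + 1)) ≤ 17500 * (B + 1) ^ 2 := by
        calc _ ≤ 5 * (700 * (B + 1) ^ 2 * 5) :=
              Nat.mul_le_mul (by omega) (Nat.mul_le_mul le_rfl (by omega))
          _ = _ := by ring
      have e2 : (B + 1) ^ 2 ≤ (B + 1) ^ 2 * (2 ^ j * (j ^ 3 + 1)) :=
        Nat.le_mul_of_pos_right _ (by positivity)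
      have e3 : 1 ≤ (B + 1) ^ 2 := Nat.one_le_pow _ _ (by omega)
      rw [nussT]
      omega
  · have hj' : 2 ≤ j := by omega
    obtain ⟨i, hi⟩ : ∃ i, i = j / 2 := ⟨_, rfl⟩
    obtain ⟨k, hk⟩ : ∃ k, k = (j + 1) / 2 := ⟨_, rfl⟩
    have hik : i + k = j := by omega
    obtain ⟨m, hm⟩ : ∃ m, m = 2 ^ i := ⟨_, rfl⟩
    obtain ⟨r, hr⟩ : ∃ r, r = 2 ^ k := ⟨_, rfl⟩
    have hm0 : 0 < m := by rw [hm]; positivity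
    have hr0 : 0 < r := by rw [hr]; positivity
    have hmr : m * r = 2 ^ j := by rw [hm, hr, ← pow_add, hik]
    have lf : f.length = m * (2 * r) := by rw [hf, pow_succ, ← hmr]; ring
    have lg : g.length = m * (2 * r) := by rw [hg, pow_succ, ← hmr]; ring
    obtain ⟨f1, f2⟩ := cols_spec (2 * r) lf bf
    obtain ⟨g1, g2⟩ := cols_spec (2 * r) lg bg
    -- The shifts `0` and `r` give the moduli `X ^ m - 1` and `X ^ m + 1`, as `z ^ 0 = 1` and `z ^ r
    -- = -1`.
    obtain ⟨Q, q1, q2, q3, q4⟩ := pm_run (ih k (by omega)) i b 0 _ _ (f1.trans hm)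
      (g1.trans hm) (by rwa [← hr]) (by rwa [← hr]) (by omega) (by simp) (by omega)
    obtain ⟨Q', q1', q2', q3', q4'⟩ := pm_run (ih k (by omega)) i b r _ _
      (f1.trans hm) (g1.trans hm) (by rwa [← hr]) (by rwa [← hr]) (by omega)
      (by rw [hr]; exact pow_dvd_pow 2 (by omega)) (by omega)
    simp only [← hr, ← hm] at q1 q1' q2 q2' q3 q3' q4 q4'
    have hlen : Q.length = Q'.length := by rw [q1, q1']
    obtain ⟨h1, h2⟩ := mar_spec (d := r) hlen q2 q2'
    obtain ⟨h3, h4⟩ := mar_spec (d := 0) hlen q2 q2'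
    obtain ⟨h5, h6⟩ := mar_spec (d := 2 * r - 1) (h3.trans h1.symm) h4 h2
    obtain ⟨h7, h8⟩ := uncols_spec (2 * r) h6
    refine ⟨uncols (2 * r) (mar (2 * r - 1) (mar 0 Q Q') (mar r Q Q')), ?_, ?_, ?_, ?_⟩
    · rw [h7, h5, h3, q1, pow_succ, ← hmr]; ring
    -- Here `2 * (b + i) + 5 * k + 3 + i + 2 ≤ 2 * b + 5 * (i + k) + 3`, because `i ≥ 1`. This fixes
    -- the constant `5`.
    · exact h8.mono (by omega)
    · intro R _ x hx
      set y := x ^ m with hy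
      set z := y ^ (2 * r - 1) with hz
      have hyr : y ^ r = -1 := by rw [hy, ← pow_mul, hmr, hx]
      have hyl := pow_mul_eq_one hyr
      have hyz : y * z = 1 := by rw [hz, ← pow_succ', Nat.sub_add_cancel (by omega), hyl]
      have hzr : z ^ r = -1 := by
        have : (y * z) ^ r = 1 := by rw [hyz, one_pow]
        rw [mul_pow, hyr] at this
        linear_combination -this
      have hzy : z ^ (2 * r - 1) = y := by
        have := pow_mul_eq_one hzr
        calc z ^ (2 * r - 1) = z ^ (2 * r - 1) * (y * z) := by rw [hyz, mul_one]
          _ = y * z ^ (2 * r - 1 + 1) := by ring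
          _ = y := by rw [Nat.sub_add_cancel (by omega), this, mul_one]
      -- The ring is `R[X]` with `y` and `z` constant: `X` has to be free of the relation `x ^ m =
      -- y` for the degree argument in `nuss_aux`.
      have d1 := q3 R[X] X (C y) (C z) (by rw [← C_mul, hyz, C_1]) (by
        rw [← C_pow, hyr]; simp)
      have d2 := q3' R[X] X (C y) (C z) (by rw [← C_mul, hyz, C_1]) (by
        rw [← C_pow, hyr]; simp)
      rw [← C_pow, hzr] at d2
      have key := nuss_aux hm0 hy q1 q1' f1 g1 (by simpa using d1) (by simpa using d2)
      rw [ev2_cols x _ lf, ev2_cols x _ lg] at key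
      rw [ev_uncols x _ h6 (h5.trans (h3.trans q1)), ← hy,
        ev2_mar x hyz (by omega) hyl (h3.trans h1.symm) h4 h2,
        ev2_mar x hyz (by omega) hyl hlen q2 q2', ev2_mar x hyz (by omega) hyl hlen q2 q2',
        hzr, hzy, esc, dif_neg hj]
      rw [← hk, ← hi, show esc k + (i + 1) = i + esc k + 1 by omega, ← key]
      ring
    · intro B hB
      refine Sp.mk HasFFT.nuss ?_
      have hun : ∃ d, (un j).tl = .cons .nil d := by
        obtain ⟨j', rfl⟩ : ∃ j', j = j' + 2 := ⟨j - 2, by omega⟩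
        exact ⟨un j', rfl⟩
      obtain ⟨d, hun⟩ := hun
      simp only [nussBody, exec, hun]
      refine (half_spec _).bind fun t1 ht1 => ?_
      refine (half_spec _).bind fun t2 ht2 => ?_
      simp only [Data.sp, sp_un, ← hi, ← hk] at ht1 ht2 ⊢
      refine (pw_spec _).bind fun t3 ht3 => ?_
      refine (pw_spec _).bind fun t4 ht4 => ?_
      simp only [sp_un, ← hm, ← hr] at ht3 ht4 ⊢
      refine (cols_run hm0 _ lf).bind fun t5 ht5 => ?_
      refine (cols_run hm0 _ lg).bind fun t6 ht6 => ?_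
      have key : Sp P fNuss2 (tup [un i, un r, un k, E2 (cols m (2 * r) f), E2 (cols m (2 * r) g)])
          (E1 (uncols (2 * r) (mar (2 * r - 1) (mar 0 Q Q') (mar r Q Q'))))
          (2 * pmT (nussT B k) B (2 * r) i + 1300 * ((B + 1) * ((2 * r + 1) * (m + 1)))) := by
        refine Sp.mk HasFFT.nuss2 ?_
        simp only [nuss2Body, exec]
        refine (q4 B (by omega)).bind fun t1 ht1 => ?_
        refine (q4' B (by omega)).bind fun t2 ht2 => ?_
        refine (nuss3_run hr0 rfl q2 q2' hlen).bind fun t3 ht3 => ⟨rfl, ?_⟩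
        have e1 : (2 * (b + i) + 5 * k + 3 + i + 2) * ((2 * r + 1) * (Q.length + 1)) ≤
            (B + 1) * ((2 * r + 1) * (m + 1)) := by
          rw [q1]; exact Nat.mul_le_mul (by omega) le_rfl
        have e2 : 1 ≤ (B + 1) * ((2 * r + 1) * (m + 1)) := Nat.mul_pos (by simp) (by simp)
        omega
      refine key.bind fun t7 ht7 => ⟨rfl, ?_⟩
      set U := (B + 1) * 2 ^ j with hU
      have e1 : (B + 1) * ((2 * r + 1) * (m + 1)) ≤ 6 * U := by
        calc _ ≤ (B + 1) * ((3 * r) * (2 * m)) := by gcongr <;> omega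
          _ = _ := by rw [hU, ← hmr]; ring
      have e2 : (m + 1) * (2 * r + 1) ≤ 6 * U := by
        calc _ = 1 * ((2 * r + 1) * (m + 1)) := by ring
          _ ≤ (B + 1) * ((2 * r + 1) * (m + 1)) := by gcongr; omega
          _ ≤ _ := e1
      have e3 : 2 ^ j ≤ U := Nat.le_mul_of_pos_left _ (by omega)
      have e4 : m ≤ 2 ^ j := by rw [← hmr]; exact Nat.le_mul_of_pos_right _ hr0
      have e5 : r ≤ 2 ^ j := by rw [← hmr]; exact Nat.le_mul_of_pos_left _ hm0
      have e6 : j < 2 ^ j := Nat.lt_two_pow_self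
      have e7 : pmT (nussT B k) B (2 * r) i ≤ m * nussT B k + 60 * U + 15000 * (i * U) := by
        have : m * (5000 * ((B + 1) * (2 * r + 1))) ≤ 15000 * U := by
          calc _ ≤ m * (5000 * ((B + 1) * (3 * r))) := by gcongr; omega
            _ = _ := by rw [hU, ← hmr]; ring
        calc _ = m * nussT B k + 60 * m + i * (m * (5000 * ((B + 1) * (2 * r + 1)))) := by
              rw [pmT, ← hm]; ring
          _ ≤ m * nussT B k + 60 * U + i * (15000 * U) := by gcongr; omega
          _ = _ := by ring
      have e8 : m * nussT B k = 40000 * ((B + 1) * (U * (k ^ 3 + 1))) := by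
        rw [nussT, ← hr, hU, ← hmr]; ring
      have e9 : nussT B j = 40000 * ((B + 1) * (U * (j ^ 3 + 1))) := by
        rw [nussT, hU]; ring
      have e10 : 2 * ((B + 1) * (U * (k ^ 3 + 1))) + j * U ≤ (B + 1) * (U * (j ^ 3 + 1)) := by
        calc _ ≤ 2 * ((B + 1) * (U * (k ^ 3 + 1))) + (B + 1) * (j * U) := by
              exact Nat.add_le_add_left (Nat.le_mul_of_pos_left _ (by omega)) _
          _ = (B + 1) * U * (2 * (k ^ 3 + 1) + j) := by ring
          _ ≤ (B + 1) * U * (j ^ 3 + 1) := by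
              rw [hk]; exact Nat.mul_le_mul_left _ (cube_half hj')
          _ = _ := by ring
      have e11 : 2 * (i * U) ≤ j * U := by
        rw [← mul_assoc]; gcongr; omega
      have e12 : 2 * U ≤ j * U := by gcongr
      have e13 : (130 * (m + 1) * (2 * r + 1)) = 130 * ((m + 1) * (2 * r + 1)) := by ring
      rw [e13] at ht5 ht6
      omega

end Lisp


namespace Lisp

open Polynomial

/-! ### Fast multiplication of natural numbers -/

abbrev fEsc : ℕ := 29
abbrev fCarry : ℕ := 30
abbrev fJlog : ℕ := 31
abbrev fPad : ℕ := 32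
abbrev fMul : ℕ := 33
abbrev fMul2 : ℕ := 34

def escBody : Expr := .cond (.tl (.var 0)) (.call fApp (args [
  .call fEsc (.call fHalf (.cons .nil (.var 0))), .cons .nil (.call fHalf (.var 0))])) .nil

/-- `(c, l) ↦ c + l(2)` -/
def carryBody : Expr := .cond (argR 1)
  (.bind (.call fAdd (args [.nil, arg 0, .hd (argR 1)]))
    (.call fBit (args [.hd (.var 0), .call fCarry (args [.tl (.var 0), .tl (rest 1 (.var 1))])])))
  (arg 0)

/-- The binary length of the length of a list, in unary. -/
def jlogBody : Expr := .cond (.var 0) (.cons .nil (.call fJlog (.call fHalf (.var 0)))) .nil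

def padBody : Expr := .cond (arg 0)
  (.cons (.cond (.hd (argR 1)) (.cons (.hd (argR 1)) .nil) .nil)
    (.call fPad (args [.tl (arg 0), .tl (argR 1)]))) .nil

/-- `(x, y) ↦ x y` -/
def mulBody : Expr := .bind (.call fJlog (.call fApp (.var 0)))
  (.bind (.call fPw (.cons .nil (.var 0)))
    (.call fMul2 (args [.var 1, .call fHalf (.var 0),
      .call fNuss (args [.var 1, .call fPad (args [.var 0, nth 0 (.var 2)]),
        .call fPad (args [.var 0, rest 1 (.var 2)])])])))

def mul2Body : Expr := .call fDrop (args [.call fEsc (arg 0),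
  .call fSub (args [.nil, .call fCarry (args [.nil, .call fTake (argR 1)]),
    .call fCarry (args [.nil, .call fDrop (argR 1)])])])

class HasMul (P : Program) : Prop extends HasFFT P where
  esc : P[fEsc]? = some escBody
  carry : P[fCarry]? = some carryBody
  jlog : P[fJlog]? = some jlogBody
  pad : P[fPad]? = some padBody
  mul : P[fMul]? = some mulBody
  mul2 : P[fMul2]? = some mul2Body

theorem esc_le (j : ℕ) : esc j ≤ 2 * j := by
  induction j using Nat.strong_induction_on with
  | _ j ih =>
    rw [esc]
    split_ifs with h
    · omega
    · have := ih ((j + 1) / 2) (by omega); omega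

/-- The first binary digits of a number. -/
def digs : ℕ → ℕ → List ℕ
  | 0, _ => []
  | n + 1, x => x % 2 :: digs n (x / 2)

@[simp] theorem length_digs (n x : ℕ) : (digs n x).length = n := by
  induction n generalizing x with
  | zero => rfl
  | succ n ih => simp [digs, ih]

theorem Bd_digs (n x : ℕ) : Bd 1 (digs n x) := by
  induction n generalizing x with
  | zero => simp [digs, Bd]
  | succ n ih =>
    intro y hy
    rcases List.mem_cons.1 hy with rfl | hy
    · omega
    · exact ih _ y hy

theorem ev_digs {n x : ℕ} (h : x < 2 ^ n) : ev 2 (digs n x) = x := by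
  induction n generalizing x with
  | zero => simp at h; simp [h, digs, ev]
  | succ n ih =>
    rw [digs, ev, ih (by omega)]; simp; omega

theorem digs_eq_append {n x : ℕ} (q : ℕ) (h : x < 2 ^ n) :
    digs (n + q) x = digs n x ++ List.replicate q 0 := by
  induction n generalizing x with
  | zero =>
    obtain rfl : x = 0 := by simpa using h
    simp only [zero_add, digs, List.nil_append]
    induction q with
    | zero => rfl
    | succ q ih => simp [digs, ih, List.replicate_succ]
  | succ n ih =>
    rw [Nat.add_right_comm, digs, digs, ih (by omega), List.cons_append]

theorem natDegree_ev_digs {m n x : ℕ} (h : x < 2 ^ m) (hm : m ≤ n) :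
    (ev (X : ℤ[X]) (digs n x)).natDegree ≤ m - 1 := by
  obtain ⟨q, rfl⟩ := Nat.exists_eq_add_of_le hm
  rw [digs_eq_append q h, ev_append, ev_replicate_zero, mul_zero, add_zero]
  simpa using natDegree_ev (R := ℤ) (digs m x)

/-- The summand `2 ^ b` is what makes the induction close: it leaves room for the next entry, which
is less than `2 ^ b`. -/
theorem ev_two_lt {b : ℕ} {l : List ℕ} (h : Bd b l) : ev 2 l + 2 ^ b ≤ 2 ^ (b + l.length) := by
  induction l with
  | nil => simp [ev]
  | cons a l ih =>
    have h1 := ih fun x hx => h x (by simp [hx])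
    have h2 := h a (by simp)
    rw [ev, List.length_cons, ← add_assoc, pow_succ]
    simp only [Nat.cast_id]
    omega

/-- The value at `2` of a product modulo `x ^ N + 1`, if there is no overflow. -/
theorem ev_two_of_mod {N m m' e x y : ℕ} {h : List ℕ} (hN : m + m' < N) (hx : x < 2 ^ m)
    (hy : y < 2 ^ m') (hl : h.length = 2 * N)
    (hh : ∀ (R : Type) [CommRing R] (z : R), z ^ N = -1 →
      ev z h = 2 ^ e * ev z (digs (2 * N) x) * ev z (digs (2 * N) y)) :
    ev 2 (h.take N) = 2 ^ e * (x * y) + ev 2 (h.drop N) := by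
  -- In the universal ring `ℤ[X] / (X ^ N + 1)` the hypothesis becomes a congruence between integer
  -- polynomials.
  have h1 := hh (AdjoinRoot (X ^ N - C (-1 : ℤ))) (AdjoinRoot.mk _ X) (by
    rw [← map_pow, ← sub_eq_zero, ← map_one (AdjoinRoot.mk _), ← map_neg, ← map_sub,
      AdjoinRoot.mk_eq_zero]
    simp)
  rw [← ev_map, ← ev_map, ← ev_map, ← map_ofNat (AdjoinRoot.mk (X ^ N - C (-1 : ℤ))) 2,
    ← map_pow, ← map_mul, ← map_mul, AdjoinRoot.mk_eq_mk] at h1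
  have h2 : ev (X : ℤ[X]) h = ev X (h.take N) + X ^ N * ev X (h.drop N) := by
    conv_lhs => rw [← List.take_append_drop N h, ev_append]
    congr 3; simp [hl]; omega
  -- As `X ^ N = -1`, the upper half of the list counts negatively.
  have h3 : (X : ℤ[X]) ^ N - C (-1) ∣ ev X (h.take N) - ev X (h.drop N)
      - 2 ^ e * ev X (digs (2 * N) x) * ev X (digs (2 * N) y) := by
    have : ev X (h.take N) - ev X (h.drop N)
      - 2 ^ e * ev X (digs (2 * N) x) * ev X (digs (2 * N) y) =
      (ev X h - 2 ^ e * ev X (digs (2 * N) x) * ev X (digs (2 * N) y)) -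
        ((X : ℤ[X]) ^ N - C (-1)) * ev X (h.drop N) := by
      rw [h2, C_neg, C_1]; ring
    rw [this]
    exact dvd_sub h1 (dvd_mul_right _ _)
  -- Because `m + m' < N`, nothing has degree `N` or more, so the congruence is an equality in
  -- `ℤ[X]` and may be evaluated at `2`.
  have h4 := eq_zero_of_X_pow_sub_C_dvd (by omega) h3 (by
    have d1 := natDegree_ev (R := ℤ) (h.take N)
    have d2 := natDegree_ev (R := ℤ) (h.drop N)
    have d3 := natDegree_ev_digs (n := 2 * N) hx (by omega)
    have d4 := natDegree_ev_digs (n := 2 * N) hy (by omega)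
    have d5 := natDegree_two_pow_mul_le e (ev (X : ℤ[X]) (digs (2 * N) x)) (ev X (digs (2 * N) y))
    simp only [List.length_take, List.length_drop, hl] at d1 d2
    refine (natDegree_sub_le _ _).trans_lt (max_lt ((natDegree_sub_le _ _).trans_lt (max_lt ?_ ?_)) ?_)
    · omega
    · omega
    · omega)
  have h5 := congrArg (Polynomial.evalRingHom (2 : ℤ)) h4
  have h6 (l : List ℕ) : ev (2 : ℤ) l = ((ev 2 l : ℕ) : ℤ) := by
    have := ev_map (Nat.castRingHom ℤ) 2 l
    simpa using this.symm
  have h7 : (2 : ℕ) ^ m ≤ 2 ^ (2 * N) := Nat.pow_le_pow_right (by norm_num) (by omega)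
  have h8 : (2 : ℕ) ^ m' ≤ 2 ^ (2 * N) := Nat.pow_le_pow_right (by norm_num) (by omega)
  rw [map_sub, map_sub, map_mul, map_mul, map_pow, map_ofNat, ev_map, ev_map, ev_map, ev_map,
    map_zero, coe_evalRingHom, eval_X, h6, h6, h6, h6, ev_digs (by omega), ev_digs (by omega)] at h5
  have h9 : ((ev 2 (h.take N) : ℕ) : ℤ) = ((2 ^ e * (x * y) + ev 2 (h.drop N) : ℕ) : ℤ) := by
    push_cast; linear_combination h5
  exact_mod_cast h9

variable {P : Program} [HasMul P]

theorem esc_run (j : ℕ) : Sp P fEsc (un j) (un (esc j)) (400 * (j + 1)) := by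
  induction j using Nat.strong_induction_on with
  | _ j ih =>
    refine Sp.mk HasMul.esc ?_
    by_cases hj : j < 2
    · have hun : (un j).tl = .nil := by interval_cases j <;> rfl
      simp only [escBody, exec, hun]
      rw [esc, dif_pos hj]; exact ⟨rfl, by omega⟩
    · have hun : ∃ d, (un j).tl = .cons .nil d := by
        obtain ⟨j', rfl⟩ : ∃ j', j = j' + 2 := ⟨j - 2, by omega⟩
        exact ⟨un j', rfl⟩
      obtain ⟨d, hun⟩ := hun
      simp only [escBody, exec, hun]
      refine (half_spec _).bind fun t1 ht1 => ?_
      simp only [Data.sp, sp_un] at ht1 ⊢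
      refine (ih ((j + 1) / 2) (by omega)).bind fun t2 ht2 => ?_
      refine (half_spec _).bind fun t3 ht3 => ?_
      refine (app_spec _ _).bind fun t4 ht4 => ⟨?_, ?_⟩
      · rw [esc.eq_1 j, dif_neg hj, ← app_un, sp_un]; rfl
      · rw [sp_un] at ht3 ht4
        have := esc_le ((j + 1) / 2)
        omega

/-- The carry never grows: `(c + a) / 2` is at most the mean of two numbers below `2 ^ b`. -/
theorem carry_run {b : ℕ} : ∀ {l : List ℕ} {c : ℕ}, Bd b l → c < 2 ^ b →
    Sp P fCarry (tup [encNat c, E1 l]) (encNat (c + ev 2 l)) (160 * (b + 1) * (l.length + 1)) := by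
  intro l
  induction l with
  | nil =>
    intro c _ _
    refine Sp.mk HasMul.carry ?_
    simp only [carryBody, exec, encList]
    exact ⟨by simp [ev], by simp; omega⟩
  | cons a l ih =>
    intro c h hc
    have ha := h a (by simp)
    refine Sp.mk HasMul.carry ?_
    simp only [carryBody, exec, encList]
    refine (add_spec b false c a hc ha).bind fun t1 ht1 => ?_
    simp only [exec, Bool.toNat_false, add_zero]
    refine (ih (fun x hx => h x (by simp [hx])) (c := (c + a) / 2) (by omega)).bind fun t2 ht2 => ?_
    refine (bit_spec _ _).bind fun t3 ht3 => ⟨?_, ?_⟩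
    · have := bodd_toNat_add (c + a)
      congr 1
      rw [ev]; simp only [Nat.cast_id]; omega
    · rw [List.length_cons, mul_add _ (l.length + 1)]; omega

theorem jlog_run (n : ℕ) : ∀ d : Data, d.sp = n → Sp P fJlog d (un n.size) (100 * (n + 1)) := by
  induction n using Nat.strong_induction_on with
  | _ n ih =>
    intro d hd
    refine Sp.mk HasMul.jlog ?_
    cases d with
    | nil => subst hd; simp [jlogBody, exec, Data.sp, un]
    | cons a d =>
      simp only [jlogBody, exec]
      refine (half_spec _).bind fun t1 ht1 => ?_
      rw [hd] at ht1 ⊢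
      simp only [Data.sp] at hd
      refine (ih (n / 2) (by omega) _ (by simp)).bind fun t2 ht2 => ⟨?_, by omega⟩
      have : n.size = (n / 2).size + 1 := by
        conv_lhs => rw [← Nat.bit_bodd_div2 n]
        rw [Nat.size_bit (by rw [Nat.bit_bodd_div2]; omega), Nat.div2_val]
      rw [this]; rfl

theorem pad_run (n : ℕ) : ∀ x : ℕ, Sp P fPad (tup [un n, encNat x]) (E1 (digs n x))
    (50 * (n + 1)) := by
  induction n with
  | zero => intro x; exact Sp.mk HasMul.pad (by simp [padBody, exec, un, digs, encList])
  | succ n ih =>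
    intro x
    refine Sp.mk HasMul.pad ?_
    simp only [padBody, exec, un, digs, encList]
    have h := bodd_toNat_add x
    split_ifs with hx
    · refine (ih (x / 2)).bind fun t1 ht1 => ⟨?_, by omega⟩
      rw [hx] at h ⊢; simp at h
      rw [show x % 2 = 1 by omega, encNat_one]; rfl
    · refine (ih (x / 2)).bind fun t1 ht1 => ⟨?_, by omega⟩
      simp at hx
      rw [hx] at h; simp at h
      rw [show x % 2 = 0 by omega, encNat_zero]

/-- The running time of the multiplication of numbers of length `b`. -/
def mulT (b : ℕ) : ℕ := 50000000 * ((b + 1) * (b.size + 1) ^ 5)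

/-- The binary digits of `x` and `y` are taken as coefficients, with `N = 2 ^ j` a power of `2`
above the total number of digits, so the product modulo `X ^ N + 1` does not wrap around. All
coefficients have at most `5 * j + 5` bits, so quadratic arithmetic on them costs a factor of order
`j ^ 2`; with `j ^ 3` from the recursion this is the fifth power in `mulT`. -/
theorem mul_run {b x y : ℕ} (hx : x < 2 ^ b) (hy : y < 2 ^ b) :
    Sp P fMul (tup [encNat x, encNat y]) (encNat (x * y)) (mulT b) := by
  obtain ⟨j, hj⟩ : ∃ j, j = (x.size + y.size).size := ⟨_, rfl⟩
  obtain ⟨N, hN⟩ : ∃ N, N = 2 ^ j := ⟨_, rfl⟩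
  have hsx : x.size ≤ b := Nat.size_le.2 hx
  have hsy : y.size ≤ b := Nat.size_le.2 hy
  have hN1 : x.size + y.size < N := by rw [hN, hj]; exact Nat.lt_size_self _
  have hN2 : N ≤ 4 * b + 1 := by
    rcases Nat.eq_zero_or_pos j with h | h
    · rw [hN, h]; simp
    · have : 2 ^ (j - 1) ≤ x.size + y.size := Nat.lt_size.1 (by omega)
      have : N = 2 * 2 ^ (j - 1) := by rw [hN, ← pow_succ', Nat.sub_add_cancel h]
      omega
  have hN3 : 2 ^ (j + 1) = 2 * N := by rw [pow_succ', hN]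
  obtain ⟨h, h1, h2, h3, h4⟩ := nuss_ok (P := P) j 1 (digs (2 * N) x) (digs (2 * N) y)
    (by rw [length_digs, hN3]) (by rw [length_digs, hN3]) (Bd_digs _ _) (Bd_digs _ _)
  obtain ⟨B, hB⟩ : ∃ B, B = 2 * 1 + 5 * j + 3 := ⟨_, rfl⟩
  rw [← hB] at h2 h4
  rw [hN3] at h1
  rw [← hN] at h3
  have key := ev_two_of_mod hN1 (Nat.lt_size_self x) (Nat.lt_size_self y) h1 h3
  have bt : Bd B (h.take N) := fun x hx => h2 x (List.mem_of_mem_take hx)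
  have bd : Bd B (h.drop N) := fun x hx => h2 x (List.mem_of_mem_drop hx)
  have lt : (h.take N).length = N := by simp [h1]; omega
  have ld : (h.drop N).length = N := by simp [h1]; omega
  have mul2 : Sp P fMul2 (tup [un j, un N, E1 h]) (encNat (x * y))
      (900 * ((B + 1) * (N + 1))) := by
    refine Sp.mk HasMul.mul2 ?_
    simp only [mul2Body, exec]
    refine (esc_run j).bind fun t1 ht1 => ?_
    refine (take_spec _ _).bind fun t2 ht2 => ?_
    rw [sp_un, take_encList _ _ _ (by omega), ← encNat_zero]
    rw [sp_un] at ht2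
    refine (carry_run bt (Nat.two_pow_pos _)).bind fun t3 ht3 => ?_
    refine (drop_spec _ _).bind fun t4 ht4 => ?_
    rw [sp_un, drop_encList]
    rw [sp_un] at ht4
    refine (carry_run bd (Nat.two_pow_pos _)).bind fun t5 ht5 => ?_
    rw [zero_add, zero_add]
    have e1 := ev_two_lt bt
    have e2 := Nat.two_pow_pos B
    rw [lt] at e1
    rw [encNat_zero]
    -- By `key` the lower half of the list has the larger value, so the truncated subtraction is
    -- exact; the difference is `2 ^ esc j * (x * y)`, whose lowest `esc j` bits are then dropped.
    refine (sub_spec (B + N) false _ (ev 2 (h.drop N)) (by omega) (by rw [key]; simp)).bind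
      fun t6 ht6 => ?_
    refine (drop_spec _ (encNat _)).bind fun t7 ht7 => ⟨?_, ?_⟩
    · rw [drop_encNat, sp_un, key]
      simp only [Bool.toNat_false, add_zero]
      rw [Nat.add_sub_cancel, Nat.mul_div_cancel_left _ (Nat.two_pow_pos _)]
    · rw [lt, mul_assoc] at ht3
      rw [ld, mul_assoc] at ht5
      rw [sp_un] at ht7
      have e3 := esc_le j
      have e4 : B + 1 ≤ (B + 1) * (N + 1) := Nat.le_mul_of_pos_right _ (by omega)
      have e5 : N + 1 ≤ (B + 1) * (N + 1) := Nat.le_mul_of_pos_left _ (by omega)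
      omega
  refine Sp.mk HasMul.mul ?_
  simp only [mulBody, exec]
  refine (app_spec (encNat x) (encNat y)).bind fun t1 ht1 => ?_
  refine (jlog_run _ _ (sp_app _ _)).bind fun t2 ht2 => ?_
  rw [sp_encNat, sp_encNat, ← hj]
  rw [sp_encNat] at ht1
  rw [sp_encNat, sp_encNat] at ht2
  refine (pw_spec _).bind fun t3 ht3 => ?_
  simp only [Data.sp, sp_un, hN3] at ht3 ⊢
  refine (half_spec _).bind fun t4 ht4 => ?_
  refine (pad_run _ _).bind fun t5 ht5 => ?_
  refine (pad_run _ _).bind fun t6 ht6 => ?_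
  refine (h4 B le_rfl).bind fun t7 ht7 => ?_
  rw [sp_un, Nat.mul_div_cancel_left _ (by norm_num)]
  rw [sp_un] at ht4
  refine mul2.bind fun t8 ht8 => ⟨rfl, ?_⟩
  have hjs : j ≤ b.size + 1 := by
    rw [hj, Nat.size_le, pow_succ]
    have := Nat.lt_size_self b
    omega
  obtain ⟨s, hs⟩ : ∃ s, s = b.size + 1 := ⟨_, rfl⟩
  rw [← hs] at hjs
  have s1 : 1 ≤ s := by omega
  have f1 : nussT B j ≤ 40000 * (4 * (242 * ((b + 1) * s ^ 5))) := by
    rw [nussT, ← hN]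
    have g1 : (B + 1) ^ 2 ≤ 121 * s ^ 2 := by
      calc (B + 1) ^ 2 ≤ (11 * s) ^ 2 := Nat.pow_le_pow_left (by omega) 2
        _ = _ := by ring
    have g2 : j ^ 3 + 1 ≤ 2 * s ^ 3 := by
      have := Nat.pow_le_pow_left hjs 3
      have := Nat.one_le_pow 3 s s1
      omega
    calc _ ≤ 40000 * (121 * s ^ 2 * ((4 * (b + 1)) * (2 * s ^ 3))) := by
          refine Nat.mul_le_mul_left _ (Nat.mul_le_mul g1 (Nat.mul_le_mul (by omega) g2))
      _ = _ := by ring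
  have f2 : (B + 1) * (N + 1) ≤ 44 * ((b + 1) * s ^ 5) := by
    calc (B + 1) * (N + 1) ≤ (11 * s) * (4 * (b + 1)) := Nat.mul_le_mul (by omega) (by omega)
      _ = 44 * ((b + 1) * s ^ 1) := by ring
      _ ≤ _ := Nat.mul_le_mul_left _ (Nat.mul_le_mul_left _ (Nat.pow_le_pow_right s1 (by norm_num)))
  have f3 : b + 1 ≤ (b + 1) * s ^ 5 := Nat.le_mul_of_pos_right _ (by positivity)
  rw [mulT, ← hs]
  omega

end Lisp


namespace Lisp

/-! ### Modular arithmetic -/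

abbrev fDivm : ℕ := 35
abbrev fDivm2 : ℕ := 36
abbrev fRed : ℕ := 37
abbrev fRed2 : ℕ := 38
abbrev fMm : ℕ := 39
abbrev fPwm : ℕ := 40
abbrev fSqs : ℕ := 41
abbrev fGcd : ℕ := 42
abbrev fAbs : ℕ := 43

/-- `(x, n) ↦ (x / n, x % n)` -/
def divmBody : Expr := .cond (arg 0)
  (.bind (.call fDivm (args [.tl (arg 0), argR 1])) (.call fDivm2 (args [rest 1 (.var 1),
    .hd (.var 0), .call fBit (args [.hd (nth 0 (.var 1)), .tl (.var 0)])]))) (.cons .nil .nil)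

def divm2Body : Expr := .cond (.call fLt (args [.nil, argR 2, arg 0]))
  (.cons (.call fBit (args [.nil, arg 1])) (argR 2))
  (.cons (.call fBit (args [tru, arg 1])) (.call fSub (args [.nil, argR 2, arg 0])))

/-- `x ↦ x % n` for small `x`; the first argument is `(n, 2 ^ c / n, c)` -/
def redBody : Expr := .call fRed2 (args [nth 0 (arg 0), .call fSub (args [.nil, argR 1,
  .call fMul (args [.call fDrop (args [rest 2 (arg 0),
    .call fMul (args [argR 1, nth 1 (arg 0)])]), nth 0 (arg 0)])])])

def red2Body : Expr := .cond (.call fLt (args [.nil, argR 1, arg 0])) (argR 1)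
  (.call fSub (args [.nil, argR 1, arg 0]))

/-- `(x, y) ↦ x y % n` -/
def mmBody : Expr := .call fRed (args [arg 0, .call fMul (argR 1)])

/-- `(x, e) ↦ x ^ e % n` -/
def pwmBody : Expr := .cond (argR 2)
  (.bind (.call fPwm (args [arg 0, arg 1, .tl (argR 2)]))
    (.bind (.call fMm (args [nth 0 (.var 1), .var 0, .var 0]))
      (.cond (.hd (rest 2 (.var 2))) (.call fMm (args [nth 0 (.var 2), .var 0, nth 1 (.var 2)]))
        (.var 0))))
  (.cons tru .nil)

/-- `(u, x) ↦ x ^ 2 ^ u % n` -/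
def sqsBody : Expr := .cond (arg 1)
  (.call fSqs (args [arg 0, .tl (arg 1), .call fMm (args [arg 0, argR 2, argR 2])])) (argR 2)

/-- The greatest common divisor of a number and an odd number. -/
def gcdBody : Expr := .cond (arg 0)
  (.cond (.hd (arg 0)) (.cond (.call fLt (args [.nil, arg 0, argR 1]))
    (.call fGcd (args [.tl (.call fSub (args [.nil, argR 1, arg 0])), arg 0]))
    (.call fGcd (args [.tl (.call fSub (args [.nil, arg 0, argR 1])), argR 1])))
    (.call fGcd (args [.tl (arg 0), argR 1]))) (argR 1)

/-- `(x, y) ↦ |x - y|` -/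
def absBody : Expr := .cond (.call fLt (args [.nil, arg 0, argR 1]))
  (.call fSub (args [.nil, argR 1, arg 0])) (.call fSub (args [.nil, arg 0, argR 1]))

class HasMod (P : Program) : Prop extends HasMul P where
  divm : P[fDivm]? = some divmBody
  divm2 : P[fDivm2]? = some divm2Body
  red : P[fRed]? = some redBody
  red2 : P[fRed2]? = some red2Body
  mm : P[fMm]? = some mmBody
  pwm : P[fPwm]? = some pwmBody
  sqs : P[fSqs]? = some sqsBody
  gcd : P[fGcd]? = some gcdBody
  abs : P[fAbs]? = some absBody

variable {P : Program} [HasMod P]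

theorem divm2_run {n q r p : ℕ} (hp : n < 2 ^ p) (hr : r < 2 * n) :
    Sp P fDivm2 (tup [encNat n, encNat q, encNat r])
      (.cons (encNat (2 * q + r / n)) (encNat (r % n))) (180 * (p + 2)) := by
  refine Sp.mk HasMod.divm2 ?_
  have h1 : (2 : ℕ) ^ (p + 1) = 2 * 2 ^ p := pow_succ' 2 p
  simp only [divm2Body, exec]
  refine (lt_spec (p + 1) false r n (by omega) (by omega)).bind fun t1 ht1 => ?_
  simp only [exec, decide_eq_true_eq, Bool.toNat_false, add_zero]
  split_ifs with h
  · refine (bit_spec false q).bind fun t2 ht2 => ⟨?_, by omega⟩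
    rw [Nat.div_eq_of_lt h, Nat.mod_eq_of_lt h]; rfl
  · refine (bit_spec true q).bind fun t2 ht2 => ?_
    refine (sub_spec (p + 1) false r n (by omega) (by simpa using h)).bind
      fun t3 ht3 => ⟨?_, by omega⟩
    have h2 : r / n = 1 := Nat.div_eq_of_lt_le (by omega) (by omega)
    have h3 : r % n = r - n := by
      rw [Nat.mod_eq_sub_mod (by omega), Nat.mod_eq_of_lt (by omega)]
    rw [h2, h3]; rfl

/-- Long division takes quadratic time, but the program divides only once, to obtain the reciprocal
`2 ^ c / n` on which all reductions rely. -/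
theorem divm_run {n p : ℕ} (hn : 0 < n) (hp : n < 2 ^ p) (b : ℕ) : ∀ {x : ℕ}, x < 2 ^ b →
    Sp P fDivm (tup [encNat x, encNat n]) (.cons (encNat (x / n)) (encNat (x % n)))
      (250 * ((b + 1) * (p + 2))) := by
  induction b with
  | zero =>
    intro x hx
    obtain rfl : x = 0 := by simpa using hx
    refine Sp.mk HasMod.divm ?_
    simp only [divmBody, exec, if_true]
    exact ⟨by simp [encNat_zero], by omega⟩
  | succ b ih =>
    intro x hx
    refine Sp.mk HasMod.divm ?_
    have hT : 250 * ((b + 1 + 1) * (p + 2)) = 250 * ((b + 1) * (p + 2)) + 250 * (p + 2) := by ring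
    by_cases h0 : x = 0
    · subst h0
      simp only [divmBody, exec, if_true]
      refine ⟨by simp [encNat_zero], ?_⟩
      omega
    · simp only [divmBody, exec, h0, if_false]
      refine (ih (x := x / 2) (by omega)).bind fun t1 ht1 => ?_
      simp only [exec]
      refine (bit_spec _ _).bind fun t2 ht2 => ?_
      have h1 := Nat.mod_lt (x / 2) hn
      have h2 := bodd_toNat_add x
      have h3 : x.bodd.toNat ≤ 1 := Bool.toNat_le _
      refine (divm2_run hp (by omega)).bind fun t3 ht3 => ⟨?_, by omega⟩
      have h4 := Nat.div_add_mod (x / 2) n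
      set d := x / 2 / n
      set e := x / 2 % n
      have h5 : x = 2 * e + x.bodd.toNat + n * (2 * d) := by
        conv_lhs => rw [← h2, ← h4]
        ring
      set f := 2 * e + x.bodd.toNat
      congr 2
      · conv_rhs => rw [h5]
        rw [Nat.add_mul_div_left _ _ hn, add_comm]
      · conv_rhs => rw [h5]
        rw [Nat.add_mul_mod_self_left]

theorem le_mulT (b : ℕ) : 50000000 * (b + 1) ≤ mulT b := by
  rw [mulT]
  exact Nat.mul_le_mul_left _ (Nat.le_mul_of_pos_right _ (by positivity))

theorem mulT_mono {b b' : ℕ} (h : b ≤ b') : mulT b ≤ mulT b' := by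
  rw [mulT, mulT]
  have := Nat.size_le_size h
  gcongr

/-- The data for the reduction modulo `n` of numbers less than `2 ^ c`, where `c` is the length
of `u`. -/
def ctx (n : ℕ) (u : Data) : Data := tup [encNat n, encNat (2 ^ u.sp / n), u]

/-- Barrett reduction. The estimated quotient `q = x * μ / 2 ^ c`, with `μ = 2 ^ c / n`, satisfies
`q * n ≤ x < (q + 2) * n` as long as `x < 2 ^ c`, so two multiplications and at most one correcting
subtraction suffice. -/
theorem red_run {n : ℕ} {u : Data} (hn : 0 < n) (hu : n < 2 ^ u.sp) {x : ℕ} (hx : x < 2 ^ u.sp) :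
    Sp P fRed (tup [ctx n u, encNat x]) (encNat (x % n)) (3 * mulT (u.sp + 1)) := by
  obtain ⟨c, hc⟩ : ∃ c, c = u.sp := ⟨_, rfl⟩
  rw [← hc] at hu hx ⊢
  obtain ⟨μ, hμ⟩ : ∃ μ, μ = 2 ^ c / n := ⟨_, rfl⟩
  have hc1 : (2 : ℕ) ^ (c + 1) = 2 * 2 ^ c := pow_succ' 2 c
  have hμ1 : μ ≤ 2 ^ c := hμ ▸ Nat.div_le_self _ _
  have hμ2 : μ * n ≤ 2 ^ c := hμ ▸ Nat.div_mul_le_self _ _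
  have hμ3 : 2 ^ c < (μ + 1) * n := by
    rw [hμ, mul_comm]; exact Nat.lt_mul_div_succ _ hn
  obtain ⟨q, hq⟩ : ∃ q, q = x * μ / 2 ^ c := ⟨_, rfl⟩
  have hq1 : q * 2 ^ c ≤ x * μ := hq ▸ Nat.div_mul_le_self _ _
  have hq2 : x * μ < 2 ^ c * (q + 1) := hq ▸ Nat.lt_mul_div_succ _ (by positivity)
  have hqx : q * n ≤ x := by
    have h1 : q * n * 2 ^ c ≤ x * 2 ^ c := by
      calc q * n * 2 ^ c = (q * 2 ^ c) * n := by ring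
        _ ≤ x * μ * n := Nat.mul_le_mul_right _ hq1
        _ = x * (μ * n) := by ring
        _ ≤ x * 2 ^ c := Nat.mul_le_mul_left _ hμ2
    exact Nat.le_of_mul_le_mul_right h1 (by positivity)
  have hxq : x < (q + 2) * n := by
    have h1 : x * 2 ^ c < (q + 2) * n * 2 ^ c := by
      calc x * 2 ^ c ≤ x * ((μ + 1) * n) := Nat.mul_le_mul_left _ hμ3.le
        _ = (x * μ + x) * n := by ring
        _ < (2 ^ c * (q + 1) + 2 ^ c) * n := by gcongr
        _ = _ := by ring
    exact lt_of_mul_lt_mul_right h1 (by positivity)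
  have hq3 : q < 2 ^ (c + 1) := by
    have : q ≤ q * n := Nat.le_mul_of_pos_right _ hn
    omega
  have hy : x - q * n < 2 * n := by rw [add_mul] at hxq; omega
  have hU := le_mulT (c + 1)
  have red2 : Sp P fRed2 (tup [encNat n, encNat (x - q * n)]) (encNat (x % n))
      (200 * (c + 2)) := by
    refine Sp.mk HasMod.red2 ?_
    simp only [red2Body, exec]
    refine (lt_spec (c + 1) false (x - q * n) n (by omega) (by omega)).bind fun t1 ht1 => ?_
    simp only [exec, decide_eq_true_eq, Bool.toNat_false, add_zero]
    have e : x % n = (x - q * n) % n := by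
      conv_lhs => rw [← Nat.sub_add_cancel hqx, Nat.add_mul_mod_self_right]
    split_ifs with h
    · exact ⟨by rw [e, Nat.mod_eq_of_lt h], by omega⟩
    · refine (sub_spec (c + 1) false (x - q * n) n (by omega) (by simpa using h)).bind
        fun t3 ht3 => ⟨?_, by omega⟩
      rw [e, Nat.mod_eq_sub_mod (by omega), Nat.mod_eq_of_lt (by omega)]; rfl
  refine Sp.mk HasMod.red ?_
  simp only [redBody, exec, ctx, ← hc, ← hμ]
  refine (mul_run (b := c + 1) (x := x) (y := μ) (by omega) (by omega)).bind fun t1 ht1 => ?_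
  refine (drop_spec u (encNat (x * μ))).bind fun t2 ht2 => ?_
  rw [drop_encNat, ← hc, ← hq]
  rw [← hc] at ht2
  refine (mul_run (b := c + 1) (x := q) (y := n) (by omega) (by omega)).bind fun t3 ht3 => ?_
  refine (sub_spec c false x (q * n) (by omega) (by simpa using hqx)).bind fun t4 ht4 => ?_
  refine red2.bind fun t5 ht5 => ⟨rfl, ?_⟩
  omega

theorem mm_run {n : ℕ} {u : Data} (hn : 0 < n) (hu : n * n < 2 ^ u.sp) {x y : ℕ} (hx : x < n)
    (hy : y < n) :
    Sp P fMm (tup [ctx n u, encNat x, encNat y]) (encNat (x * y % n)) (5 * mulT (u.sp + 1)) := by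
  refine Sp.mk HasMod.mm ?_
  have h1 : n ≤ n * n := Nat.le_mul_of_pos_left _ hn
  have h2 : x * y < n * n := Nat.mul_lt_mul'' hx hy
  have h3 : (2 : ℕ) ^ (u.sp + 1) = 2 * 2 ^ u.sp := pow_succ' 2 _
  simp only [mmBody, exec]
  refine (mul_run (b := u.sp + 1) (x := x) (y := y) (by omega) (by omega)).bind fun t1 ht1 => ?_
  refine (red_run hn (by omega) (by omega)).bind fun t2 ht2 => ⟨rfl, ?_⟩
  have hU := le_mulT (u.sp + 1)
  omega

theorem pwm_run {n : ℕ} {u : Data} (hn : 1 < n) (hu : n * n < 2 ^ u.sp) {x : ℕ} (hx : x < n)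
    (b : ℕ) : ∀ {e : ℕ}, e < 2 ^ b →
    Sp P fPwm (tup [ctx n u, encNat x, encNat e]) (encNat (x ^ e % n))
      (11 * ((b + 1) * mulT (u.sp + 1))) := by
  have hU := le_mulT (u.sp + 1)
  induction b with
  | zero =>
    intro e he
    obtain rfl : e = 0 := by simpa using he
    refine Sp.mk HasMod.pwm ?_
    simp only [pwmBody, exec, if_true]
    exact ⟨by simp [encNat_one, Nat.mod_eq_of_lt hn], by omega⟩
  | succ b ih =>
    intro e he
    have hT : 11 * ((b + 1 + 1) * mulT (u.sp + 1)) = 11 * ((b + 1) * mulT (u.sp + 1)) +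
      11 * mulT (u.sp + 1) := by ring
    refine Sp.mk HasMod.pwm ?_
    by_cases h0 : e = 0
    · subst h0
      simp only [pwmBody, exec, if_true]
      exact ⟨by simp [encNat_one, Nat.mod_eq_of_lt hn], by omega⟩
    · simp only [pwmBody, exec, h0, if_false]
      have hm (y : ℕ) : y % n < n := Nat.mod_lt _ (by omega)
      refine (ih (e := e / 2) (by omega)).bind fun t1 ht1 => ?_
      refine (mm_run (by omega) hu (hm _) (hm _)).bind fun t2 ht2 => ?_
      have h2 := bodd_toNat_add e
      have h3 : x ^ (e / 2) % n * (x ^ (e / 2) % n) % n = x ^ (2 * (e / 2)) % n := by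
        rw [← Nat.mul_mod, ← pow_add, two_mul]
      rw [h3]
      split_ifs with h
      · refine (mm_run (by omega) hu (hm _) hx).bind fun t3 ht3 => ⟨?_, by omega⟩
        rw [h] at h2
        congr 1
        conv_rhs => rw [← h2]
        rw [Bool.toNat_true, pow_succ, Nat.mul_mod, Nat.mod_mod, ← Nat.mul_mod]
      · simp at h
        rw [h] at h2
        refine ⟨?_, by omega⟩
        congr 2
        simpa using congrArg (x ^ ·) h2

/-- Formulated for arbitrary `x`, of which the program sees the residue, so that the induction
hypothesis applies to the unreduced square `x * x`. -/
theorem sqs_run {n : ℕ} {u : Data} (hn : 0 < n) (hu : n * n < 2 ^ u.sp) (d : Data) : ∀ (x : ℕ),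
    Sp P fSqs (tup [ctx n u, d, encNat (x % n)]) (encNat (x ^ 2 ^ d.sp % n))
      (6 * ((d.sp + 1) * mulT (u.sp + 1))) := by
  have hU := le_mulT (u.sp + 1)
  induction d with
  | nil =>
    intro x
    refine Sp.mk HasMod.sqs ?_
    simp only [sqsBody, exec]
    exact ⟨by simp [Data.sp], by simp only [Data.sp]; omega⟩
  | cons a d _ ih =>
    intro x
    refine Sp.mk HasMod.sqs ?_
    simp only [sqsBody, exec, Data.sp]
    refine (mm_run hn hu (Nat.mod_lt _ hn) (Nat.mod_lt _ hn)).bind fun t1 ht1 => ?_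
    rw [← Nat.mul_mod]
    refine (ih (x * x)).bind fun t2 ht2 => ⟨?_, ?_⟩
    · rw [← pow_two, ← pow_mul, pow_succ' 2 d.sp]
    · have hT : 6 * ((d.sp + 1 + 1) * mulT (u.sp + 1)) = 6 * ((d.sp + 1) * mulT (u.sp + 1)) +
        6 * mulT (u.sp + 1) := by ring
      omega

theorem gcd_half_of_even {x y : ℕ} (hx : x % 2 = 0) (hy : y % 2 = 1) :
    Nat.gcd (x / 2) y = Nat.gcd x y := by
  obtain ⟨d, rfl⟩ : ∃ d, x = 2 * d := ⟨x / 2, by omega⟩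
  rw [Nat.mul_div_cancel_left _ (by norm_num)]
  refine (Nat.Coprime.gcd_mul_left_cancel d ?_).symm
  rw [Nat.coprime_two_left]
  exact Nat.odd_iff.2 hy

/-- The binary algorithm. The second argument remains odd, so factors `2` of the first may be
discarded. If both are odd, their difference is even and is halved at once. Each call thus removes a
bit from the total `p + q`, at the cost of one comparison and one subtraction. -/
theorem gcd_run {B : ℕ} (b : ℕ) : ∀ {p q x y : ℕ}, p + q ≤ b → x < 2 ^ p → y < 2 ^ q → x < 2 ^ B →
    y < 2 ^ B → y % 2 = 1 →
    Sp P fGcd (tup [encNat x, encNat y]) (encNat (Nat.gcd x y)) (200 * ((b + 1) * (B + 1))) := by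
  induction b with
  | zero =>
    intro p q x y hpq hx hy _ _ h
    obtain rfl : q = 0 := by omega
    obtain rfl : y = 0 := by simpa using hy
    simp at h
  | succ b ih =>
    intro p q x y hpq hx hy hxB hyB h
    have hT : 200 * ((b + 1 + 1) * (B + 1)) = 200 * ((b + 1) * (B + 1)) + 200 * (B + 1) := by ring
    refine Sp.mk HasMod.gcd ?_
    by_cases h0 : x = 0
    · subst h0
      simp only [gcdBody, exec, if_true]
      exact ⟨by simp, by omega⟩
    obtain ⟨p, rfl⟩ : ∃ p', p = p' + 1 := ⟨p - 1, by
      rcases p with _ | p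
      · simp at hx; omega
      · rfl⟩
    obtain ⟨q, rfl⟩ : ∃ q', q = q' + 1 := ⟨q - 1, by
      rcases q with _ | q
      · simp at hy; omega
      · rfl⟩
    have h2 := bodd_toNat_add x
    simp only [gcdBody, exec, h0, if_false]
    split_ifs with hb
    · rw [hb] at h2
      simp only [Bool.toNat_true] at h2
      refine (lt_spec B false x y hxB hyB).bind fun t1 ht1 => ?_
      simp only [exec, decide_eq_true_eq, Bool.toNat_false, add_zero]
      split_ifs with hlt
      · refine (sub_spec B false y x hyB (by simp; omega)).bind fun t2 ht2 => ?_
        simp only [exec, Bool.toNat_false, add_zero]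
        refine (ih (p := q) (q := p + 1) (by omega) (by omega) hx (by omega) hxB (by omega)).bind
          fun t3 ht3 => ⟨?_, by omega⟩
        rw [gcd_half_of_even (by omega) (by omega), Nat.gcd_sub_self_left hlt.le, Nat.gcd_comm]
      · refine (sub_spec B false x y hxB (by simp; omega)).bind fun t2 ht2 => ?_
        simp only [exec, Bool.toNat_false, add_zero]
        refine (ih (p := p) (q := q + 1) (by omega) (by omega) hy (by omega) hyB h).bind
          fun t3 ht3 => ⟨?_, by omega⟩
        rw [gcd_half_of_even (by omega) h, Nat.gcd_sub_self_left (by omega)]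
    · simp at hb
      rw [hb] at h2
      simp only [Bool.toNat_false] at h2
      refine (ih (p := p) (q := q + 1) (by omega) (by omega) hy (by omega) hyB h).bind
        fun t3 ht3 => ⟨?_, by omega⟩
      rw [gcd_half_of_even (by omega) h]

theorem abs_run {b x y : ℕ} (hx : x < 2 ^ b) (hy : y < 2 ^ b) :
    Sp P fAbs (tup [encNat x, encNat y]) (encNat (Int.natAbs ((x : ℤ) - y))) (180 * (b + 1)) := by
  refine Sp.mk HasMod.abs ?_
  simp only [absBody, exec]
  refine (lt_spec b false x y hx hy).bind fun t1 ht1 => ?_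
  simp only [exec, decide_eq_true_eq, Bool.toNat_false, add_zero]
  split_ifs with h
  · refine (sub_spec b false y x hy (by simp; omega)).bind fun t2 ht2 => ⟨?_, by omega⟩
    congr 1; simp; omega
  · refine (sub_spec b false x y hx (by simp; omega)).bind fun t2 ht2 => ⟨?_, by omega⟩
    congr 1; simp; omega

end Lisp


namespace Lisp

/-! ### Perfect powers -/

abbrev fPowU : ℕ := 44
abbrev fRoot : ℕ := 45
abbrev fPp : ℕ := 46

/-- `(x, u) ↦ x ^ u` -/
def powUBody : Expr := .cond (argR 1)
  (.call fMul (args [arg 0, .call fPowU (args [arg 0, .tl (argR 1)])])) (.cons tru .nil)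

/-- `(u, n) ↦ ⌊n ^ (1 / u)⌋` -/
def rootBody : Expr := .cond (argR 1)
  (.bind (.call fRoot (args [arg 0, .call fDrop (.var 0)]))
    (.bind (.call fBit (args [tru, .var 0]))
      (.cond (.call fLt (args [.nil, rest 1 (.var 2),
          .call fPowU (args [.var 0, nth 0 (.var 2)])]))
        (.call fBit (args [.nil, .var 1])) (.var 0)))) .nil

/-- `(f, u, n) ↦` whether `n` is an `e`-th power for one of the `f` exponents `e = u, u + 1, …` -/
def ppBody : Expr := .cond (arg 0)
  (.cond (.call fEq (args [.call fPowU (args [.call fRoot (argR 1), arg 1]), argR 2])) tru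
    (.call fPp (args [.tl (arg 0), .cons .nil (arg 1), argR 2]))) .nil

class HasPow (P : Program) : Prop extends HasMod P where
  powU : P[fPowU]? = some powUBody
  root : P[fRoot]? = some rootBody
  pp : P[fPp]? = some ppBody

variable {P : Program} [HasPow P]

theorem powU_run {b x : ℕ} (hx : 0 < x) (hb : x < 2 ^ b) (u : Data) : x ^ u.sp < 2 ^ b →
    Sp P fPowU (tup [encNat x, u]) (encNat (x ^ u.sp)) (2 * ((u.sp + 1) * mulT b)) := by
  have hU := le_mulT b
  induction u with
  | nil =>
    intro _
    refine Sp.mk HasPow.powU ?_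
    simp only [powUBody, exec, Data.sp]
    exact ⟨by simp [encNat_one], by omega⟩
  | cons a u _ ih =>
    intro h
    simp only [Data.sp] at h
    have h1 : x ^ u.sp < 2 ^ b := (Nat.pow_le_pow_right hx (Nat.le_succ _)).trans_lt h
    refine Sp.mk HasPow.powU ?_
    simp only [powUBody, exec, Data.sp]
    refine (ih h1).bind fun t1 ht1 => ?_
    refine (mul_run hb h1).bind fun t2 ht2 => ⟨by rw [pow_succ'], ?_⟩
    have hT : 2 * ((u.sp + 1 + 1) * mulT b) = 2 * ((u.sp + 1) * mulT b) + 2 * mulT b := by ring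
    omega

/-- The root is found bit by bit: if `r` is the integral root of `n / 2 ^ u.sp`, then `(2 * r) ^
u.sp ≤ n < (2 * r + 2) ^ u.sp`, so a single trial power decides between `2 * r` and `2 * r + 1`. -/
theorem root_run {u : Data} (hu : 0 < u.sp) {L : ℕ} (b : ℕ) : ∀ {n : ℕ}, n < 2 ^ b → b ≤ L →
    ∃ r, r ^ u.sp ≤ n ∧ n < (r + 1) ^ u.sp ∧ Sp P fRoot (tup [u, encNat n]) (encNat r)
      ((b + 1) * (3 * ((u.sp + 1) * mulT (u.sp + L)))) := by
  obtain ⟨M, hM⟩ : ∃ M, M = (u.sp + 1) * mulT (u.sp + L) := ⟨_, rfl⟩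
  have hU := le_mulT (u.sp + L)
  have hMU : mulT (u.sp + L) ≤ M := hM ▸ Nat.le_mul_of_pos_left _ (by omega)
  have zero (b : ℕ) : Sp P fRoot (tup [u, encNat 0]) (encNat 0) ((b + 1) * (3 * M)) := by
    refine Sp.mk HasPow.root ?_
    simp only [rootBody, exec, if_true]
    refine ⟨by simp [encNat_zero], ?_⟩
    have : 3 * M ≤ (b + 1) * (3 * M) := Nat.le_mul_of_pos_left _ (by omega)
    omega
  rw [← hM]
  induction b with
  | zero =>
    intro n hn _
    obtain rfl : n = 0 := by simpa using hn
    exact ⟨0, by simp [hu.ne'], by simp, zero 0⟩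
  | succ b ih =>
    intro n hn hb
    by_cases h0 : n = 0
    · subst h0
      exact ⟨0, by simp [hu.ne'], by simp, zero (b + 1)⟩
    have h2e : 2 ≤ 2 ^ u.sp := Nat.le_self_pow hu.ne' 2
    obtain ⟨r, h1, h2, h3⟩ := ih (n := n / 2 ^ u.sp) (by
      have : n / 2 ^ u.sp ≤ n / 2 := Nat.div_le_div_left h2e (by norm_num)
      omega) (by omega)
    have h4 : (2 * r) ^ u.sp ≤ n := by
      rw [mul_pow]
      exact (Nat.mul_le_mul_left _ h1).trans (Nat.mul_div_le _ _)
    have h5 : n < (2 * r + 1 + 1) ^ u.sp := by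
      rw [show 2 * r + 1 + 1 = 2 * (r + 1) by ring, mul_pow]
      exact (Nat.lt_mul_div_succ n (by positivity)).trans_le (Nat.mul_le_mul_left _ h2)
    -- Bounds the length of the trial power. The comparison `2 * r + 1 ≤ 2 * (2 * r)` fails for `r =
    -- 0`, which is treated apart.
    have h6 : (2 * r + 1) ^ u.sp < 2 ^ (u.sp + L) := by
      rcases Nat.eq_zero_or_pos r with rfl | hr
      · simp; omega
      · calc (2 * r + 1) ^ u.sp ≤ (2 * (2 * r)) ^ u.sp := Nat.pow_le_pow_left (by omega) _
          _ = 2 ^ u.sp * (2 * r) ^ u.sp := mul_pow _ _ _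
          _ ≤ 2 ^ u.sp * n := Nat.mul_le_mul_left _ h4
          _ < 2 ^ u.sp * 2 ^ L := Nat.mul_lt_mul_of_pos_left
              (hn.trans_le (Nat.pow_le_pow_right (by norm_num) hb)) (by positivity)
          _ = _ := (pow_add _ _ _).symm
    have h7 : 2 * r + 1 < 2 ^ (u.sp + L) := (Nat.le_self_pow hu.ne' _).trans_lt h6
    have h8 : n < 2 ^ (u.sp + L) := hn.trans_le (Nat.pow_le_pow_right (by norm_num) (by omega))
    have key : ∀ r', (r' = if n < (2 * r + 1) ^ u.sp then 2 * r else 2 * r + 1) →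
        Sp P fRoot (tup [u, encNat n]) (encNat r') ((b + 1 + 1) * (3 * M)) := by
      intro r' hr'
      refine Sp.mk HasPow.root ?_
      simp only [rootBody, exec, h0, if_false]
      refine (drop_spec u (encNat n)).bind fun t1 ht1 => ?_
      rw [drop_encNat]
      refine h3.bind fun t2 ht2 => ?_
      refine (bit_spec true r).bind fun t3 ht3 => ?_
      rw [Bool.toNat_true]
      refine (powU_run (by omega) h7 u h6).bind fun t4 ht4 => ?_
      refine (lt_spec (u.sp + L) false n _ h8 h6).bind fun t5 ht5 => ?_
      simp only [exec, decide_eq_true_eq, Bool.toNat_false, add_zero]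
      have hT : (b + 1 + 1) * (3 * M) = (b + 1) * (3 * M) + 3 * M := by ring
      rw [← hM] at ht4
      split_ifs with h
      · refine (bit_spec false r).bind fun t6 ht6 => ⟨?_, by omega⟩
        rw [hr', if_pos h]; rfl
      · exact ⟨by rw [hr', if_neg h], by omega⟩
    by_cases h : n < (2 * r + 1) ^ u.sp
    · exact ⟨2 * r, h4, h, key _ (by rw [if_pos h])⟩
    · exact ⟨2 * r + 1, not_lt.1 h, h5, key _ (by rw [if_neg h])⟩

/-- If `n = d ^ e`, then `d` is the integral `e`-th root of `n`, so one root and one power per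
exponent decide; `f` serves as a counter of the exponents still to be tried. -/
theorem pp_run {n L : ℕ} (hn0 : 0 < n) (hn : n < 2 ^ L) (f : Data) : ∀ {u : Data}, 0 < u.sp →
    u.sp + f.sp ≤ L + 2 → ∃ β : Bool, (β = true ↔ ∃ e, u.sp ≤ e ∧ e < u.sp + f.sp ∧ ∃ d, n = d ^ e) ∧
      Sp P fPp (tup [f, u, encNat n]) (encBool β)
        ((f.sp + 1) * (6 * ((L + 2) * ((L + 2) * mulT (2 * L + 2))))) := by
  classical
  obtain ⟨M, hM⟩ : ∃ M, M = (L + 2) * ((L + 2) * mulT (2 * L + 2)) := ⟨_, rfl⟩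
  have hU := le_mulT (2 * L + 2)
  have hMU1 : (L + 2) * mulT (2 * L + 2) ≤ M := hM ▸ Nat.le_mul_of_pos_left _ (by omega)
  have hMU : mulT (2 * L + 2) ≤ (L + 2) * mulT (2 * L + 2) := Nat.le_mul_of_pos_left _ (by omega)
  rw [← hM]
  induction f with
  | nil =>
    intro u _ _
    refine ⟨false, by simp [Data.sp]; omega, Sp.mk HasPow.pp ?_⟩
    simp only [ppBody, exec]
    exact ⟨rfl, by simp only [Data.sp]; omega⟩
  | cons a f _ ih =>
    intro u hu huf
    simp only [Data.sp] at huf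
    obtain ⟨β, hβ1, hβ2⟩ := ih (u := .cons .nil u) (by simp [Data.sp]) (by simp only [Data.sp]; omega)
    obtain ⟨r, h1, h2, h3⟩ := root_run (P := P) hu L hn le_rfl
    have hr0 : 0 < r := by
      rcases Nat.eq_zero_or_pos r with rfl | hr
      · simp at h2; omega
      · exact hr
    have hpow : r ^ u.sp < 2 ^ (2 * L + 2) :=
      h1.trans_lt (hn.trans_le (Nat.pow_le_pow_right (by norm_num) (by omega)))
    have hr2 : r < 2 ^ (2 * L + 2) := (Nat.le_self_pow hu.ne' _).trans_lt hpow
    have hT : (f.sp + 1 + 1) * (6 * M) = (f.sp + 1) * (6 * M) + 6 * M := by ring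
    have e1 : (L + 1) * (3 * ((u.sp + 1) * mulT (u.sp + L))) ≤ 3 * M := by
      calc _ ≤ (L + 2) * (3 * ((L + 2) * mulT (2 * L + 2))) := by
            refine Nat.mul_le_mul (by omega) (Nat.mul_le_mul_left _ (Nat.mul_le_mul (by omega) ?_))
            exact mulT_mono (by omega)
        _ = _ := by rw [hM]; ring
    have e2 : 2 * ((u.sp + 1) * mulT (2 * L + 2)) ≤ 2 * M := by
      refine Nat.mul_le_mul_left _ (le_trans ?_ hMU1)
      exact Nat.mul_le_mul_right _ (by omega)
    have key : ∀ β' : Bool, β' = (decide (r ^ u.sp = n) || β) →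
        Sp P fPp (tup [.cons a f, u, encNat n]) (encBool β') ((f.sp + 1 + 1) * (6 * M)) := by
      intro β' hβ'
      refine Sp.mk HasPow.pp ?_
      simp only [ppBody, exec]
      refine h3.bind fun t1 ht1 => ?_
      refine (powU_run hr0 hr2 u hpow).bind fun t2 ht2 => ?_
      refine (eq_spec _ (encNat n)).bind fun t3 ht3 => ?_
      have := nodes_encNat_lt hpow
      simp only [exec, decide_eq_true_eq, encNat_injective.eq_iff]
      split_ifs with h
      · exact ⟨by rw [hβ', decide_eq_true h]; rfl, by omega⟩
      · refine hβ2.bind fun t4 ht4 => ⟨?_, by omega⟩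
        rw [hβ', decide_eq_false h]; rfl
    refine ⟨_, ?_, key _ rfl⟩
    simp only [Bool.or_eq_true, decide_eq_true_eq, hβ1, Data.sp]
    constructor
    · rintro (h | ⟨e, he1, he2, d, hd⟩)
      · exact ⟨u.sp, le_rfl, by omega, r, h.symm⟩
      · exact ⟨e, by omega, by omega, d, hd⟩
    · rintro ⟨e, he1, he2, d, hd⟩
      rcases he1.eq_or_lt with rfl | he1
      · left
        have : d = r := by
          have k1 : d < r + 1 := lt_of_pow_lt_pow_left₀ u.sp (by omega) (hd ▸ h2)
          have k2 : r < d + 1 := by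
            refine lt_of_pow_lt_pow_left₀ u.sp (by omega) (h1.trans_lt ?_)
            rw [hd]; exact Nat.pow_lt_pow_left (by omega) hu.ne'
          omega
        rw [hd, this]
      · exact .inr ⟨e, by omega, by omega, d, hd⟩

end Lisp


namespace Lisp

open Polynomial

/-! ### Polynomials modulo `n` and `x ^ D - a` -/

abbrev fPack : ℕ := 47
abbrev fApw : ℕ := 48
abbrev fUnp : ℕ := 49
abbrev fLow : ℕ := 50
abbrev fFold : ℕ := 51
abbrev fPml : ℕ := 52
abbrev fPpw : ℕ := 53
abbrev fSmap : ℕ := 54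
abbrev fInc : ℕ := 55

/-- `(w, x, y) ↦ x + 2 ^ w y` for `x < 2 ^ w` -/
def apwBody : Expr := .cond (arg 0)
  (.call fBit (args [.hd (arg 1), .call fApw (args [.tl (arg 0), .tl (arg 1), argR 2])])) (argR 2)

/-- `(w, l) ↦ l(2 ^ w)` -/
def packBody : Expr := .cond (argR 1)
  (.call fApw (args [arg 0, .hd (argR 1), .call fPack (args [arg 0, .tl (argR 1)])])) .nil

/-- `(w, x) ↦ x % 2 ^ w` -/
def lowBody : Expr := .cond (arg 0)
  (.call fBit (args [.hd (argR 1), .call fLow (args [.tl (arg 0), .tl (argR 1)])])) .nil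

/-- The first digits of a number to the base `2 ^ w`. -/
def unpBody : Expr := .cond (arg 0) (.cons (.call fLow (argR 1))
  (.call fUnp (args [.tl (arg 0), arg 1, .call fDrop (argR 1)]))) .nil

/-- `(l, l') ↦ l + a l'` modulo `n` -/
def foldBody : Expr := .cond (arg 2)
  (.cons (.call fRed (args [arg 0, .call fAdd (args [.nil, .hd (arg 2),
      .call fMul (args [arg 1, .call fRed (args [arg 0, .hd (argR 3)])])])]))
    (.call fFold (args [arg 0, arg 1, .tl (arg 2), .tl (argR 3)]))) .nil

/-- The product of two polynomials; the first argument is `(ctx, a, D)`. -/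
def pmlBody : Expr := .bind
  (.call fUnp (args [.call fApp (args [rest 2 (arg 0), rest 2 (arg 0)]), rest 2 (nth 0 (arg 0)),
    .call fMul (args [.call fPack (args [rest 2 (nth 0 (arg 0)), arg 1]),
      .call fPack (args [rest 2 (nth 0 (arg 0)), argR 2])])]))
  (.call fFold (args [nth 0 (nth 0 (.var 1)), nth 1 (nth 0 (.var 1)),
    .call fTake (args [rest 2 (nth 0 (.var 1)), .var 0]),
    .call fDrop (args [rest 2 (nth 0 (.var 1)), .var 0])]))

/-- A power of a polynomial. -/
def ppwBody : Expr := .cond (argR 2)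
  (.bind (.call fPpw (args [arg 0, arg 1, .tl (argR 2)]))
    (.bind (.call fPml (args [nth 0 (.var 1), .var 0, .var 0]))
      (.cond (.hd (rest 2 (.var 2))) (.call fPml (args [nth 0 (.var 2), .var 0, nth 1 (.var 2)]))
        (.var 0))))
  (.cons (.cons tru .nil) (.tl (rest 2 (arg 0))))

/-- `l ↦ m l` modulo `n` -/
def smapBody : Expr := .cond (argR 2)
  (.cons (.call fMm (args [arg 0, arg 1, .hd (argR 2)]))
    (.call fSmap (args [arg 0, arg 1, .tl (argR 2)]))) .nil

/-- `l ↦ 1 + l` modulo `n` -/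
def incBody : Expr :=
  .cons (.call fRed (args [arg 0, .call fAdd (args [tru, .hd (argR 1), .nil])])) (.tl (argR 1))

class HasPoly (P : Program) : Prop extends HasPow P where
  pack : P[fPack]? = some packBody
  apw : P[fApw]? = some apwBody
  unp : P[fUnp]? = some unpBody
  low : P[fLow]? = some lowBody
  fold : P[fFold]? = some foldBody
  pml : P[fPml]? = some pmlBody
  ppw : P[fPpw]? = some ppwBody
  smap : P[fSmap]? = some smapBody
  inc : P[fInc]? = some incBody

/-- Product of polynomials. -/
def lconv : List ℕ → List ℕ → List ℕ
  | [], g => List.replicate g.length 0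
  | a :: f, g => vadd (g.map (a * ·) ++ List.replicate (f.length + 1) 0) (0 :: lconv f g)

@[simp] theorem length_lconv (f g : List ℕ) : (lconv f g).length = f.length + g.length := by
  induction f with
  | nil => simp [lconv]
  | cons a f ih => rw [lconv, length_vadd] <;> simp [ih] <;> omega

theorem ev_lconv {R : Type*} [CommSemiring R] (x : R) (f g : List ℕ) :
    ev x (lconv f g) = ev x f * ev x g := by
  induction f with
  | nil => simp [lconv, ev, ev_replicate_zero]
  | cons a f ih =>
    rw [lconv, ev_vadd _ _ _ (by simp; omega), ev_append, ev_scale, ev_replicate_zero, ev, ev, ih]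
    simp; ring

theorem lconv_lt {n : ℕ} {f g : List ℕ} (hf : ∀ x ∈ f, x < n) (hg : ∀ x ∈ g, x < n) (hn : 0 < n) :
    ∀ x ∈ lconv f g, x < f.length * (n * n) + 1 := by
  induction f with
  | nil => intro x hx; simp [lconv] at hx; simp [hx.2]
  | cons a f ih =>
    intro x hx
    have h1 := vadd_lt (M := n * n) (M' := f.length * (n * n) + 1) (fun y hy => by
      rcases List.mem_append.1 hy with hy | hy
      · obtain ⟨z, hz, rfl⟩ := List.mem_map.1 hy
        exact Nat.mul_lt_mul'' (hf a (by simp)) (hg z hz)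
      · rw [(List.mem_replicate.1 hy).2]; exact Nat.mul_pos hn hn) (fun y hy => by
      rcases List.mem_cons.1 hy with rfl | hy
      · omega
      · exact ih (fun x hx => hf x (by simp [hx])) y hy) x hx
    rw [List.length_cons, add_mul]; omega

/-- The first digits of a number to the base `2 ^ w`. -/
def unp (w : ℕ) : ℕ → ℕ → List ℕ
  | 0, _ => []
  | k + 1, x => x % 2 ^ w :: unp w k (x / 2 ^ w)

/-- Kronecker substitution is invertible: coefficients below `2 ^ w` are the digits of the value at
`2 ^ w`. -/
theorem unp_ev {w : ℕ} {l : List ℕ} (h : Bd w l) : unp w l.length (ev (2 ^ w) l) = l := by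
  induction l with
  | nil => rfl
  | cons a l ih =>
    have ha := h a (by simp)
    rw [List.length_cons, unp, ev, Nat.cast_id, Nat.add_mul_mod_self_left, Nat.mod_eq_of_lt ha,
      Nat.add_mul_div_left _ _ (by positivity), Nat.div_eq_of_lt ha, zero_add,
      ih fun x hx => h x (by simp [hx])]

theorem ev_two_pow_lt {w : ℕ} {l : List ℕ} (h : Bd w l) : ev (2 ^ w) l < 2 ^ (w * l.length) := by
  induction l with
  | nil => simp [ev]
  | cons a l ih =>
    have ha := h a (by simp)
    have ih := ih fun x hx => h x (by simp [hx])
    rw [ev, Nat.cast_id, List.length_cons, mul_add, mul_one, pow_add, mul_comm (2 ^ (w * l.length))]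
    calc a + 2 ^ w * ev (2 ^ w) l < 2 ^ w + 2 ^ w * ev (2 ^ w) l := by omega
      _ = 2 ^ w * (ev (2 ^ w) l + 1) := by ring
      _ ≤ _ := Nat.mul_le_mul_left _ ih

/-- `l + a l'` modulo `n` -/
def foldL (n a : ℕ) (l l' : List ℕ) : List ℕ :=
  List.zipWith (fun x y => (x + a * (y % n)) % n) l l'

theorem ev_foldL {n a : ℕ} : ∀ {l l' : List ℕ}, l.length = l'.length →
    ev (X : (ZMod n)[X]) (foldL n a l l') = ev X l + C (a : ZMod n) * ev X l'
  | [], [], _ => by simp [foldL, ev]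
  | x :: l, y :: l', h => by
    have ih := ev_foldL (n := n) (a := a) (l := l) (l' := l') (by simpa using h)
    simp only [foldL, List.zipWith_cons_cons, ev] at ih ⊢
    rw [ih]
    have : ((((x + a * (y % n)) % n : ℕ) : (ZMod n)[X])) = x + C (a : ZMod n) * y := by
      rw [← C_eq_natCast, ← C_eq_natCast, ← C_eq_natCast, ← C_mul, ← C_add]
      congr 1
      simp
    rw [this]; ring

variable {P : Program} [HasPoly P]

theorem apw_run (w : Data) : ∀ {x y : ℕ}, x < 2 ^ w.sp →
    Sp P fApw (tup [w, encNat x, encNat y]) (encNat (x + 2 ^ w.sp * y)) (50 * (w.sp + 1)) := by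
  induction w with
  | nil =>
    intro x y hx
    obtain rfl : x = 0 := by simpa [Data.sp] using hx
    refine Sp.mk HasPoly.apw ?_
    simp only [apwBody, exec]
    exact ⟨by simp [Data.sp], by omega⟩
  | cons a w _ ih =>
    intro x y hx
    simp only [Data.sp] at hx ⊢
    refine Sp.mk HasPoly.apw ?_
    simp only [apwBody, exec]
    refine (ih (x := x / 2) (by omega)).bind fun t1 ht1 => ?_
    refine (bit_spec _ _).bind fun t2 ht2 => ⟨?_, by omega⟩
    have := bodd_toNat_add x
    congr 1
    rw [pow_succ']
    linarith

theorem pack_run (w : Data) {l : List ℕ} (h : Bd w.sp l) :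
    Sp P fPack (tup [w, E1 l]) (encNat (ev (2 ^ w.sp) l)) (80 * ((w.sp + 1) * (l.length + 1))) := by
  induction l with
  | nil =>
    refine Sp.mk HasPoly.pack ?_
    simp only [packBody, exec, encList]
    exact ⟨by simp [ev, encNat_zero], by simp; omega⟩
  | cons a l ih =>
    refine Sp.mk HasPoly.pack ?_
    simp only [packBody, exec, encList]
    refine (ih fun x hx => h x (by simp [hx])).bind fun t1 ht1 => ?_
    refine (apw_run w (h a (by simp))).bind fun t2 ht2 => ⟨by simp [ev], ?_⟩
    rw [List.length_cons, mul_add _ (l.length + 1)]; omega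

theorem low_run (w : Data) : ∀ {x : ℕ},
    Sp P fLow (tup [w, encNat x]) (encNat (x % 2 ^ w.sp)) (50 * (w.sp + 1)) := by
  induction w with
  | nil =>
    intro x
    refine Sp.mk HasPoly.low ?_
    simp only [lowBody, exec]
    exact ⟨by simp [Data.sp, Nat.mod_one, encNat_zero], by omega⟩
  | cons a w _ ih =>
    intro x
    simp only [Data.sp]
    refine Sp.mk HasPoly.low ?_
    simp only [lowBody, exec]
    refine (ih (x := x / 2)).bind fun t1 ht1 => ?_
    refine (bit_spec _ _).bind fun t2 ht2 => ⟨?_, by omega⟩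
    have := bodd_toNat_add x
    congr 1
    rw [pow_succ', Nat.mod_mul]
    have h3 : x.bodd.toNat ≤ 1 := Bool.toNat_le _
    omega

theorem unp_run (w k : Data) : ∀ {x : ℕ}, Sp P fUnp (tup [k, w, encNat x]) (E1 (unp w.sp k.sp x))
    (120 * ((w.sp + 1) * (k.sp + 1))) := by
  induction k with
  | nil =>
    intro x
    refine Sp.mk HasPoly.unp ?_
    simp only [unpBody, exec, Data.sp, unp]
    exact ⟨rfl, by omega⟩
  | cons a k _ ih =>
    intro x
    refine Sp.mk HasPoly.unp ?_
    simp only [unpBody, exec, Data.sp, unp]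
    refine (low_run w).bind fun t1 ht1 => ?_
    refine (drop_spec w (encNat x)).bind fun t2 ht2 => ?_
    rw [drop_encNat]
    refine ih.bind fun t3 ht3 => ⟨rfl, ?_⟩
    rw [mul_add _ (k.sp + 1)]; omega

theorem fold_run {n a M : ℕ} {u : Data} (hn : 0 < n) (ha : a < n) (hu : M + n * n < 2 ^ u.sp) :
    ∀ {l l' : List ℕ}, l.length = l'.length → (∀ x ∈ l, x < M) → (∀ x ∈ l', x < M) →
    Sp P fFold (tup [ctx n u, encNat a, E1 l, E1 l']) (E1 (foldL n a l l'))
      (9 * ((l.length + 1) * mulT (u.sp + 1))) := by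
  have hU := le_mulT (u.sp + 1)
  have hnn : n ≤ n * n := Nat.le_mul_of_pos_left _ hn
  have h2 : (2 : ℕ) ^ (u.sp + 1) = 2 * 2 ^ u.sp := pow_succ' 2 _
  intro l
  induction l with
  | nil =>
    intro l' hl _ _
    refine Sp.mk HasPoly.fold ?_
    simp only [foldBody, exec, encList, foldL]
    exact ⟨rfl, by simp; omega⟩
  | cons x l ih =>
    intro l' hl h h'
    cases l' with
    | nil => simp at hl
    | cons y l' =>
    have hx := h x (by simp)
    have hy := h' y (by simp)
    have hyn := Nat.mod_lt y hn
    have hay : a * (y % n) < n * n := Nat.mul_lt_mul'' ha hyn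
    refine Sp.mk HasPoly.fold ?_
    simp only [foldBody, exec, encList, foldL]
    refine (red_run hn (by omega) (x := y) (by omega)).bind fun t1 ht1 => ?_
    refine (mul_run (b := u.sp + 1) (x := a) (y := y % n) (by omega) (by omega)).bind
      fun t2 ht2 => ?_
    refine (add_spec u.sp false x (a * (y % n)) (by omega) (by omega)).bind fun t3 ht3 => ?_
    refine (red_run hn (by omega) (by simp; omega)).bind fun t4 ht4 => ?_
    refine (ih (by simpa using hl) (fun x hx => h x (by simp [hx]))
      (fun x hx => h' x (by simp [hx]))).bind fun t5 ht5 => ⟨?_, ?_⟩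
    · simp [encList, foldL]
    · have hT : 9 * ((l.length + 1 + 1) * mulT (u.sp + 1)) = 9 * ((l.length + 1) * mulT (u.sp + 1))
        + 9 * mulT (u.sp + 1) := by ring
      rw [List.length_cons]; omega

/-- A list of `D` residues modulo `n`. -/
def PL (n D : ℕ) (l : List ℕ) : Prop := l.length = D ∧ ∀ x ∈ l, x < n

/-- The unit of the running time of polynomial operations. -/
def polT (c D : ℕ) : ℕ := mulT (c * D) + (D + 1) * mulT (c + 1)

/-- One integer multiplication of about `u.sp * D` bits yields all coefficients of the product over
`ℕ`, because `2 ^ u.sp` exceeds each of them. As `X ^ D` is congruent to `a`, the upper half is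
multiplied by `a` and added to the lower half. -/
theorem pml_run {n a D : ℕ} {u : Data} (hn : 0 < n) (ha : a < n)
    (hu : (D + 1) * (n * n) + 1 < 2 ^ u.sp) {f g : List ℕ} (hf : PL n D f) (hg : PL n D g) :
    ∃ h, PL n D h ∧ (X ^ D - C (a : ZMod n) ∣ ev X h - ev X f * ev X g) ∧
      Sp P fPml (tup [tup [ctx n u, encNat a, un D], E1 f, E1 g]) (E1 h)
        (10 * polT u.sp D) := by
  have hnn : n ≤ n * n := Nat.le_mul_of_pos_left _ hn
  rw [add_mul, one_mul] at hu
  have bf : Bd u.sp f := fun x hx => (hf.2 x hx).trans (by omega)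
  have bg : Bd u.sp g := fun x hx => (hg.2 x hx).trans (by omega)
  have hlt := lconv_lt hf.2 hg.2 hn
  rw [hf.1] at hlt
  have hlen : (lconv f g).length = D + D := by rw [length_lconv, hf.1, hg.1]
  have bl : Bd u.sp (lconv f g) := fun x hx => (hlt x hx).trans (by omega)
  have lt : ((lconv f g).take D).length = D := by simp [hlen]
  have ld : ((lconv f g).drop D).length = D := by simp [hlen]
  refine ⟨foldL n a ((lconv f g).take D) ((lconv f g).drop D), ⟨?_, ?_⟩, ?_, ?_⟩
  · simp [foldL, hlen]
  · intro x hx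
    rw [foldL, ← List.map_uncurry_zip_eq_zipWith] at hx
    obtain ⟨y, -, rfl⟩ := List.mem_map.1 hx
    exact Nat.mod_lt _ hn
  · rw [ev_foldL (by rw [lt, ld]), ← ev_lconv]
    conv_rhs => rw [← List.take_append_drop D (lconv f g), ev_append, lt]
    rw [List.take_append_drop]
    exact ⟨-ev X ((lconv f g).drop D), by ring⟩
  · refine Sp.mk HasPoly.pml ?_
    have e1 := ev_two_pow_lt bf
    have e2 := ev_two_pow_lt bg
    rw [hf.1] at e1
    rw [hg.1] at e2
    simp only [pmlBody, ctx, exec]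
    refine (app_spec _ _).bind fun t1 ht1 => ?_
    refine (pack_run u bf).bind fun t2 ht2 => ?_
    refine (pack_run u bg).bind fun t3 ht3 => ?_
    refine (mul_run e1 e2).bind fun t4 ht4 => ?_
    refine (unp_run _ _).bind fun t5 ht5 => ?_
    rw [app_un, sp_un, ← ev_lconv, ← hlen, unp_ev bl]
    rw [app_un, sp_un] at ht5
    refine (take_spec (un D) (E1 (lconv f g))).bind fun t6 ht6 => ?_
    refine (drop_spec (un D) (E1 (lconv f g))).bind fun t7 ht7 => ?_
    rw [sp_un, take_encList _ _ _ (by omega), drop_encList]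
    refine (fold_run (M := D * (n * n) + 1) hn ha (by omega) (by rw [lt, ld])
      (fun x hx => hlt x (List.mem_of_mem_take hx))
      (fun x hx => hlt x (List.mem_of_mem_drop hx))).bind fun t8 ht8 => ⟨rfl, ?_⟩
    rw [hf.1] at ht2
    rw [hg.1] at ht3
    rw [lt] at ht8
    rw [sp_un] at ht1 ht6 ht7
    have hU := le_mulT (u.sp + 1)
    have f1 : (u.sp + 1) * (D + 1) * 50000000 ≤ (D + 1) * mulT (u.sp + 1) := by
      calc _ = (D + 1) * (50000000 * (u.sp + 1)) := by ring
        _ ≤ _ := Nat.mul_le_mul_left _ (by omega)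
    have f2 : (u.sp + 1) * (D + D + 1) ≤ 2 * ((u.sp + 1) * (D + 1)) := by
      calc _ ≤ (u.sp + 1) * (2 * (D + 1)) := Nat.mul_le_mul_left _ (by omega)
        _ = _ := by ring
    have f3 : D + 1 ≤ (u.sp + 1) * (D + 1) := Nat.le_mul_of_pos_left _ (by omega)
    rw [polT]
    omega

/-- As `nil` encodes `0`, a unary number is also a list of zero coefficients. The program takes the
zeros that pad `1`, `x` and `1 + m * x` from the unary number `2 ^ s`. -/
theorem un_eq_zeros (k : ℕ) : un k = encList encNat (List.replicate k 0) := by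
  induction k with
  | zero => rfl
  | succ k ih => simp [un, List.replicate_succ, encList, ih, encNat_zero]

theorem ppw_run {n a D : ℕ} {u : Data} (hn : 1 < n) (ha : a < n) (hD : 0 < D)
    (hu : (D + 1) * (n * n) + 1 < 2 ^ u.sp) {f : List ℕ} (hf : PL n D f) (b : ℕ) :
    ∀ {e : ℕ}, e < 2 ^ b → ∃ h, PL n D h ∧ (X ^ D - C (a : ZMod n) ∣ ev X h - ev X f ^ e) ∧
      Sp P fPpw (tup [tup [ctx n u, encNat a, un D], E1 f, encNat e]) (E1 h)
        (21 * ((b + 1) * polT u.sp D)) := by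
  have hV : 50000000 ≤ polT u.sp D := by
    have := le_mulT (u.sp * D)
    rw [polT]; omega
  obtain ⟨D, rfl⟩ : ∃ D', D = D' + 1 := ⟨D - 1, by omega⟩
  have one : PL n (D + 1) (1 :: List.replicate D 0) := by
    refine ⟨by simp, fun x hx => ?_⟩
    simp at hx
    omega
  have zero (b : ℕ) : Sp P fPpw (tup [tup [ctx n u, encNat a, un (D + 1)], E1 f, encNat 0])
      (E1 (1 :: List.replicate D 0)) (21 * ((b + 1) * polT u.sp (D + 1))) := by
    refine Sp.mk HasPoly.ppw ?_
    simp only [ppwBody, exec, if_true, un]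
    refine ⟨?_, ?_⟩
    · rw [un_eq_zeros, ← encNat_one]; rfl
    · have : polT u.sp (D + 1) ≤ (b + 1) * polT u.sp (D + 1) := Nat.le_mul_of_pos_left _ (by omega)
      omega
  induction b with
  | zero =>
    intro e he
    obtain rfl : e = 0 := by simpa using he
    exact ⟨_, one, by simp [ev, ev_replicate_zero], zero 0⟩
  | succ b ih =>
    intro e he
    by_cases h0 : e = 0
    · subst h0
      exact ⟨_, one, by simp [ev, ev_replicate_zero], zero (b + 1)⟩
    obtain ⟨h, h1, h2, h3⟩ := ih (e := e / 2) (by omega)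
    obtain ⟨g, g1, g2, g3⟩ := pml_run (P := P) (by omega) ha hu h1 h1
    obtain ⟨k, k1, k2, k3⟩ := pml_run (P := P) (by omega) ha hu g1 hf
    have hb := bodd_toNat_add e
    have hT : 21 * ((b + 1 + 1) * polT u.sp (D + 1)) = 21 * ((b + 1) * polT u.sp (D + 1)) +
      21 * polT u.sp (D + 1) := by ring
    have hg : X ^ (D + 1) - C (a : ZMod n) ∣ ev X g - ev X f ^ (2 * (e / 2)) := by
      have : ev X g - ev X f ^ (2 * (e / 2)) = (ev X g - ev X h * ev X h) +
          (ev X h - ev X f ^ (e / 2)) * (ev (X : (ZMod n)[X]) h + ev X f ^ (e / 2)) := by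
        rw [two_mul, pow_add]; ring
      rw [this]
      exact dvd_add g2 (h2.mul_right _)
    cases hbe : e.bodd with
    | false =>
      rw [hbe] at hb
      simp at hb
      refine ⟨g, g1, by rwa [hb] at hg, Sp.mk HasPoly.ppw ?_⟩
      simp only [ppwBody, exec, h0, hbe, if_false, Bool.false_eq_true]
      refine h3.bind fun t1 ht1 => ?_
      refine g3.bind fun t2 ht2 => ⟨rfl, by omega⟩
    | true =>
      rw [hbe] at hb
      simp at hb
      refine ⟨k, k1, ?_, Sp.mk HasPoly.ppw ?_⟩
      · have : ev X k - ev X f ^ e = (ev X k - ev X g * ev X f) +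
          (ev X g - ev X f ^ (2 * (e / 2))) * ev (X : (ZMod n)[X]) f := by
          conv_lhs => rw [← hb, pow_succ]
          ring
        rw [this]
        exact dvd_add k2 (hg.mul_right _)
      · simp only [ppwBody, exec, h0, hbe, if_false, if_true]
        refine h3.bind fun t1 ht1 => ?_
        refine g3.bind fun t2 ht2 => ?_
        refine k3.bind fun t3 ht3 => ⟨rfl, by omega⟩

theorem smap_run {n m : ℕ} {u : Data} (hn : 0 < n) (hu : n * n < 2 ^ u.sp) (hm : m < n) {l : List ℕ}
    (h : ∀ x ∈ l, x < n) :
    Sp P fSmap (tup [ctx n u, encNat m, E1 l]) (E1 (l.map fun x => m * x % n))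
      (6 * ((l.length + 1) * mulT (u.sp + 1))) := by
  have hU := le_mulT (u.sp + 1)
  induction l with
  | nil =>
    refine Sp.mk HasPoly.smap ?_
    simp only [smapBody, exec, encList]
    exact ⟨rfl, by simp; omega⟩
  | cons x l ih =>
    refine Sp.mk HasPoly.smap ?_
    simp only [smapBody, exec, encList]
    refine (mm_run hn hu hm (h x (by simp))).bind fun t1 ht1 => ?_
    refine (ih fun x hx => h x (by simp [hx])).bind fun t2 ht2 => ⟨by simp [encList], ?_⟩
    have hT : 6 * ((l.length + 1 + 1) * mulT (u.sp + 1)) = 6 * ((l.length + 1) * mulT (u.sp + 1))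
        + 6 * mulT (u.sp + 1) := by ring
    rw [List.length_cons]; omega

theorem inc_run {n x : ℕ} {u : Data} (hn : 0 < n) (hu : n * n < 2 ^ u.sp) {l : List ℕ} (hx : x < n) :
    Sp P fInc (tup [ctx n u, E1 (x :: l)]) (E1 ((x + 1) % n :: l)) (4 * mulT (u.sp + 1)) := by
  have hU := le_mulT (u.sp + 1)
  have hnn : n ≤ n * n := Nat.le_mul_of_pos_left _ hn
  refine Sp.mk HasPoly.inc ?_
  simp only [incBody, exec, encList]
  rw [← encNat_zero]
  refine (add_spec u.sp true x 0 (by omega) (by omega)).bind fun t1 ht1 => ?_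
  rw [Bool.toNat_true, add_zero]
  refine (red_run hn (by omega) (by omega)).bind fun t2 ht2 => ⟨rfl, by omega⟩

theorem ev_smap {n m : ℕ} (l : List ℕ) :
    ev (X : (ZMod n)[X]) (l.map fun x => m * x % n) = C (m : ZMod n) * ev X l := by
  induction l with
  | nil => simp [ev]
  | cons x l ih =>
    simp only [List.map_cons, ev, ih]
    have : (((m * x % n : ℕ) : (ZMod n)[X])) = C (m : ZMod n) * x := by
      rw [← C_eq_natCast, ← C_eq_natCast, ← C_mul]
      congr 1
      simp
    rw [this]; ring

end Lisp


namespace Lisp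

open AlgOne

/-! ### The program -/

abbrev fUn2 : ℕ := 56
abbrev fShl : ℕ := 57
abbrev fTz : ℕ := 58
abbrev fMem : ℕ := 59
abbrev fEmit : ℕ := 60
abbrev fPowers : ℕ := 61
abbrev fSmall : ℕ := 62
abbrev fPerfect : ℕ := 63
abbrev fOuter : ℕ := 64
abbrev fInner : ℕ := 65
abbrev fBound : ℕ := 66
abbrev fCoprime : ℕ := 67
abbrev fDiff : ℕ := 68
abbrev fCong : ℕ := 69
abbrev fFinal : ℕ := 70

/-- From binary to unary. -/
def un2Body : Expr := .cond (.var 0) (.bind (.call fUn2 (.tl (.var 0)))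
  (.cond (.hd (.var 1)) (.cons .nil (.call fApp (args [.var 0, .var 0])))
    (.call fApp (args [.var 0, .var 0])))) .nil

/-- `(u, x) ↦ 2 ^ u x` -/
def shlBody : Expr := .cond (arg 0)
  (.call fBit (args [.nil, .call fShl (args [.tl (arg 0), argR 1])])) (argR 1)

/-- The odd part and the exponent of `2` of a positive number. -/
def tzBody : Expr := .cond (.hd (arg 0)) (.var 0)
  (.call fTz (args [.tl (arg 0), .cons .nil (argR 1)]))

def memBody : Expr := .cond (argR 1) (.cond (.call fEq (args [arg 0, .hd (argR 1)])) tru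
  (.call fMem (args [arg 0, .tl (argR 1)]))) .nil

/-- Puts an entry in front of the record. -/
def emitBody : Expr := .cons (.hd (argR 1)) (.cons (arg 0) (.tl (argR 1)))

def isComposite : Expr := .cons .nil .nil

def isPrime : Expr := .cons tru .nil

/-- The second argument is the result of all that follows, so the record is built from its end and
each entry costs a constant number of steps. -/
def emit (r e : Expr) : Expr := .call fEmit (args [r, e])

/-- `(n, 2 ^ c / n, c)`; the context consists of `((n, 2 ^ c / n, c), a, 2 ^ s)`, `k`, `2 ^ (s - k)`,
where `c`, `2 ^ s` and `k` are unary. -/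
def cMod (e : Expr) : Expr := nth 0 (nth 0 e)
def cN (e : Expr) : Expr := nth 0 (nth 0 (nth 0 e))
def cA (e : Expr) : Expr := nth 1 (nth 0 e)
def cD (e : Expr) : Expr := rest 2 (nth 0 e)
def cK (e : Expr) : Expr := nth 1 e
def cTarget (e : Expr) : Expr := rest 2 e

/-- The argument is the input `(n, a, s)`. -/
def setupBody : Expr :=
  .bind (.call fUn2 (argR 2))
    (.bind (.call fApp (args [nth 0 (.var 1),
        .call fApp (args [nth 0 (.var 1), .cons .nil (.cons .nil (.var 0))])]))
      (.bind (.call fTz (args [.cons .nil (.tl (nth 0 (.var 2))), .nil]))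
        (.call fPowers (args [args [args [args [nth 0 (.var 3),
            .hd (.call fDivm (args [.call fShl (args [.var 1, .cons tru .nil]), nth 0 (.var 3)])),
            .var 1], nth 1 (.var 3), .call fPw (.var 2)], .tl (.var 0),
          .call fShl (args [.call fDrop (args [.tl (.var 0), .var 2]), .cons tru .nil])],
          .hd (.var 0)]))))

def powersBody : Expr :=
  .bind (.call fPwm (args [cMod (arg 0), cA (arg 0), argR 1]))
    (.bind (.call fSqs (args [cMod (nth 0 (.var 1)), .tl (cK (nth 0 (.var 1))), .var 0]))
      (emit (.cons (.var 1) (.cons (.var 0) .nil))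
        (.cond (.call fEq (args [.var 0, .cons .nil (.tl (cN (nth 0 (.var 2))))]))
          (.call fSmall (nth 0 (.var 2))) isComposite)))

def smallBody : Expr :=
  .cond (.call fDrop (args [.call fApp (args [cK (.var 0), cK (.var 0)]), cN (.var 0)]))
    (emit (.cons .nil .nil) (.call fPerfect (.var 0)))
    (emit (.cons (.cons tru .nil) .nil) isPrime)

def perfectBody : Expr :=
  .cond (.call fPp (args [cN (.var 0), .cons .nil (.cons .nil .nil), cN (.var 0)]))
    (emit (.cons (.cons tru .nil) .nil) isComposite)
    (emit (.cons .nil .nil) (.call fOuter (args [.var 0, .cons tru .nil, .cons tru .nil,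
      .cons (.cons tru .nil) .nil, .cons (.cons tru .nil) .nil])))

/-- The argument is `(C, |S|, m, S, S')`. -/
def outerBody : Expr :=
  emit (.cons (arg 1) .nil) (.cond (.call fLt (args [.nil, arg 1, cTarget (arg 0)]))
    (.call fInner (.var 0)) (.call fFinal (args [arg 0, arg 3])))

/-- The argument is `(C, |S|, m, S, S')`. -/
def innerBody : Expr :=
  .bind (.call fSqs (args [cMod (arg 0), cK (arg 0), .call fRed (args [cMod (arg 0), arg 2])]))
    (emit (.cons (nth 2 (.var 1)) (.cons (.var 0) .nil))
      (.cond (.call fMem (args [.var 0, rest 4 (.var 1)]))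
        (.call fInner (args [nth 0 (.var 1), nth 1 (.var 1),
          .call fAdd (args [tru, nth 2 (.var 1), .nil]), rest 3 (.var 1)]))
        (.call fBound (args [nth 0 (.var 1), nth 1 (.var 1), nth 2 (.var 1), .var 0,
          rest 3 (.var 1)]))))

/-- The argument is `(C, |S|, m, m ^ 2 ^ k % n, S, S')`. -/
def boundBody : Expr :=
  .bind (.call fBit (args [tru, .call fShl (args [.tl (cK (arg 0)), arg 1])]))
    (emit (.cons (.var 0) .nil)
      (.cond (.call fLt (args [.nil, .var 0, nth 2 (.var 1)])) isComposite
        (.call fCoprime (.var 1))))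

/-- The argument is `(C, |S|, m, m ^ 2 ^ k % n, S, S')`. -/
def coprimeBody : Expr :=
  .bind (.call fGcd (args [arg 2, cN (arg 0)]))
    (emit (.cons (.var 0) .nil) (.cond (.tl (.var 0)) isComposite
      (.call fDiff (args [rest 5 (.var 1), .var 1]))))

/-- The argument is `(todo, C, |S|, m, m ^ 2 ^ k % n, S, S')`. -/
def diffBody : Expr := .cond (arg 0)
  (.bind (.call fGcd (args [.call fAbs (args [arg 4, .hd (arg 0)]), cN (arg 1)]))
    (emit (.cons (.hd (nth 0 (.var 1))) (.cons (.var 0) .nil))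
      (.cond (.tl (.var 0)) isComposite
        (.call fDiff (args [.tl (nth 0 (.var 1)), rest 1 (.var 1)])))))
  (emit .nil (.call fOuter (args [arg 1, .call fAdd (args [tru, arg 2, .nil]), arg 3,
    .call fApp (args [arg 5, .cons (arg 3) .nil]),
    .call fApp (args [argR 6, .cons (arg 4) .nil])])))

/-- `(C, m) ↦` the remainders of `(1 + m x) ^ n` and `1 + m x ^ n` -/
def congBody : Expr :=
  .bind (.call fRed (args [cMod (arg 0), argR 1]))
    (.cons
      (.call fPpw (args [nth 0 (nth 0 (.var 1)),
        .cons (.cons tru .nil) (.cons (.var 0) (.tl (.tl (cD (nth 0 (.var 1)))))),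
        cN (nth 0 (.var 1))]))
      (.call fInc (args [cMod (nth 0 (.var 1)), .call fSmap (args [cMod (nth 0 (.var 1)), .var 0,
        .call fPpw (args [nth 0 (nth 0 (.var 1)),
          .cons .nil (.cons (.cons tru .nil) (.tl (.tl (cD (nth 0 (.var 1)))))),
          cN (nth 0 (.var 1))])])])))

/-- The argument is `(C, todo)`. -/
def finalBody : Expr := .cond (argR 1)
  (.bind (.call fCong (args [arg 0, .hd (argR 1)]))
    (emit (.cons (.hd (rest 1 (.var 1))) (.call fApp (.var 0)))
      (.cond (.call fEq (.var 0)) (.call fFinal (args [nth 0 (.var 1), .tl (rest 1 (.var 1))]))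
        isComposite)))
  (emit .nil isPrime)

class HasMain (P : Program) : Prop extends HasPoly P where
  setup : P[0]? = some setupBody
  un2 : P[fUn2]? = some un2Body
  shl : P[fShl]? = some shlBody
  tz : P[fTz]? = some tzBody
  mem : P[fMem]? = some memBody
  emit : P[fEmit]? = some emitBody
  powers : P[fPowers]? = some powersBody
  small : P[fSmall]? = some smallBody
  perfect : P[fPerfect]? = some perfectBody
  outer : P[fOuter]? = some outerBody
  inner : P[fInner]? = some innerBody
  bound : P[fBound]? = some boundBody
  coprime : P[fCoprime]? = some coprimeBody
  diff : P[fDiff]? = some diffBody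
  cong : P[fCong]? = some congBody
  final : P[fFinal]? = some finalBody

variable {P : Program} [HasMain P]

/-- The time is linear in the value of `x` and not in its length. The only number converted is `s`,
which is of order `log log n`. -/
theorem un2_run (x : ℕ) : Sp P fUn2 (encNat x) (un x) (200 * (x + 1)) := by
  induction x using Nat.strong_induction_on with
  | _ x ih =>
    refine Sp.mk HasMain.un2 ?_
    simp only [un2Body, exec]
    have hx := bodd_toNat_add x
    split_ifs with h0 hb
    · subst h0; exact ⟨rfl, by omega⟩
    · refine (ih (x / 2) (by omega)).bind fun t1 ht1 => ?_
      refine (app_spec (un (x / 2)) (un (x / 2))).bind fun t2 ht2 => ?_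
      rw [hb] at hx
      simp only [Bool.toNat_true] at hx
      rw [sp_un] at ht2
      refine ⟨?_, by omega⟩
      rw [app_un]
      conv_rhs => rw [← hx, two_mul]
      rfl
    · refine (ih (x / 2) (by omega)).bind fun t1 ht1 => ?_
      refine (app_spec (un (x / 2)) (un (x / 2))).bind fun t2 ht2 => ?_
      rw [show x.bodd = false by simpa using hb] at hx
      simp only [Bool.toNat_false, add_zero] at hx
      rw [sp_un] at ht2
      refine ⟨?_, by omega⟩
      rw [app_un]
      conv_rhs => rw [← hx, two_mul]

theorem shl_run (u : Data) (x : ℕ) :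
    Sp P fShl (tup [u, encNat x]) (encNat (x * 2 ^ u.sp)) (40 * (u.sp + 1)) := by
  induction u with
  | nil =>
    refine Sp.mk HasMain.shl ?_
    simp only [shlBody, exec, Data.sp]
    exact ⟨by simp, by omega⟩
  | cons a u _ ih =>
    refine Sp.mk HasMain.shl ?_
    simp only [shlBody, exec, Data.sp]
    refine ih.bind fun t1 ht1 => ?_
    refine (bit_spec false _).bind fun t2 ht2 => ⟨?_, by omega⟩
    rw [pow_succ]; congr 1; simp only [Bool.toNat_false]; ring

theorem tz_run (b : ℕ) : ∀ {x j : ℕ}, 0 < x → x < 2 ^ b →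
    Sp P fTz (tup [encNat x, un j])
      (.cons (encNat (x / 2 ^ padicValNat 2 x)) (un (j + padicValNat 2 x))) (40 * (b + 1)) := by
  induction b with
  | zero => intro x j h0 hx; simp at hx; omega
  | succ b ih =>
    intro x j h0 hx
    refine Sp.mk HasMain.tz ?_
    simp only [tzBody, exec]
    split_ifs with hb
    · have h2 : ¬ 2 ∣ x := by
        have := bodd_toNat_add x
        rw [hb] at this
        simp only [Bool.toNat_true] at this
        omega
      rw [padicValNat.eq_zero_of_not_dvd h2]
      exact ⟨by simp, by omega⟩
    · have hx2 : 2 * (x / 2) = x := by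
        have := bodd_toNat_add x
        rw [show x.bodd = false by simpa using hb] at this
        simpa using this
      refine (ih (x := x / 2) (j := j + 1) (by omega) (by omega)).bind fun t1 ht1 =>
        ⟨?_, by omega⟩
      have : padicValNat 2 x = padicValNat 2 (x / 2) + 1 := by
        conv_lhs => rw [← hx2]
        rw [padicValNat.mul (by norm_num) (by omega)]
        simp [add_comm]
      rw [this, pow_succ', ← Nat.div_div_eq_div_mul, add_assoc, add_comm 1]

theorem mem_run (x : ℕ) (l : List ℕ) : Sp P fMem (tup [encNat x, E1 l])
    (encBool (decide (x ∈ l))) ((l.length + 1) * (30 * (encNat x).nodes + 40)) := by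
  classical
  induction l with
  | nil =>
    refine Sp.mk HasMain.mem ?_
    simp only [memBody, exec, encList]
    exact ⟨by simp [encBool], by simp⟩
  | cons y l ih =>
    refine Sp.mk HasMain.mem ?_
    simp only [memBody, exec, encList]
    refine (eq_spec (encNat x) (encNat y)).bind fun t1 ht1 => ?_
    simp only [exec, decide_eq_true_eq, encNat_injective.eq_iff]
    have hT : ((y :: l).length + 1) * (30 * (encNat x).nodes + 40) =
      (l.length + 1) * (30 * (encNat x).nodes + 40) + (30 * (encNat x).nodes + 40) := by
      simp; ring
    split_ifs with h
    · exact ⟨by simp [h, encBool], by omega⟩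
    · refine ih.bind fun t2 ht2 => ⟨by simp [h], by omega⟩

theorem emit_run (r : List ℕ) (b : Bool) (w : List (List ℕ)) :
    Sp P fEmit (tup [E1 r, output b w]) (output b (r :: w)) 20 := by
  refine Sp.mk HasMain.emit ?_
  simp only [emitBody, exec, output]
  exact ⟨rfl, by omega⟩

end Lisp


namespace AlgOne

open Polynomial Lisp

/-! ### The remainders as lists -/

theorem coeff_ev {R : Type*} [CommRing R] (l : List ℕ) (i : ℕ) :
    (ev X l : R[X]).coeff i = (l.getD i 0 : ℕ) := by
  induction l generalizing i with
  | nil => simp [ev]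
  | cons a l ih =>
    cases i with
    | zero => simp [ev]
    | succ i => simp [ev, ih]

/-- The modulus is monic of degree `2 ^ s`, so remainders are unique, and any list of `2 ^ s`
reduced residues in the right class is the list of coefficients. This identifies what the program
computes with `remainder`. -/
theorem remainder_eq {n a : ℕ} (hn : 1 < n) {h : List ℕ} (hh : PL n (2 ^ s n) h) {F : (ZMod n)[X]}
    (hF : modulus n a ∣ ev X h - F) : remainder n a F = h := by
  have : Fact (1 < n) := ⟨hn⟩
  have hD : 2 ^ s n ≠ 0 := by positivity
  have hmon : (modulus n a).Monic := monic_X_pow_sub_C _ hD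
  have hdeg : (modulus n a).degree = (2 ^ s n : ℕ) := degree_X_pow_sub_C (by positivity) _
  have h1 : F %ₘ modulus n a = ev X h := by
    rw [← modByMonic_eq_of_dvd_sub hmon hF, (modByMonic_eq_self_iff hmon).2]
    rw [hdeg, degree_lt_iff_coeff_zero]
    intro i hi
    rw [coeff_ev, List.getD_eq_default _ _ (by rw [hh.1]; exact hi), Nat.cast_zero]
  refine List.ext_getElem (by simp [remainder, hh.1]) fun i h2 h3 => ?_
  simp only [remainder, h1, List.getElem_map, List.getElem_range, coeff_ev]
  rw [List.getD_eq_getElem _ _ h3, ZMod.val_natCast, Nat.mod_eq_of_lt (hh.2 _ (List.getElem_mem h3))]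

theorem modulus_dvd_sub_iff {n a : ℕ} (hn : 1 < n) {f g : List ℕ} (hf : PL n (2 ^ s n) f)
    (hg : PL n (2 ^ s n) g) {F G : (ZMod n)[X]} (hF : modulus n a ∣ ev X f - F)
    (hG : modulus n a ∣ ev X g - G) : modulus n a ∣ F - G ↔ f = g := by
  constructor
  · intro h
    have h1 : modulus n a ∣ ev X g - F := by
      have := dvd_sub hG h
      rwa [sub_sub_sub_cancel_right] at this
    rw [← remainder_eq hn hf hF, remainder_eq hn hg h1]
  · rintro rfl
    have := dvd_sub hG hF
    rwa [sub_sub_sub_cancel_left] at this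

/-! ### The search for new residues -/

/-- Let `p` be a prime divisor of `n`. The numbers from `1` to `M - 1` are distinct modulo `p`, and
each is a root of some `X ^ 2 ^ k - x` with `x ∈ S'`. Over the field `ℤ / p` these polynomials have
at most `2 ^ k` roots each. -/
theorem le_of_forall_mem {n k M : ℕ} (hn : 1 < n) {S' : List ℕ} (hc : ∀ x ∈ S', Nat.Coprime x n)
    (hM : ∀ m, 1 ≤ m → m < M → m ^ 2 ^ k % n ∈ S') : M ≤ S'.length * 2 ^ k + 1 := by
  classical
  obtain ⟨p, hp, hpn⟩ := Nat.exists_prime_and_dvd hn.ne'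
  have : Fact p.Prime := ⟨hp⟩
  -- Distinctness modulo `p`: if `p < M`, the residue of `p ^ 2 ^ k` would lie in `S'` although `p`
  -- divides it.
  have hMp : M ≤ p := by
    by_contra! h
    have h1 := hc _ (hM p hp.one_le h)
    have h2 : p ∣ p ^ 2 ^ k % n := (Nat.dvd_mod_iff hpn).2 (dvd_pow_self p (by positivity))
    have h3 := Nat.dvd_gcd h2 hpn
    rw [h1] at h3
    exact hp.one_lt.ne' (Nat.dvd_one.1 h3)
  have h1 : (Finset.Ico 1 M).image (fun m : ℕ => (m : ZMod p)) ⊆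
      S'.toFinset.biUnion fun x => (nthRoots (2 ^ k) (x : ZMod p)).toFinset := by
    intro y hy
    obtain ⟨m, hm, rfl⟩ := Finset.mem_image.1 hy
    rw [Finset.mem_Ico] at hm
    refine Finset.mem_biUnion.2 ⟨_, List.mem_toFinset.2 (hM m hm.1 hm.2), ?_⟩
    rw [Multiset.mem_toFinset, mem_nthRoots (by positivity)]
    have h2 : m ^ 2 ^ k % n ≡ m ^ 2 ^ k [MOD p] := (Nat.mod_modEq _ _).of_dvd hpn
    have h3 := (ZMod.natCast_eq_natCast_iff _ _ _).2 h2
    rw [h3]; push_cast; rfl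
  have h2 := Finset.card_le_card h1
  rw [Finset.card_image_of_injOn, Nat.card_Ico] at h2
  · have h3 : (S'.toFinset.biUnion fun x => (nthRoots (2 ^ k) (x : ZMod p)).toFinset).card ≤
        S'.toFinset.card * 2 ^ k := Finset.card_biUnion_le_card_mul _ _ _ fun x _ =>
      (Multiset.toFinset_card_le _).trans (card_nthRoots _ _)
    have h4 := Nat.mul_le_mul_right (2 ^ k) (List.toFinset_card_le S')
    omega
  · intro x hx y hy hxy
    rw [Finset.coe_Ico, Set.mem_Ico] at hx hy
    have h3 := (ZMod.natCast_eq_natCast_iff _ _ _).1 hxy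
    exact Nat.ModEq.eq_of_lt_of_lt h3 (by omega) (by omega)

/-! ### The parameters -/

theorem five_le {n a : ℕ} (h : (n, a) ∈ Valid) : 5 ≤ n := by
  obtain ⟨h1, h2, h3⟩ := h
  simp only at h1 h2 h3
  have : n ≠ 1 := by
    rintro rfl
    simp at h3
  omega

theorem two_lt_logb {n a : ℕ} (h : (n, a) ∈ Valid) : 2 < Real.logb 2 n := by
  have := five_le h
  rw [Real.lt_logb_iff_rpow_lt (by norm_num) (by positivity)]
  norm_num
  exact_mod_cast (by omega : 4 < n)

/-- Together with `two_pow_s_le` this determines `2 ^ s` up to a factor `2`. The lower bound yields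
the saving in the case `s ≤ k` and covers the perfect power test. -/
theorem logb_sq_le {n a : ℕ} (h : (n, a) ∈ Valid) : Real.logb 2 n ^ 2 ≤ 2 ^ s n := by
  have h1 := two_lt_logb h
  have h2 : 2 * Real.logb 2 (Real.logb 2 n) ≤ s n := Nat.le_ceil _
  have h3 : Real.logb 2 (Real.logb 2 n ^ 2) ≤ s n := by
    rw [Real.logb_pow]; exact_mod_cast h2
  rw [Real.logb_le_iff_le_rpow (by norm_num) (by positivity), Real.rpow_natCast] at h3
  exact h3

theorem s_le {n a : ℕ} (h : (n, a) ∈ Valid) : (s n : ℝ) ≤ 2 * Real.logb 2 (Real.logb 2 n) + 1 := by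
  have h1 := two_lt_logb h
  exact (Nat.ceil_lt_add_one (mul_nonneg (by norm_num)
    (Real.logb_nonneg (by norm_num) (by linarith)))).le

theorem two_pow_s_le {n a : ℕ} (h : (n, a) ∈ Valid) : (2 : ℝ) ^ s n ≤ 2 * Real.logb 2 n ^ 2 := by
  have h1 := two_lt_logb h
  have h2 := s_le h
  have h3 : (s n : ℝ) ≤ Real.logb 2 (2 * Real.logb 2 n ^ 2) := by
    rw [Real.logb_mul (by norm_num) (by positivity), Real.logb_pow, Real.logb_self_eq_one (by norm_num)]
    push_cast; linarith
  rw [Real.le_logb_iff_rpow_le (by norm_num) (by positivity), Real.rpow_natCast] at h3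
  exact h3

theorem one_le_s {n a : ℕ} (h : (n, a) ∈ Valid) : 1 ≤ s n := by
  have h1 := two_lt_logb h
  have h2 := logb_sq_le h
  by_contra! h3
  rw [show s n = 0 by omega] at h2
  nlinarith

theorem one_le_k {n a : ℕ} (h : (n, a) ∈ Valid) : 1 ≤ k n := by
  have h5 := five_le h
  obtain ⟨h1, -, -⟩ := h
  simp only at h1
  exact one_le_padicValNat_of_dvd (by omega) (by omega)

theorem two_pow_k_dvd (n : ℕ) : 2 ^ k n ∣ n - 1 := pow_padicValNat_dvd

theorem k_le_size {n a : ℕ} (h : (n, a) ∈ Valid) : k n ≤ n.size := by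
  have h5 := five_le h
  have h1 := Nat.le_of_dvd (by omega) (two_pow_k_dvd n)
  exact ((Nat.pow_lt_pow_iff_right (by norm_num)).1
    (h1.trans_lt ((Nat.sub_lt (by omega) one_pos).trans (Nat.lt_size_self n)))).le

theorem size_le_logb {n a : ℕ} (h : (n, a) ∈ Valid) : (n.size : ℝ) ≤ Real.logb 2 n + 1 := by
  have h5 := five_le h
  have h1 : 2 ^ (n.size - 1) ≤ n := by
    by_contra! h2
    have := Nat.size_le.2 h2
    have : 0 < n.size := Nat.size_pos.2 (by omega)
    omega
  have h2 : ((n.size - 1 : ℕ) : ℝ) ≤ Real.logb 2 n := by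
    rw [Real.le_logb_iff_rpow_le (by norm_num) (by positivity), Real.rpow_natCast]
    exact_mod_cast h1
  have h3 : 0 < n.size := Nat.size_pos.2 (by omega)
  rw [Nat.cast_pred h3] at h2
  linarith

theorem size_sq_le {n a : ℕ} (h : (n, a) ∈ Valid) : n.size ^ 2 ≤ 4 * 2 ^ s n := by
  have h1 := two_lt_logb h
  have h2 := size_le_logb h
  have h3 := logb_sq_le h
  have : (n.size : ℝ) ^ 2 ≤ 4 * 2 ^ s n := by
    calc (n.size : ℝ) ^ 2 ≤ (2 * Real.logb 2 n) ^ 2 := by gcongr; linarith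
      _ ≤ _ := by rw [mul_pow]; linarith
  exact_mod_cast this

/-- Removes the logarithm: the program tests whether dropping `2 * k` bits of `n` leaves nothing. -/
theorem logb_lt_iff {n a : ℕ} (h : (n, a) ∈ Valid) :
    (k n : ℝ) > 1 / 2 * Real.logb 2 n ↔ n < 2 ^ (k n + k n) := by
  have h5 := five_le h
  rw [show (k n : ℝ) > 1 / 2 * Real.logb 2 n ↔ Real.logb 2 n < ((k n + k n : ℕ) : ℝ) by
    push_cast; constructor <;> intro h <;> linarith]
  rw [Real.logb_lt_iff_lt_rpow (by norm_num) (by positivity), Real.rpow_natCast]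
  norm_cast

/-- Since `n > 1` the base is at least `2`, so the exponent is less than the bit length. -/
theorem perfect_iff {n : ℕ} (h5 : 1 < n) : (∃ d e : ℕ, 0 < d ∧ 1 < e ∧ n = d ^ e) ↔
    ∃ e, 2 ≤ e ∧ e < 2 + n.size ∧ ∃ d, n = d ^ e := by
  constructor
  · rintro ⟨d, e, hd, he, h⟩
    refine ⟨e, he, ?_, d, h⟩
    have hd2 : 2 ≤ d := by
      by_contra! h2
      obtain rfl : d = 1 := by omega
      simp at h
      omega
    have h1 : 2 ^ e < 2 ^ n.size := ((Nat.pow_le_pow_left hd2 e).trans h.ge).trans_lt (Nat.lt_size_self n)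
    have := (Nat.pow_lt_pow_iff_right (by norm_num)).1 h1
    omega
  · rintro ⟨e, he, -, d, h⟩
    refine ⟨d, e, Nat.pos_of_ne_zero ?_, he, h⟩
    rintro rfl
    rw [zero_pow (by omega)] at h
    omega

end AlgOne


namespace AlgOne

open Polynomial Lisp

/-! ### The polynomial congruences -/

/-- The data at the disposal of all steps. -/
noncomputable def cx (n a : ℕ) (u : Data) : Data :=
  tup [tup [ctx n u, encNat a, un (2 ^ s n)], un (k n), encNat (2 ^ (s n - k n))]

variable {P : Program} [HasMain P] {n a : ℕ} {u : Data}

/-- The width is chosen for the largest numbers that occur: a coefficient of a product is at most `2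
^ s * n ^ 2`, and the reduction modulo `x ^ 2 ^ s - a` adds less than `n ^ 2`. -/
theorem width_bound (hV : (n, a) ∈ Valid) (hu : u.sp = 2 * n.size + s n + 2) :
    (2 ^ s n + 1) * (n * n) + 1 < 2 ^ u.sp := by
  have h5 := five_le hV
  have h1 := Nat.lt_size_self n
  have h2 : n * n < 2 ^ (2 * n.size) := by
    rw [two_mul, pow_add]; exact Nat.mul_lt_mul'' h1 h1
  have h3 : 2 ^ u.sp = 4 * (2 ^ s n * 2 ^ (2 * n.size)) := by rw [hu]; ring
  have h4 : 2 ^ s n * (n * n) < 2 ^ s n * 2 ^ (2 * n.size) :=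
    Nat.mul_lt_mul_of_pos_left h2 (by positivity)
  have h6 : n * n ≤ 2 ^ s n * (n * n) := Nat.le_mul_of_pos_left _ (by positivity)
  have h7 : (2 ^ s n + 1) * (n * n) = 2 ^ s n * (n * n) + n * n := by ring
  have h8 : 1 ≤ n * n := Nat.mul_pos (by omega) (by omega)
  omega

theorem sq_lt_width (hV : (n, a) ∈ Valid) (hu : u.sp = 2 * n.size + s n + 2) :
    n * n < 2 ^ u.sp := by
  have := width_bound hV hu
  have : n * n ≤ (2 ^ s n + 1) * (n * n) := Nat.le_mul_of_pos_left _ (by positivity)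
  omega

theorem lt_width (hV : (n, a) ∈ Valid) (hu : u.sp = 2 * n.size + s n + 2) : n < 2 ^ u.sp :=
  (Nat.le_mul_of_pos_left _ (by have := five_le hV; omega)).trans_lt (sq_lt_width hV hu)

theorem two_pow_s_lt_width (hu : u.sp = 2 * n.size + s n + 2) : 2 * 2 ^ s n < 2 ^ u.sp := by
  rw [← pow_succ']
  exact Nat.pow_lt_pow_right (by norm_num) (by omega)

theorem natCast_mod (m : ℕ) : ((m % n : ℕ) : (ZMod n)[X]) = C (m : ZMod n) := by
  rw [← C_eq_natCast]; congr 1; simp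

theorem mulT_le_polT (c D : ℕ) : (D + 1) * mulT (c + 1) ≤ polT c D := Nat.le_add_left _ _

theorem cong_run (hV : (n, a) ∈ Valid) (hu : u.sp = 2 * n.size + s n + 2) {m : ℕ}
    (hm : m < 2 ^ u.sp) : ∃ f g, PL n (2 ^ s n) f ∧ PL n (2 ^ s n) g ∧
      modulus n a ∣ ev X f - lhs n m ∧ modulus n a ∣ ev X g - rhs n m ∧
      Sp P fCong (tup [cx n a u, encNat m]) (.cons (E1 f) (E1 g))
        (60 * ((n.size + 1) * polT u.sp (2 ^ s n))) := by
  have h5 := five_le hV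
  have hs := one_le_s hV
  have hnn := sq_lt_width hV hu
  have hw := width_bound hV hu
  -- `s ≥ 1` guarantees that `1 + m * x` and `x` are already reduced, with `d` zeros as padding.
  obtain ⟨d, hd⟩ : ∃ d, 2 ^ s n = d + 2 := by
    have : 2 ^ 1 ≤ 2 ^ s n := Nat.pow_le_pow_right (by norm_num) hs
    exact ⟨2 ^ s n - 2, by omega⟩
  have hmn : m % n < n := Nat.mod_lt _ (by omega)
  have hf0 : PL n (2 ^ s n) (1 :: m % n :: List.replicate d 0) := by
    refine ⟨by simp [hd], fun x hx => ?_⟩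
    simp at hx
    omega
  have hf1 : PL n (2 ^ s n) (0 :: 1 :: List.replicate d 0) := by
    refine ⟨by simp [hd], fun x hx => ?_⟩
    simp at hx
    omega
  obtain ⟨f, hf, hfd, hfr⟩ := ppw_run (P := P) (by omega) hV.2.1 (by positivity) hw hf0 n.size
    (Nat.lt_size_self n)
  obtain ⟨g, hg, hgd, hgr⟩ := ppw_run (P := P) (by omega) hV.2.1 (by positivity) hw hf1 n.size
    (Nat.lt_size_self n)
  obtain ⟨x, g, rfl⟩ : ∃ x g', g = x :: g' := by
    cases g with
    | nil => have := hg.1; simp at this; omega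
    | cons x g => exact ⟨x, g, rfl⟩
  have hh : PL n (2 ^ s n) ((m % n * x % n + 1) % n :: g.map fun x => m % n * x % n) := by
    refine ⟨by simpa using hg.1, fun y hy => ?_⟩
    rcases List.mem_cons.1 hy with rfl | hy
    · exact Nat.mod_lt _ (by omega)
    · obtain ⟨z, -, rfl⟩ := List.mem_map.1 hy
      exact Nat.mod_lt _ (by omega)
  refine ⟨f, _, hf, hh, ?_, ?_, Sp.mk HasMain.cong ?_⟩
  · have : ev (X : (ZMod n)[X]) (1 :: m % n :: List.replicate d 0) = 1 + C (m : ZMod n) * X := by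
      simp only [ev, ev_replicate_zero, natCast_mod]
      push_cast; ring
    rw [this] at hfd
    exact hfd
  · have h1 : ev (X : (ZMod n)[X]) (0 :: 1 :: List.replicate d 0) = X := by
      simp [ev, ev_replicate_zero]
    rw [h1] at hgd
    have h2 : ev (X : (ZMod n)[X]) ((m % n * x % n + 1) % n :: g.map fun x => m % n * x % n) =
        1 + C (m : ZMod n) * ev X (x :: g) := by
      have h3 := ev_smap (n := n) (m := m % n) (x :: g)
      rw [List.map_cons, ev] at h3
      have h4 : (((m % n * x % n + 1) % n : ℕ) : (ZMod n)[X]) = 1 + ((m % n * x % n : ℕ) : (ZMod n)[X]) := by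
        rw [natCast_mod, ← C_eq_natCast (m % n * x % n), Nat.cast_add, C_add, Nat.cast_one, C_1, add_comm]
      rw [ev, h4, add_assoc, h3, ZMod.natCast_mod]
    rw [h2, rhs, add_sub_add_left_eq_sub, ← mul_sub]
    exact dvd_mul_of_dvd_right hgd _
  · simp only [congBody, cx, ctx, cMod, cN, cD, exec, hd, un]
    simp only [ctx, exec, hd, un, encList] at hfr hgr
    rw [un_eq_zeros, ← encNat_zero] at hfr hgr
    refine (red_run (by omega) (lt_width hV hu) hm).bind fun t1 ht1 => ?_
    rw [un_eq_zeros, ← encNat_one, ← encNat_zero]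
    refine hfr.bind fun t2 ht2 => ?_
    refine hgr.bind fun t3 ht3 => ?_
    refine (smap_run (l := x :: g) (by omega) hnn hmn hg.2).bind fun t4 ht4 => ?_
    refine (inc_run (by omega) hnn (Nat.mod_lt _ (by omega))).bind fun t5 ht5 => ⟨rfl, ?_⟩
    rw [hg.1, hd] at ht4
    have h6 := mulT_le_polT u.sp (d + 2)
    have h7 : mulT (u.sp + 1) ≤ (d + 2 + 1) * mulT (u.sp + 1) := Nat.le_mul_of_pos_left _ (by omega)
    have h8 : polT u.sp (d + 2) ≤ (n.size + 1) * polT u.sp (d + 2) :=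
      Nat.le_mul_of_pos_left _ (by omega)
    have h9 := le_mulT (u.sp + 1)
    omega

theorem nodes_E1 {b : ℕ} {l : List ℕ} (h : Bd b l) :
    (E1 l).nodes ≤ l.length * (4 * b + 2) + 1 := by
  induction l with
  | nil => simp [encList, Data.nodes]
  | cons x l ih =>
    have h1 := nodes_encNat_lt (h x (by simp))
    have h2 := ih fun y hy => h y (by simp [hy])
    have h3 : (l.length + 1) * (4 * b + 2) = l.length * (4 * b + 2) + (4 * b + 2) := by ring
    rw [List.length_cons]
    change (encNat x).nodes + (E1 l).nodes + 1 ≤ _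
    omega

theorem final_run (hV : (n, a) ∈ Valid) (hu : u.sp = 2 * n.size + s n + 2) {todo : List ℕ}
    (hm : ∀ m ∈ todo, m < 2 ^ u.sp) : ∃ w b, Runs n a (.step4 todo) w b ∧
      Sp P fFinal (tup [cx n a u, E1 todo]) (output b w)
        ((todo.length + 1) * (70 * ((n.size + 1) * polT u.sp (2 ^ s n)))) := by
  classical
  have h5 := five_le hV
  have h6 := mulT_le_polT u.sp (2 ^ s n)
  have h7 : mulT (u.sp + 1) ≤ (2 ^ s n + 1) * mulT (u.sp + 1) :=
    Nat.le_mul_of_pos_left _ (Nat.succ_pos _)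
  have h8 : polT u.sp (2 ^ s n) ≤ (n.size + 1) * polT u.sp (2 ^ s n) :=
    Nat.le_mul_of_pos_left _ (by omega)
  have h9 := le_mulT (u.sp + 1)
  induction todo with
  | nil =>
    refine ⟨_, _, .step (by rw [step]) (.done true), Sp.mk HasMain.final ?_⟩
    simp only [finalBody, exec, encList, emit, isPrime]
    refine (emit_run [] true []).bind fun t1 ht1 => ⟨rfl, ?_⟩
    simp only [List.length_nil, zero_add, one_mul]
    omega
  | cons m todo ih =>
    obtain ⟨w, b, hr, hsp⟩ := ih fun x hx => hm x (by simp [hx])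
    obtain ⟨f, g, hf, hg, hfd, hgd, hc⟩ := cong_run (P := P) hV hu (hm m (by simp))
    have hiff := modulus_dvd_sub_iff (by omega) hf hg hfd hgd
    have hT : ((m :: todo).length + 1) * (70 * ((n.size + 1) * polT u.sp (2 ^ s n))) =
      (todo.length + 1) * (70 * ((n.size + 1) * polT u.sp (2 ^ s n))) +
        70 * ((n.size + 1) * polT u.sp (2 ^ s n)) := by
      rw [List.length_cons]; ring
    have hn2 : 30 * (E1 f).nodes ≤ (2 ^ s n + 1) * mulT (u.sp + 1) := by
      have h1 := nodes_E1 (b := n.size) fun x hx => (hf.2 x hx).trans (Nat.lt_size_self n)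
      rw [hf.1] at h1
      have h2 : 2 ^ s n * (30 * (4 * n.size + 2)) ≤ 2 ^ s n * mulT (u.sp + 1) :=
        Nat.mul_le_mul_left _ (by omega)
      have h3 : 2 ^ s n * (30 * (4 * n.size + 2)) = 30 * (2 ^ s n * (4 * n.size + 2)) := by ring
      have h4 : (2 ^ s n + 1) * mulT (u.sp + 1) = 2 ^ s n * mulT (u.sp + 1) + mulT (u.sp + 1) := by
        ring
      omega
    have hf1 : 20 * (f.length + 1) ≤ (2 ^ s n + 1) * mulT (u.sp + 1) := by
      rw [hf.1, mul_comm]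
      exact Nat.mul_le_mul_left _ (by omega)
    by_cases h : f = g
    · refine ⟨(m :: (f ++ g)) :: w, b, .step ?_ hr, Sp.mk HasMain.final ?_⟩
      · rw [step, if_pos (hiff.2 h), remainder_eq (by omega) hf hfd, remainder_eq (by omega) hg hgd]
      simp only [finalBody, exec, encList, emit]
      refine hc.bind fun t1 ht1 => ?_
      refine (app_spec (E1 f) (E1 g)).bind fun t2 ht2 => ?_
      refine (eq_spec (E1 f) (E1 g)).bind fun t3 ht3 => ?_
      simp only [exec, decide_eq_true_eq, if_pos (congrArg E1 h)]
      refine hsp.bind fun t4 ht4 => ?_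
      rw [app_encList]
      refine (emit_run (m :: (f ++ g)) b w).bind fun t5 ht5 => ⟨rfl, ?_⟩
      rw [sp_encList] at ht2
      omega
    · refine ⟨(m :: (f ++ g)) :: [], false, .step ?_ (.done false), Sp.mk HasMain.final ?_⟩
      · rw [step, if_neg (mt hiff.1 h), remainder_eq (by omega) hf hfd,
          remainder_eq (by omega) hg hgd]
      simp only [finalBody, exec, encList, emit, isComposite]
      refine hc.bind fun t1 ht1 => ?_
      refine (app_spec (E1 f) (E1 g)).bind fun t2 ht2 => ?_
      refine (eq_spec (E1 f) (E1 g)).bind fun t3 ht3 => ?_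
      simp only [exec, decide_eq_true_eq,
        if_neg fun h' => h (encList_injective encNat_injective h')]
      rw [app_encList]
      refine (emit_run (m :: (f ++ g)) false []).bind fun t5 ht5 => ⟨rfl, ?_⟩
      rw [sp_encList] at ht2
      omega

end AlgOne


namespace AlgOne

open Lisp

/-! ### The search loop -/

variable {P : Program} [HasMain P] {n a : ℕ} {u : Data}

theorem tl_un (j : ℕ) : (un j).tl = un (j - 1) := by cases j <;> rfl

/-- For `s ≤ k` the exponent is truncated to `0`, so that `l = 0`. -/
theorem mul_two_pow_lt {l k s : ℕ} (h : l < 2 ^ (s - k)) : l * 2 ^ k + 1 ≤ 2 ^ s := by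
  rcases le_total k s with hk | hk
  · have h1 : (l + 1) * 2 ^ k ≤ 2 ^ (s - k) * 2 ^ k := Nat.mul_le_mul_right _ h
    rw [← pow_add, Nat.sub_add_cancel hk] at h1
    have : 1 ≤ 2 ^ k := Nat.one_le_two_pow
    have : (l + 1) * 2 ^ k = l * 2 ^ k + 2 ^ k := by ring
    omega
  · rw [Nat.sub_eq_zero_of_le hk] at h
    obtain rfl : l = 0 := by simpa using h
    simp [Nat.one_le_two_pow]

/-- The greatest common divisor with `n` depends only on the residue modulo `n`, so the program
never forms the huge power. -/
theorem int_gcd_pow_sub (m e x : ℕ) :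
    Int.gcd ((m : ℤ) ^ e - x) n = Nat.gcd ((m ^ e % n : ℕ) - (x : ℤ)).natAbs n := by
  have : (m : ℤ) ^ e - x ≡ (m ^ e % n : ℕ) - (x : ℤ) [ZMOD n] := by
    refine Int.ModEq.sub ?_ (Int.ModEq.refl _)
    push_cast
    exact (Int.mod_modEq _ _).symm
  rw [← Int.gcd_emod, this, Int.gcd_emod, Int.gcd, Int.natAbs_natCast]

/-- Running time of one computation of a greatest common divisor. -/
def gcdT (c : ℕ) : ℕ := 200 * ((2 * c + 1) * (c + 1)) + 2 * mulT (c + 1)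

/-- The state of affairs at the beginning of a round. -/
structure Inv (n m : ℕ) (S S' : List ℕ) : Prop where
  length_eq : S.length = S'.length
  length_le : S.length ≤ 2 ^ (s n - k n)
  pos : 1 ≤ m
  le : ∀ x ∈ S, x ≤ 2 ^ s n
  lt : ∀ x ∈ S', x < n
  coprime : ∀ x ∈ S', Nat.Coprime x n
  seen : ∀ x, 1 ≤ x → x < m → x ^ 2 ^ k n % n ∈ S'

theorem Inv.le_bound {m : ℕ} {S S' : List ℕ} (h : Inv n m S S') (hn : 1 < n)
    (hl : S.length < 2 ^ (s n - k n)) : m ≤ 2 ^ s n := by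
  have h1 := le_of_forall_mem hn h.coprime h.seen
  rw [← h.length_eq] at h1
  exact h1.trans (mul_two_pow_lt hl)

/-- `m` itself is not advanced: its power now belongs to the list, so the next inner loop begins by
passing over it. -/
theorem Inv.add {m : ℕ} {S S' : List ℕ} (h : Inv n m S S') (hn : 1 < n)
    (hl : S.length < 2 ^ (s n - k n)) (hc : Nat.Coprime m n) :
    Inv n m (S ++ [m]) (S' ++ [m ^ 2 ^ k n % n]) where
  length_eq := by simp [h.length_eq]
  length_le := by simpa using hl
  pos := h.pos
  le x hx := by
    rcases List.mem_append.1 hx with hx | hx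
    · exact h.le x hx
    · rw [List.mem_singleton.1 hx]; exact h.le_bound hn hl
  lt x hx := by
    rcases List.mem_append.1 hx with hx | hx
    · exact h.lt x hx
    · rw [List.mem_singleton.1 hx]; exact Nat.mod_lt _ (by omega)
  coprime x hx := by
    rcases List.mem_append.1 hx with hx | hx
    · exact h.coprime x hx
    · rw [List.mem_singleton.1 hx, Nat.Coprime, ← Nat.gcd_rec, Nat.gcd_comm]
      exact Nat.Coprime.pow_left _ hc
  seen x h1 h2 := List.mem_append_left _ (h.seen x h1 h2)

/-- The lemmas on the parts of a round take the rest of the computation, with its time `T`, as the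
hypothesis `hout`. The mutual recursion of the program is thereby resolved by the single induction
over rounds in `outer_run`. -/
theorem diff_run (hV : (n, a) ∈ Valid) (hu : u.sp = 2 * n.size + s n + 2) {m T : ℕ}
    {S S' todo : List ℕ} (h : Inv n m S S') (hl : S.length < 2 ^ (s n - k n))
    (htodo : ∀ x ∈ todo, x < n)
    (hout : ∃ w b, Runs n a (.outer m (S ++ [m]) (S' ++ [m ^ 2 ^ k n % n])) w b ∧
      Sp P fOuter (tup [cx n a u, encNat (S.length + 1), encNat m, E1 (S ++ [m]),
        E1 (S' ++ [m ^ 2 ^ k n % n])]) (output b w) T) :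
    ∃ w b, Runs n a (.diff m S S' todo) w b ∧
      Sp P fDiff (tup [E1 todo, cx n a u, encNat S.length, encNat m, encNat (m ^ 2 ^ k n % n),
        E1 S, E1 S']) (output b w)
        (T + todo.length * gcdT u.sp + (2 ^ (s n - k n) + 2) * mulT (u.sp + 1)) := by
  have h5 := five_le hV
  have hM := le_mulT (u.sp + 1)
  have hnw := lt_width hV hu
  have hsw := two_pow_s_lt_width hu
  have hcn : m ^ 2 ^ k n % n < n := Nat.mod_lt _ (by omega)
  induction todo with
  | nil =>
    obtain ⟨w, b, hr, hsp⟩ := hout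
    refine ⟨[] :: w, b, .step (by rw [step]) hr, Sp.mk HasMain.diff ?_⟩
    simp only [diffBody, exec, encList, emit]
    have hls : S.length < 2 ^ u.sp := by
      have := Nat.pow_le_pow_right (n := 2) (by norm_num) (Nat.sub_le (s n) (k n))
      omega
    refine (add_spec u.sp true S.length 0 hls (by positivity)).bind fun t1 ht1 => ?_
    refine (app_spec (E1 S) (E1 [m])).bind fun t2 ht2 => ?_
    refine (app_spec (E1 S') (E1 [m ^ 2 ^ k n % n])).bind fun t3 ht3 => ?_
    rw [app_encList, app_encList]
    refine hsp.bind fun t4 ht4 => ?_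
    refine (emit_run [] b w).bind fun t5 ht5 => ⟨rfl, ?_⟩
    rw [sp_encList] at ht2 ht3
    rw [← h.length_eq] at ht3
    have h1 : (2 ^ (s n - k n) + 2) * mulT (u.sp + 1) =
      2 ^ (s n - k n) * mulT (u.sp + 1) + 2 * mulT (u.sp + 1) := by ring
    have h2 : 2 ^ (s n - k n) * 100 ≤ 2 ^ (s n - k n) * mulT (u.sp + 1) :=
      Nat.mul_le_mul_left _ (by omega)
    omega
  | cons x todo ih =>
    have hxn := htodo x (by simp)
    have hg := int_gcd_pow_sub (n := n) m (2 ^ k n) x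
    have hn2 : n % 2 = 1 := by have := hV.1; simp only at this; omega
    have hT : (x :: todo).length * gcdT u.sp = todo.length * gcdT u.sp + gcdT u.sp := by
      rw [List.length_cons]; ring
    have hgT : gcdT u.sp = 200 * ((2 * u.sp + 1) * (u.sp + 1)) + 2 * mulT (u.sp + 1) := rfl
    obtain ⟨c, hc⟩ : ∃ c, c = m ^ 2 ^ k n % n := ⟨_, rfl⟩
    obtain ⟨g, hg'⟩ : ∃ g, g = Nat.gcd ((c : ℤ) - x).natAbs n := ⟨_, rfl⟩
    have hab : ((c : ℤ) - x).natAbs < 2 ^ u.sp := by omega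
    have hg0 : 0 < g := hg' ▸ Nat.gcd_pos_of_pos_right _ (by omega)
    rw [← hc, ← hg'] at hg
    have habs := abs_run (P := P) (x := c) (y := x) (b := u.sp) (by omega) (by omega)
    have hgcd := gcd_run (P := P) (B := u.sp) (2 * u.sp) (p := u.sp) (q := u.sp) (by omega) hab hnw hab
      hnw hn2
    rw [← hg'] at hgcd
    by_cases h1 : g > 1
    · refine ⟨[[x, g]], false, .step (by rw [step, hg, if_pos h1]) (.done false),
        Sp.mk HasMain.diff ?_⟩
      rw [← hc]
      simp only [diffBody, exec, encList, emit, cx, ctx, cN, isComposite]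
      refine habs.bind fun t1 ht1 => ?_
      refine hgcd.bind fun t2 ht2 => ?_
      simp only [exec, if_neg (show ¬ g / 2 = 0 by omega)]
      refine (emit_run [x, g] false []).bind fun t3 ht3 => ⟨rfl, ?_⟩
      omega
    · obtain ⟨w, b, hr, hsp⟩ := ih fun y hy => htodo y (by simp [hy])
      refine ⟨[x, g] :: w, b, .step (by rw [step, hg, if_neg h1]) hr, Sp.mk HasMain.diff ?_⟩
      rw [← hc] at hsp ⊢
      simp only [diffBody, exec, encList, emit, cx, ctx, cN]
      refine habs.bind fun t1 ht1 => ?_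
      refine hgcd.bind fun t2 ht2 => ?_
      simp only [exec, if_pos (show g / 2 = 0 by omega)]
      refine hsp.bind fun t3 ht3 => ?_
      refine (emit_run [x, g] b w).bind fun t4 ht4 => ⟨rfl, ?_⟩
      omega

theorem coprime_run (hV : (n, a) ∈ Valid) (hu : u.sp = 2 * n.size + s n + 2) {m T : ℕ}
    {S S' : List ℕ} (h : Inv n m S S') (hl : S.length < 2 ^ (s n - k n))
    (hout : Nat.Coprime m n → ∃ w b,
      Runs n a (.outer m (S ++ [m]) (S' ++ [m ^ 2 ^ k n % n])) w b ∧
      Sp P fOuter (tup [cx n a u, encNat (S.length + 1), encNat m, E1 (S ++ [m]),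
        E1 (S' ++ [m ^ 2 ^ k n % n])]) (output b w) T) :
    ∃ w b, Runs n a (.gcd m S S') w b ∧
      Sp P fCoprime (tup [cx n a u, encNat S.length, encNat m, encNat (m ^ 2 ^ k n % n),
        E1 S, E1 S']) (output b w)
        (T + (2 ^ (s n - k n) + 1) * gcdT u.sp + (2 ^ (s n - k n) + 2) * mulT (u.sp + 1)) := by
  have h5 := five_le hV
  have hM := le_mulT (u.sp + 1)
  have hnw := lt_width hV hu
  have hsw := two_pow_s_lt_width hu
  have hmw : m < 2 ^ u.sp := by have := h.le_bound (by omega) hl; omega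
  have hn2 : n % 2 = 1 := by have := hV.1; simp only at this; omega
  have hgT : gcdT u.sp = 200 * ((2 * u.sp + 1) * (u.sp + 1)) + 2 * mulT (u.sp + 1) := rfl
  have hT : (2 ^ (s n - k n) + 1) * gcdT u.sp = 2 ^ (s n - k n) * gcdT u.sp + gcdT u.sp := by ring
  have hg0 : 0 < Nat.gcd m n := Nat.gcd_pos_of_pos_right _ (by omega)
  have hgcd := gcd_run (P := P) (B := u.sp) (2 * u.sp) (p := u.sp) (q := u.sp) (by omega) hmw hnw
    hmw hnw hn2
  by_cases h1 : Nat.gcd m n > 1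
  · refine ⟨[[Nat.gcd m n]], false, .step (by rw [step, if_pos h1]) (.done false),
      Sp.mk HasMain.coprime ?_⟩
    simp only [coprimeBody, exec, emit, cx, ctx, cN, isComposite]
    refine hgcd.bind fun t2 ht2 => ?_
    simp only [exec, if_neg (show ¬ Nat.gcd m n / 2 = 0 by omega)]
    refine (emit_run [Nat.gcd m n] false []).bind fun t3 ht3 => ⟨rfl, ?_⟩
    omega
  · obtain ⟨w, b, hr, hsp⟩ := diff_run hV hu h hl h.lt (hout (by rw [Nat.Coprime]; omega))
    refine ⟨[Nat.gcd m n] :: w, b, .step (by rw [step, if_neg h1]) hr, Sp.mk HasMain.coprime ?_⟩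
    simp only [coprimeBody, exec, emit, cx, ctx, cN]
    refine hgcd.bind fun t2 ht2 => ?_
    simp only [exec, if_pos (show Nat.gcd m n / 2 = 0 by omega)]
    refine hsp.bind fun t3 ht3 => ?_
    refine (emit_run [Nat.gcd m n] b w).bind fun t4 ht4 => ⟨rfl, ?_⟩
    have : S'.length * gcdT u.sp ≤ 2 ^ (s n - k n) * gcdT u.sp :=
      Nat.mul_le_mul_right _ (h.length_eq ▸ h.length_le)
    omega

theorem bound_run (hV : (n, a) ∈ Valid) (hu : u.sp = 2 * n.size + s n + 2) {m T : ℕ}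
    {S S' : List ℕ} (h : Inv n m S S') (hl : S.length < 2 ^ (s n - k n))
    (hout : Nat.Coprime m n → ∃ w b,
      Runs n a (.outer m (S ++ [m]) (S' ++ [m ^ 2 ^ k n % n])) w b ∧
      Sp P fOuter (tup [cx n a u, encNat (S.length + 1), encNat m, E1 (S ++ [m]),
        E1 (S' ++ [m ^ 2 ^ k n % n])]) (output b w) T) :
    ∃ w b, Runs n a (.bound m S S') w b ∧
      Sp P fBound (tup [cx n a u, encNat S.length, encNat m, encNat (m ^ 2 ^ k n % n),
        E1 S, E1 S']) (output b w)
        (T + (2 ^ (s n - k n) + 1) * gcdT u.sp + (2 ^ (s n - k n) + 3) * mulT (u.sp + 1)) := by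
  have h5 := five_le hV
  have hM := le_mulT (u.sp + 1)
  have hsw := two_pow_s_lt_width hu
  have hkL := k_le_size hV
  have hk1 := one_le_k hV
  have hmw : m < 2 ^ u.sp := by have := h.le_bound (by omega) hl; omega
  have hB := mul_two_pow_lt hl
  -- The program shifts by `k - 1` places and appends the bit `1`, which does the last doubling and
  -- the addition together; this needs `k ≥ 1`.
  have hB2 : 2 * (S.length * 2 ^ (k n - 1)) + 1 = S.length * 2 ^ k n + 1 := by
    obtain ⟨j, hj⟩ : ∃ j, k n = j + 1 := ⟨k n - 1, by omega⟩
    rw [hj, Nat.add_sub_cancel]; ring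
  have hT : (2 ^ (s n - k n) + 3) * mulT (u.sp + 1) =
    (2 ^ (s n - k n) + 2) * mulT (u.sp + 1) + mulT (u.sp + 1) := by ring
  have hshl := shl_run (P := P) (un (k n - 1)) S.length
  have hlt := lt_spec (P := P) u.sp false (S.length * 2 ^ k n + 1) m (by omega) hmw
  rw [sp_un] at hshl
  -- By `le_of_forall_mem` the invariant rules out this case, but following both branches is no
  -- harder.
  by_cases h1 : m > S.length * 2 ^ k n + 1
  · refine ⟨[[S.length * 2 ^ k n + 1]], false, .step (by rw [step, if_pos h1]) (.done false),
      Sp.mk HasMain.bound ?_⟩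
    simp only [boundBody, exec, emit, cx, ctx, cK, isComposite, tl_un]
    refine hshl.bind fun t1 ht1 => ?_
    refine (bit_spec true _).bind fun t2 ht2 => ?_
    rw [Bool.toNat_true, hB2]
    refine hlt.bind fun t3 ht3 => ?_
    simp only [exec, decide_eq_true_eq, Bool.toNat_false, add_zero, if_pos h1]
    refine (emit_run [S.length * 2 ^ k n + 1] false []).bind fun t4 ht4 => ⟨rfl, ?_⟩
    omega
  · obtain ⟨w, b, hr, hsp⟩ := coprime_run hV hu h hl hout
    refine ⟨[S.length * 2 ^ k n + 1] :: w, b, .step (by rw [step, if_neg h1]) hr,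
      Sp.mk HasMain.bound ?_⟩
    simp only [boundBody, exec, emit, cx, ctx, cK, tl_un]
    refine hshl.bind fun t1 ht1 => ?_
    refine (bit_spec true _).bind fun t2 ht2 => ?_
    rw [Bool.toNat_true, hB2]
    refine hlt.bind fun t3 ht3 => ?_
    simp only [exec, decide_eq_true_eq, Bool.toNat_false, add_zero, if_neg h1]
    refine hsp.bind fun t4 ht4 => ?_
    refine (emit_run [S.length * 2 ^ k n + 1] b w).bind fun t5 ht5 => ⟨rfl, ?_⟩
    omega

/-- Running time of one test of the inner loop. -/
noncomputable def innerT (n c : ℕ) : ℕ :=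
  6 * ((k n + 1) * mulT (c + 1)) + (2 ^ (s n - k n) + 5) * mulT (c + 1)

/-- Running time of one round, without the successful tests of the inner loop. -/
noncomputable def roundT (n c : ℕ) : ℕ :=
  innerT n c + (2 ^ (s n - k n) + 1) * gcdT c + (2 ^ (s n - k n) + 4) * mulT (c + 1)

/-- Here `i = 2 ^ s + 1 - m` is a budget of tests. It is handed on to the next round undiminished by
anything but the growth of `m`, so all rounds share the one budget instead of each paying for `2 ^
s` tests. -/
theorem inner_run (hV : (n, a) ∈ Valid) (hu : u.sp = 2 * n.size + s n + 2) {T : ℕ}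
    {S S' : List ℕ} (hl : S.length < 2 ^ (s n - k n))
    (hout : ∀ m i, Inv n m S S' → Nat.Coprime m n → m + i = 2 ^ s n + 1 → ∃ w b,
      Runs n a (.outer m (S ++ [m]) (S' ++ [m ^ 2 ^ k n % n])) w b ∧
      Sp P fOuter (tup [cx n a u, encNat (S.length + 1), encNat m, E1 (S ++ [m]),
        E1 (S' ++ [m ^ 2 ^ k n % n])]) (output b w) (i * innerT n u.sp + T)) (i : ℕ) :
    ∀ m, m + i = 2 ^ s n + 1 → Inv n m S S' → ∃ w b, Runs n a (.inner m S S') w b ∧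
      Sp P fInner (tup [cx n a u, encNat S.length, encNat m, E1 S, E1 S']) (output b w)
        (i * innerT n u.sp + T + innerT n u.sp + (2 ^ (s n - k n) + 1) * gcdT u.sp +
          (2 ^ (s n - k n) + 3) * mulT (u.sp + 1)) := by
  have h5 := five_le hV
  have hM := le_mulT (u.sp + 1)
  have hsw := two_pow_s_lt_width hu
  have hnw := lt_width hV hu
  have hT : innerT n u.sp = 6 * ((k n + 1) * mulT (u.sp + 1)) +
    (2 ^ (s n - k n) + 1) * mulT (u.sp + 1) + 4 * mulT (u.sp + 1) := by rw [innerT]; ring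
  induction i with
  | zero =>
    intro m hm h
    -- An exhausted budget would mean `m = 2 ^ s + 1`, which the counting of roots excludes.
    have := h.le_bound (by omega) hl
    omega
  | succ i ih =>
    intro m hm h
    have hmw : m < 2 ^ u.sp := by have := h.le_bound (by omega) hl; omega
    have hred := red_run (P := P) (by omega) hnw hmw
    have hsqs := sqs_run (P := P) (by omega) (sq_lt_width hV hu) (un (k n)) m
    have hmem := mem_run (P := P) (m ^ 2 ^ k n % n) S'
    rw [sp_un] at hsqs
    have hcn : m ^ 2 ^ k n % n < n := Nat.mod_lt _ (by omega)
    have hmT : (S'.length + 1) * (30 * (encNat (m ^ 2 ^ k n % n)).nodes + 40) ≤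
        (2 ^ (s n - k n) + 1) * mulT (u.sp + 1) := by
      have h1 := nodes_encNat_lt (hcn.trans hnw)
      exact Nat.mul_le_mul (by have := h.length_eq ▸ h.length_le; omega) (by omega)
    by_cases h1 : m ^ 2 ^ k n % n ∈ S'
    · have h' : Inv n (m + 1) S S' := { h with
        pos := by omega
        seen := fun x hx hxm => by
          rcases Nat.lt_succ_iff_lt_or_eq.1 hxm with hxm | rfl
          · exact h.seen x hx hxm
          · exact h1 }
      obtain ⟨w, b, hr, hsp⟩ := ih (m + 1) (by omega) h'
      refine ⟨[m, m ^ 2 ^ k n % n] :: w, b, .step (by rw [step, if_pos h1]) hr,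
        Sp.mk HasMain.inner ?_⟩
      simp only [innerBody, exec, emit, cx, ctx, cMod, cK]
      refine hred.bind fun t1 ht1 => ?_
      refine hsqs.bind fun t2 ht2 => ?_
      refine hmem.bind fun t3 ht3 => ?_
      simp only [exec, decide_eq_true_eq, if_pos h1]
      rw [show Lisp.Data.nil = encNat 0 from encNat_zero.symm]
      refine (add_spec u.sp true m 0 hmw (by positivity)).bind fun t4 ht4 => ?_
      refine hsp.bind fun t5 ht5 => ?_
      refine (emit_run [m, m ^ 2 ^ k n % n] b w).bind fun t6 ht6 => ⟨rfl, ?_⟩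
      have : (i + 1) * innerT n u.sp = i * innerT n u.sp + innerT n u.sp := by ring
      omega
    · obtain ⟨w, b, hr, hsp⟩ := bound_run hV hu h hl fun hc => hout m (i + 1) h hc hm
      refine ⟨[m, m ^ 2 ^ k n % n] :: w, b, .step (by rw [step, if_neg h1]) hr,
        Sp.mk HasMain.inner ?_⟩
      simp only [innerBody, exec, emit, cx, ctx, cMod, cK]
      refine hred.bind fun t1 ht1 => ?_
      refine hsqs.bind fun t2 ht2 => ?_
      refine hmem.bind fun t3 ht3 => ?_
      simp only [exec, decide_eq_true_eq, if_neg h1]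
      refine hsp.bind fun t5 ht5 => ?_
      refine (emit_run [m, m ^ 2 ^ k n % n] b w).bind fun t6 ht6 => ⟨rfl, ?_⟩
      omega

/-- Running time of the polynomial congruences. -/
noncomputable def finalT (n c : ℕ) : ℕ :=
  (2 ^ (s n - k n) + 1) * (70 * ((n.size + 1) * polT c (2 ^ s n))) + mulT (c + 1)

/-- The time is a potential: `i` for the values of `m` still available, `j` for the rounds still to
come, and Step 4 at the end. -/
theorem outer_run (hV : (n, a) ∈ Valid) (hu : u.sp = 2 * n.size + s n + 2) (j : ℕ) :
    ∀ (m i : ℕ) (S S' : List ℕ), Inv n m S S' → S.length + j = 2 ^ (s n - k n) →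
    m + i = 2 ^ s n + 1 → ∃ w b, Runs n a (.outer m S S') w b ∧
      Sp P fOuter (tup [cx n a u, encNat S.length, encNat m, E1 S, E1 S']) (output b w)
        (i * innerT n u.sp + (j * roundT n u.sp + finalT n u.sp)) := by
  have h5 := five_le hV
  have hM := le_mulT (u.sp + 1)
  have hsw := two_pow_s_lt_width hu
  have hNw : 2 ^ (s n - k n) < 2 ^ u.sp := by
    have := Nat.pow_le_pow_right (n := 2) (by norm_num) (Nat.sub_le (s n) (k n))
    omega
  induction j with
  | zero =>
    intro m i S S' h hj hm
    have h1 : ¬ S.length < 2 ^ (s n - k n) := by omega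
    obtain ⟨w, b, hr, hsp⟩ := final_run (P := P) hV hu (todo := S) fun x hx => by
      have := h.le x hx; omega
    have hlt := lt_spec (P := P) u.sp false S.length (2 ^ (s n - k n)) (by omega) hNw
    refine ⟨[S.length] :: w, b, .step (by rw [step, if_neg h1]) hr, Sp.mk HasMain.outer ?_⟩
    simp only [outerBody, exec, emit, cx, cTarget]
    refine hlt.bind fun t1 ht1 => ?_
    simp only [exec, decide_eq_true_eq, Bool.toNat_false, add_zero, if_neg h1]
    refine hsp.bind fun t2 ht2 => ?_
    refine (emit_run [S.length] b w).bind fun t3 ht3 => ⟨rfl, ?_⟩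
    rw [show S.length = 2 ^ (s n - k n) by omega] at ht2
    rw [finalT]
    omega
  | succ j ih =>
    intro m i S S' h hj hm
    have h1 : S.length < 2 ^ (s n - k n) := by omega
    obtain ⟨w, b, hr, hsp⟩ := inner_run hV hu h1 (fun m' i' h' hc hm' =>
      (by simpa using ih m' i' _ _ (h'.add (by omega) h1 hc) (by simp; omega) hm')) i m hm h
    have hlt := lt_spec (P := P) u.sp false S.length (2 ^ (s n - k n)) (by omega) hNw
    refine ⟨[S.length] :: w, b, .step (by rw [step, if_pos h1]) hr, Sp.mk HasMain.outer ?_⟩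
    simp only [outerBody, exec, emit, cx, cTarget]
    refine hlt.bind fun t1 ht1 => ?_
    simp only [exec, decide_eq_true_eq, Bool.toNat_false, add_zero, if_pos h1]
    refine hsp.bind fun t2 ht2 => ?_
    refine (emit_run [S.length] b w).bind fun t3 ht3 => ⟨rfl, ?_⟩
    have hT : (j + 1) * roundT n u.sp = j * roundT n u.sp + (innerT n u.sp +
      (2 ^ (s n - k n) + 1) * gcdT u.sp + (2 ^ (s n - k n) + 3) * mulT (u.sp + 1) +
      mulT (u.sp + 1)) := by rw [roundT]; ring
    omega

end AlgOne


namespace AlgOne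

open Lisp

/-! ### The whole algorithm -/

variable {P : Program} [HasMain P] {n a : ℕ} {u : Data}

/-- Running time of the search loop and the polynomial congruences. -/
noncomputable def loopT (n c : ℕ) : ℕ :=
  2 ^ s n * innerT n c + (2 ^ (s n - k n) * roundT n c + finalT n c)

/-- Running time of the test for perfect powers. -/
def perfectT (L : ℕ) : ℕ := (L + 1) * (6 * ((L + 2) * ((L + 2) * mulT (2 * L + 2))))

theorem inv_init (hV : (n, a) ∈ Valid) : Inv n 1 [1] [1] where
  length_eq := rfl
  length_le := Nat.one_le_two_pow
  pos := le_rfl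
  le x hx := by rw [List.mem_singleton.1 hx]; exact Nat.one_le_two_pow
  lt x hx := by have := five_le hV; rw [List.mem_singleton.1 hx]; omega
  coprime x hx := by rw [List.mem_singleton.1 hx]; exact Nat.coprime_one_left n
  seen x h1 h2 := by omega

theorem perfect_run (hV : (n, a) ∈ Valid) (hu : u.sp = 2 * n.size + s n + 2) :
    ∃ w b, Runs n a .step2 w b ∧ Sp P fPerfect (cx n a u) (output b w)
      (loopT n u.sp + perfectT n.size + mulT (u.sp + 1)) := by
  have h5 := five_le hV
  have hM := le_mulT (u.sp + 1)
  -- The list of binary digits of `n` serves as a unary counter of length `n.size`, which covers the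
  -- exponents from `2` to `n.size + 1`.
  obtain ⟨β, hβ, hpp⟩ := pp_run (P := P) (n := n) (L := n.size) (by omega) (Nat.lt_size_self n)
    (encNat n) (u := un 2) (by simp) (by rw [sp_un, sp_encNat]; omega)
  rw [sp_encNat, sp_un, ← perfect_iff (by omega)] at hβ
  rw [sp_encNat, ← perfectT] at hpp
  cases β with
  | true =>
    refine ⟨[[1]], false, .step (by rw [step, if_pos (hβ.1 rfl)]) (.done false),
      Sp.mk HasMain.perfect ?_⟩
    simp only [perfectBody, exec, emit, cx, ctx, cN, isComposite]
    refine hpp.bind fun t1 ht1 => ?_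
    simp only [exec, if_true]
    rw [← encNat_one]
    refine (emit_run [1] false []).bind fun t2 ht2 => ⟨rfl, ?_⟩
    omega
  | false =>
    obtain ⟨w, b, hr, hsp⟩ := outer_run (P := P) hV hu (2 ^ (s n - k n) - 1) 1 (2 ^ s n) [1] [1]
      (inv_init hV) (by have : 1 ≤ 2 ^ (s n - k n) := Nat.one_le_two_pow
                        simp; omega) (by omega)
    refine ⟨[0] :: w, b, .step (by rw [step, if_neg fun h => by simpa using hβ.2 h]) hr,
      Sp.mk HasMain.perfect ?_⟩
    simp only [perfectBody, exec, emit, cx, ctx, cN]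
    refine hpp.bind fun t1 ht1 => ?_
    simp only [exec, Bool.false_eq_true, if_false]
    rw [← encNat_one]
    refine hsp.bind fun t2 ht2 => ?_
    rw [← encNat_zero]
    refine (emit_run [0] b w).bind fun t3 ht3 => ⟨rfl, ?_⟩
    have : (2 ^ (s n - k n) - 1) * roundT n u.sp ≤ 2 ^ (s n - k n) * roundT n u.sp :=
      Nat.mul_le_mul_right _ (Nat.sub_le _ _)
    rw [loopT]
    omega

theorem small_run (hV : (n, a) ∈ Valid) (hu : u.sp = 2 * n.size + s n + 2) :
    ∃ w b, Runs n a .step1b w b ∧ Sp P fSmall (cx n a u) (output b w)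
      (loopT n u.sp + perfectT n.size + 2 * mulT (u.sp + 1)) := by
  have hM := le_mulT (u.sp + 1)
  have hkL := k_le_size hV
  have happ := app_spec (P := P) (un (k n)) (un (k n))
  have hdrop := drop_spec (P := P) (un (k n + k n)) (encNat n)
  rw [sp_un, app_un] at happ
  rw [sp_un, drop_encNat] at hdrop
  have h2 : n / 2 ^ (k n + k n) = 0 ↔ n < 2 ^ (k n + k n) := Nat.div_eq_zero_iff_lt (by positivity)
  by_cases h1 : (k n : ℝ) > 1 / 2 * Real.logb 2 n
  · refine ⟨[[1]], true, .step (by rw [step, if_pos h1]) (.done true), Sp.mk HasMain.small ?_⟩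
    rw [logb_lt_iff hV] at h1
    simp only [smallBody, exec, emit, cx, ctx, cN, cK, isPrime]
    refine happ.bind fun t1 ht1 => ?_
    refine hdrop.bind fun t2 ht2 => ?_
    simp only [exec, if_pos (h2.2 h1)]
    rw [← encNat_one]
    refine (emit_run [1] true []).bind fun t3 ht3 => ⟨rfl, ?_⟩
    omega
  · obtain ⟨w, b, hr, hsp⟩ := perfect_run (P := P) hV hu
    refine ⟨[0] :: w, b, .step (by rw [step, if_neg h1]) hr, Sp.mk HasMain.small ?_⟩
    rw [logb_lt_iff hV] at h1
    simp only [smallBody, exec, emit, cx, ctx, cN, cK]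
    refine happ.bind fun t1 ht1 => ?_
    refine hdrop.bind fun t2 ht2 => ?_
    simp only [exec, if_neg (mt h2.1 h1)]
    refine hsp.bind fun t3 ht3 => ?_
    rw [← encNat_zero]
    refine (emit_run [0] b w).bind fun t4 ht4 => ⟨rfl, ?_⟩
    omega

/-- `n` is odd, so clearing the lowest bit subtracts `1`. -/
theorem encNat_pred (hV : (n, a) ∈ Valid) : encNat (n - 1) = .cons .nil (encNat (n / 2)) := by
  have h5 := five_le hV
  have h1 := hV.1
  simp only at h1
  have := encNat_bit false (n / 2) (.inl (by omega))
  rw [Bool.toNat_false, add_zero, show 2 * (n / 2) = n - 1 by omega] at this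
  exact this

theorem modEq_neg_one_iff (hn : 0 < n) (x : ℕ) : (x : ℤ) ≡ -1 [ZMOD n] ↔ x % n = n - 1 := by
  rw [Int.modEq_iff_dvd, ← dvd_neg, show -(-1 - (x : ℤ)) = ((x + 1 : ℕ) : ℤ) by push_cast; ring,
    Int.natCast_dvd_natCast, Nat.dvd_iff_mod_eq_zero, Nat.add_mod]
  have h1 := Nat.mod_lt x hn
  rcases Nat.eq_or_lt_of_le (show 1 ≤ n from hn) with rfl | h2
  · simp [Nat.mod_one]
  · rw [Nat.mod_eq_of_lt h2]
    constructor
    · intro h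
      by_contra h3
      rw [Nat.mod_eq_of_lt (by omega)] at h
      omega
    · intro h
      rw [h, Nat.sub_add_cancel hn, Nat.mod_self]

/-- Running time of all steps. -/
noncomputable def stepsT (n c : ℕ) : ℕ :=
  loopT n c + perfectT n.size + 18 * ((n.size + 1) * mulT (c + 1)) + 3 * mulT (c + 1)

theorem powers_run (hV : (n, a) ∈ Valid) (hu : u.sp = 2 * n.size + s n + 2) :
    ∃ w b, Runs n a .step1a w b ∧
      Sp P fPowers (tup [cx n a u, encNat ((n - 1) / 2 ^ k n)]) (output b w) (stepsT n u.sp) := by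
  classical
  have h5 := five_le hV
  have hM := le_mulT (u.sp + 1)
  have hkL := k_le_size hV
  have hnn := sq_lt_width hV hu
  obtain ⟨A, hA⟩ : ∃ A, A = a ^ ((n - 1) / 2 ^ k n) := ⟨_, rfl⟩
  have he : (n - 1) / 2 ^ k n < 2 ^ n.size :=
    (Nat.div_le_self _ _).trans_lt ((Nat.sub_lt (by omega) one_pos).trans (Nat.lt_size_self n))
  have hpwm := pwm_run (P := P) (by omega) hnn hV.2.1 n.size he
  have hsqs := sqs_run (P := P) (by omega) hnn (un (k n - 1)) A
  simp only at hpwm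
  rw [← hA] at hpwm
  rw [sp_un] at hsqs
  obtain ⟨B, hB⟩ : ∃ B, B = A ^ 2 ^ (k n - 1) % n := ⟨_, rfl⟩
  have hBn : B < n := hB ▸ Nat.mod_lt _ (by omega)
  rw [← hB] at hsqs
  have heq := eq_spec (P := P) (encNat B) (encNat (n - 1))
  have hnod := nodes_encNat_lt (hBn.trans (Nat.lt_size_self n))
  have hiff : (A : ℤ) ^ 2 ^ (k n - 1) ≡ -1 [ZMOD n] ↔ B = n - 1 := by
    rw [hB, ← modEq_neg_one_iff (by omega)]; push_cast; rfl
  have hkM : (k n - 1 + 1) * mulT (u.sp + 1) ≤ (n.size + 1) * mulT (u.sp + 1) :=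
    Nat.mul_le_mul_right _ (by omega)
  rw [encNat_pred hV] at heq
  by_cases h1 : B = n - 1
  · obtain ⟨w, b, hr, hsp⟩ := small_run (P := P) hV hu
    refine ⟨[A % n, B] :: w, b, .step (by simp only [step, ← hA, ← hB, if_pos (hiff.2 h1)]) hr,
      Sp.mk HasMain.powers ?_⟩
    simp only [powersBody, exec, emit, cx, ctx, cMod, cN, cA, cK, tl_un]
    refine hpwm.bind fun t1 ht1 => ?_
    refine hsqs.bind fun t2 ht2 => ?_
    refine heq.bind fun t3 ht3 => ?_
    simp only [exec, decide_eq_true_eq]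
    rw [if_pos (by rw [h1, encNat_pred hV])]
    refine hsp.bind fun t4 ht4 => ?_
    refine (emit_run [A % n, B] b w).bind fun t5 ht5 => ⟨rfl, ?_⟩
    rw [stepsT]
    omega
  · refine ⟨[[A % n, B]], false,
      .step (by simp only [step, ← hA, ← hB, if_neg (mt hiff.1 h1)]) (.done false),
      Sp.mk HasMain.powers ?_⟩
    simp only [powersBody, exec, emit, cx, ctx, cMod, cN, cA, cK, tl_un, isComposite]
    refine hpwm.bind fun t1 ht1 => ?_
    refine hsqs.bind fun t2 ht2 => ?_
    refine heq.bind fun t3 ht3 => ?_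
    simp only [exec, decide_eq_true_eq]
    rw [if_neg (by rw [← encNat_pred hV, encNat_injective.eq_iff]; exact h1)]
    refine (emit_run [A % n, B] false []).bind fun t5 ht5 => ⟨rfl, ?_⟩
    rw [stepsT]
    omega

/-- Bound for the running time of the program. -/
noncomputable def totalT (n c : ℕ) : ℕ :=
  stepsT n c + 250 * ((c + 2) * (n.size + 2)) + 70 * 2 ^ s n + mulT (c + 1)

theorem setup_run (hV : (n, a) ∈ Valid) :
    ∃ w b, Runs n a .step1a w b ∧
      Sp P 0 (input n a) (output b w) (totalT n (2 * n.size + s n + 2)) := by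
  have h5 := five_le hV
  have hkL := k_le_size hV
  -- Only the length of `u` counts, so the digits of `n` are used as they are to form a unary
  -- number.
  obtain ⟨u, hu'⟩ : ∃ u, u = (encNat n).app ((encNat n).app (.cons .nil (.cons .nil (un (s n))))) :=
    ⟨_, rfl⟩
  have hu : u.sp = 2 * n.size + s n + 2 := by
    rw [hu', sp_app, sp_app, sp_encNat]
    simp only [Data.sp, sp_un]
    omega
  have hM := le_mulT (u.sp + 1)
  obtain ⟨w, b, hr, hsp⟩ := powers_run (P := P) hV hu
  have hun := un2_run (P := P) (s n)
  have happ1 := app_spec (P := P) (encNat n) (.cons .nil (.cons .nil (un (s n))))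
  have happ2 := app_spec (P := P) (encNat n) ((encNat n).app (.cons .nil (.cons .nil (un (s n)))))
  rw [← hu', sp_encNat] at happ2
  rw [sp_encNat] at happ1
  have htz := tz_run (P := P) n.size (x := n - 1) (j := 0) (by omega)
    ((Nat.sub_lt (by omega) one_pos).trans (Nat.lt_size_self n))
  rw [zero_add, encNat_pred hV, show padicValNat 2 (n - 1) = k n from rfl] at htz
  have hshl := shl_run (P := P) u 1
  rw [one_mul, encNat_one] at hshl
  have hdivm := divm_run (P := P) (n := n) (by omega) (Nat.lt_size_self n) (u.sp + 1)
    (x := 2 ^ u.sp) (Nat.pow_lt_pow_right (by norm_num) (by omega))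
  have hpw := pw_spec (P := P) (un (s n))
  have hdrop := drop_spec (P := P) (un (k n)) (un (s n))
  have hshl2 := shl_run (P := P) (un (s n - k n)) 1
  rw [sp_un] at hpw
  rw [sp_un, drop_un] at hdrop
  rw [sp_un, one_mul, encNat_one] at hshl2
  refine ⟨w, b, hr, Sp.mk HasMain.setup ?_⟩
  rw [← hu, totalT]
  simp only [setupBody, exec, input]
  refine hun.bind fun t1 ht1 => ?_
  refine happ1.bind fun t2 ht2 => ?_
  refine happ2.bind fun t3 ht3 => ?_
  refine htz.bind fun t4 ht4 => ?_
  simp only [exec]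
  refine hshl.bind fun t5 ht5 => ?_
  refine hdivm.bind fun t6 ht6 => ?_
  refine hpw.bind fun t7 ht7 => ?_
  refine hdrop.bind fun t8 ht8 => ?_
  refine hshl2.bind fun t9 ht9 => ?_
  refine hsp.bind fun t10 ht10 => ⟨rfl, ?_⟩
  have h6 : (u.sp + 1 + 1) * (n.size + 2) = (u.sp + 2) * (n.size + 2) := rfl
  omega

end AlgOne


namespace AlgOne

open Lisp

/-! ### Estimates -/

variable {n a : ℕ}

theorem three_le_size (hV : (n, a) ∈ Valid) : 3 ≤ n.size := by
  have h5 := five_le hV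
  by_contra! h
  have h1 := Nat.lt_size_self n
  have h2 : 2 ^ n.size ≤ 2 ^ 2 := Nat.pow_le_pow_right (by norm_num) (by omega)
  omega

theorem s_le_size (hV : (n, a) ∈ Valid) : s n ≤ 2 * n.size := by
  have h5 := five_le hV
  have h1 := two_lt_logb hV
  have h2 := two_pow_s_le hV
  have h3 : Real.logb 2 n ≤ n.size := by
    rw [Real.logb_le_iff_le_rpow (by norm_num) (by positivity), Real.rpow_natCast]
    exact_mod_cast (Nat.lt_size_self n).le
  have h4 : (2 : ℝ) ^ s n ≤ 2 * (n.size : ℝ) ^ 2 := h2.trans (by gcongr)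
  have h6 : 2 ^ s n ≤ 2 * n.size ^ 2 := by exact_mod_cast h4
  have h7 : n.size < 2 ^ n.size := Nat.lt_two_pow_self
  have h8 : n.size ^ 2 < (2 ^ n.size) ^ 2 := Nat.pow_lt_pow_left h7 (by norm_num)
  have h9 : 2 ^ s n < 2 ^ (2 * n.size + 1) := by
    rw [pow_succ, mul_comm 2 n.size, pow_mul]; omega
  have := (Nat.pow_lt_pow_iff_right (by norm_num)).1 h9
  omega

theorem size_lt_two_pow (hV : (n, a) ∈ Valid) : n.size < 2 ^ (s n + 2) := by
  have h1 := size_sq_le hV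
  have h2 : n.size ^ 2 < (2 ^ (s n + 2)) ^ 2 := by
    have h3 : (2 ^ (s n + 2)) ^ 2 = 16 * (2 ^ s n * 2 ^ s n) := by ring
    have h4 : 2 ^ s n ≤ 2 ^ s n * 2 ^ s n := Nat.le_mul_of_pos_left _ (by positivity)
    have : 0 < 2 ^ s n := by positivity
    omega
  exact lt_of_pow_lt_pow_left₀ 2 (by positivity) h2

/-- As `n.size < 2 ^ (s + 2)`, the logarithm of the width is `O(s)`; in this way all logarithmic
factors become powers of `s + 1`. -/
theorem mulT_width_le (hV : (n, a) ∈ Valid) : mulT (2 * n.size + s n + 2 + 1) ≤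
    10 ^ 12 * (n.size * (s n + 1) ^ 5) := by
  have h3 := three_le_size hV
  have hs := s_le_size hV
  have hs1 := one_le_s hV
  have hL := size_lt_two_pow hV
  have h4 : (2 * n.size + s n + 2 + 1).size ≤ s n + 5 := by
    rw [Nat.size_le]
    have h5 : 2 ^ (s n + 5) = 8 * 2 ^ (s n + 2) := by ring
    have h6 : s n < 2 ^ s n := Nat.lt_two_pow_self
    have h7 : 2 ^ (s n + 2) = 4 * 2 ^ s n := by ring
    omega
  rw [mulT]
  calc _ ≤ 50000000 * ((6 * n.size) * (4 * (s n + 1)) ^ 5) := by gcongr <;> omega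
    _ = 307200000000 * (n.size * (s n + 1) ^ 5) := by ring
    _ ≤ _ := by gcongr; norm_num

theorem mulT_width_mul_le (hV : (n, a) ∈ Valid) : mulT ((2 * n.size + s n + 2) * 2 ^ s n) ≤
    3 * 10 ^ 12 * (n.size * 2 ^ s n * (s n + 1) ^ 5) := by
  have h3 := three_le_size hV
  have hs := s_le_size hV
  have hs1 := one_le_s hV
  have hL := size_lt_two_pow hV
  have hD : 1 ≤ 2 ^ s n := Nat.one_le_two_pow
  have h4 : ((2 * n.size + s n + 2) * 2 ^ s n).size ≤ 2 * s n + 5 := by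
    rw [Nat.size_le]
    have h5 : 2 ^ (2 * s n + 5) = 2 ^ (s n + 5) * 2 ^ s n := by rw [← pow_add]; congr 1; omega
    rw [h5]
    refine Nat.mul_lt_mul_of_pos_right ?_ (by positivity)
    have h5 : 2 ^ (s n + 5) = 8 * 2 ^ (s n + 2) := by ring
    have h6 : s n < 2 ^ s n := Nat.lt_two_pow_self
    have h7 : 2 ^ (s n + 2) = 4 * 2 ^ s n := by ring
    omega
  have h6 : (2 * n.size + s n + 2) * 2 ^ s n + 1 ≤ 6 * n.size * 2 ^ s n := by
    calc _ ≤ (2 * n.size + s n + 2) * 2 ^ s n + 1 * 2 ^ s n := by omega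
      _ = (2 * n.size + s n + 3) * 2 ^ s n := by ring
      _ ≤ _ := by gcongr; omega
  rw [mulT]
  calc _ ≤ 50000000 * ((6 * n.size * 2 ^ s n) * (5 * (s n + 1)) ^ 5) := by gcongr <;> omega
    _ = 937500000000 * (n.size * 2 ^ s n * (s n + 1) ^ 5) := by ring
    _ ≤ _ := by gcongr; norm_num

/-- All parts are compared with `Q = D * N * L ^ 2 * e`, where `e = (s + 1) ^ 5` carries the
logarithmic factors. After generalization only a few inequalities between free variables are used,
above all `N ≤ D` and `L ^ 2 ≤ 4 * D`. -/
theorem totalT_le (hV : (n, a) ∈ Valid) : totalT n (2 * n.size + s n + 2) + 2 ≤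
    10 ^ 16 * (2 ^ s n * 2 ^ (s n - k n) * n.size ^ 2 * (s n + 1) ^ 5) := by
  have h3 := three_le_size hV
  have hs := s_le_size hV
  have hk := k_le_size hV
  have hM := mulT_width_le hV
  have hM' := mulT_width_mul_le hV
  have hM2 : mulT (2 * n.size + 2) ≤ mulT (2 * n.size + s n + 2 + 1) := mulT_mono (by omega)
  have hsq := size_sq_le hV
  have hND : 2 ^ (s n - k n) ≤ 2 ^ s n := Nat.pow_le_pow_right (by norm_num) (Nat.sub_le _ _)
  have hN : 1 ≤ 2 ^ (s n - k n) := Nat.one_le_two_pow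
  have hD : 1 ≤ 2 ^ s n := Nat.one_le_two_pow
  have he : 1 ≤ (s n + 1) ^ 5 := Nat.one_le_pow _ _ (by omega)
  have hc : 2 * n.size + s n + 2 + 2 ≤ 6 * n.size := by omega
  simp only [totalT, stepsT, loopT, innerT, roundT, finalT, gcdT, perfectT, polT]
  generalize mulT (2 * n.size + s n + 2 + 1) = M at *
  generalize mulT ((2 * n.size + s n + 2) * 2 ^ s n) = M' at *
  generalize mulT (2 * n.size + 2) = M2 at *
  generalize 2 * n.size + s n + 2 = c at *
  generalize (s n + 1) ^ 5 = e at *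
  generalize 2 ^ (s n - k n) = N at *
  generalize 2 ^ s n = D at *
  generalize k n = κ at *
  generalize n.size = L at *
  obtain ⟨Y, hY⟩ : ∃ Y, Y = L ^ 2 * e := ⟨_, rfl⟩
  obtain ⟨Q, hQ⟩ : ∃ Q, Q = D * N * Y := ⟨_, rfl⟩
  have hLY : L * e ≤ Y := by rw [hY, pow_two]; gcongr; exact Nat.le_mul_of_pos_left _ (by omega)
  have hLLY : L * L ≤ Y := by rw [hY, pow_two]; exact Nat.le_mul_of_pos_right _ he
  have hMY : M ≤ 10 ^ 12 * Y := hM.trans (by gcongr)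
  have hLM : L * M ≤ 10 ^ 12 * Y := by
    calc L * M ≤ L * (10 ^ 12 * (L * e)) := by gcongr
      _ = _ := by rw [hY]; ring
  have hY1 : 1 ≤ Y := (Nat.mul_pos (by omega) (by omega)).trans_le hLLY
  have hNY : N * Y ≤ Q := by rw [hQ, mul_assoc]; exact Nat.le_mul_of_pos_left _ hD
  have hDY : D * Y ≤ Q := by rw [hQ, mul_right_comm]; exact Nat.le_mul_of_pos_right _ hN
  have hYQ : Y ≤ Q := (Nat.le_mul_of_pos_left _ hN).trans hNY
  have hDQ : D ≤ Q := (Nat.le_mul_of_pos_right _ hY1).trans hDY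
  have hinner : 6 * ((κ + 1) * M) + (N + 5) * M ≤ 18 * 10 ^ 12 * (N * Y) := by
    have h1 : (κ + 1) * M ≤ 2 * (10 ^ 12 * Y) := by
      calc (κ + 1) * M ≤ (2 * L) * M := by gcongr; omega
        _ = 2 * (L * M) := by ring
        _ ≤ _ := by gcongr
    have h2 : (N + 5) * M ≤ (6 * N) * (10 ^ 12 * Y) := by gcongr; omega
    have h3 : Y ≤ N * Y := Nat.le_mul_of_pos_left _ hN
    linarith
  have hgcd : 200 * ((2 * c + 1) * (c + 1)) + 2 * M ≤ 3 * 10 ^ 12 * Y := by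
    have h1 : (2 * c + 1) * (c + 1) ≤ (12 * L) * (6 * L) := by gcongr <;> omega
    linarith
  have hround : 6 * ((κ + 1) * M) + (N + 5) * M + (N + 1) * (200 * ((2 * c + 1) * (c + 1)) + 2 * M) +
      (N + 4) * M ≤ 29 * 10 ^ 12 * (N * Y) := by
    have h1 : (N + 1) * (200 * ((2 * c + 1) * (c + 1)) + 2 * M) ≤ (2 * N) * (3 * 10 ^ 12 * Y) := by
      gcongr; omega
    have h2 : (N + 4) * M ≤ (5 * N) * (10 ^ 12 * Y) := by gcongr; omega
    linarith
  have hI : D * (6 * ((κ + 1) * M) + (N + 5) * M) ≤ 18 * 10 ^ 12 * Q := by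
    calc _ ≤ D * (18 * 10 ^ 12 * (N * Y)) := by gcongr
      _ = _ := by rw [hQ]; ring
  -- `N` rounds with about `N` greatest common divisors each; one factor `N` is estimated by `D`.
  have hR : N * (6 * ((κ + 1) * M) + (N + 5) * M + (N + 1) * (200 * ((2 * c + 1) * (c + 1)) + 2 * M) +
      (N + 4) * M) ≤ 29 * 10 ^ 12 * Q := by
    calc _ ≤ D * (29 * 10 ^ 12 * (N * Y)) := by gcongr
      _ = _ := by rw [hQ]; ring
  -- The main term: `N` congruences, `L` products each, and `L * D * e` for a product.
  have hF : (N + 1) * (70 * ((L + 1) * (M' + (D + 1) * M))) ≤ 1400 * 10 ^ 12 * Q := by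
    have h1 : M' + (D + 1) * M ≤ 5 * 10 ^ 12 * (L * D * e) := by
      have : (D + 1) * M ≤ (2 * D) * (10 ^ 12 * (L * e)) := by gcongr; omega
      linarith
    calc _ ≤ (2 * N) * (70 * ((2 * L) * (5 * 10 ^ 12 * (L * D * e)))) := by gcongr <;> omega
      _ = _ := by rw [hQ, hY]; ring
  -- About `L` exponents, `L` bits of a root and `L` multiplications for a power give `L ^ 4`; two
  -- of the factors `L` are absorbed by `L ^ 2 ≤ 4 * D`.
  have hP : (L + 1) * (6 * ((L + 2) * ((L + 2) * M2))) ≤ 192 * 10 ^ 12 * Q := by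
    calc _ ≤ (2 * L) * (6 * ((2 * L) * ((2 * L) * (10 ^ 12 * (L * e))))) := by
          gcongr <;> omega
      _ = 48 * 10 ^ 12 * (L ^ 2 * Y) := by rw [hY]; ring
      _ ≤ 48 * 10 ^ 12 * (4 * D * Y) := by gcongr
      _ = 192 * 10 ^ 12 * (D * Y) := by ring
      _ ≤ _ := by gcongr
  have hA : (L + 1) * M ≤ 2 * 10 ^ 12 * Q := by
    calc (L + 1) * M ≤ (2 * L) * M := by gcongr; omega
      _ = 2 * (L * M) := by ring
      _ ≤ 2 * (10 ^ 12 * Y) := by gcongr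
      _ ≤ _ := by linarith
  have hS : (c + 2) * (L + 2) ≤ 12 * Q := by
    calc (c + 2) * (L + 2) ≤ (6 * L) * (2 * L) := by gcongr <;> omega
      _ = 12 * (L * L) := by ring
      _ ≤ _ := by linarith
  have : D * N * L ^ 2 * e = Q := by rw [hQ, hY]; ring
  rw [this]
  linarith

end AlgOne


/-! ### Assembly of the program, and the soft estimates -/

namespace Lisp

/-- The implementation of the algorithm. -/
def algorithm : Program :=
  [setupBody, bitBody, addBody, subBody, ltBody, mulSBody, eqBody, appBody, dropBody, takeBody,
    halfBody, pwBody, vaddBody, lrotBody, marBody, mrotBody, scaleBody, convBody, colsBody,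
    zcBody, headsBody, tailsBody, uncolsBody, pmBody, pm2Body, pm3Body, nussBody, nuss2Body,
    nuss3Body, escBody, carryBody, jlogBody, padBody, mulBody, mul2Body, divmBody, divm2Body,
    redBody, red2Body, mmBody, pwmBody, sqsBody, gcdBody, absBody, powUBody, rootBody, ppBody,
    packBody, apwBody, unpBody, lowBody, foldBody, pmlBody, ppwBody, smapBody, incBody, un2Body,
    shlBody, tzBody, memBody, emitBody, powersBody, smallBody, perfectBody, outerBody, innerBody,
    boundBody, coprimeBody, diffBody, congBody, finalBody]

instance : HasArith algorithm := ⟨rfl, rfl, rfl, rfl, rfl, rfl⟩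
instance : HasList algorithm := ⟨rfl, rfl, rfl, rfl, rfl⟩
instance : HasVec algorithm := ⟨rfl, rfl, rfl, rfl, rfl, rfl, rfl, rfl, rfl, rfl, rfl⟩
instance : HasFFT algorithm := ⟨rfl, rfl, rfl, rfl, rfl, rfl⟩
instance : HasMul algorithm := ⟨rfl, rfl, rfl, rfl, rfl, rfl⟩
instance : HasMod algorithm := ⟨rfl, rfl, rfl, rfl, rfl, rfl, rfl, rfl, rfl⟩
instance : HasPow algorithm := ⟨rfl, rfl, rfl⟩
instance : HasPoly algorithm := ⟨rfl, rfl, rfl, rfl, rfl, rfl, rfl, rfl, rfl⟩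
instance : HasMain algorithm := ⟨rfl, rfl, rfl, rfl, rfl, rfl, rfl, rfl, rfl, rfl, rfl, rfl, rfl, rfl,
  rfl, rfl⟩

end Lisp

namespace AlgOne

open Lisp Polynomial

theorem exists_haltsWith {n a : ℕ} (hV : (n, a) ∈ Valid) : ∃ t,
    (∃ w b, Runs n a .step1a w b ∧ algorithm.HaltsWith (input n a) (output b w) t) ∧
      t ≤ 10 ^ 16 * (2 ^ s n * 2 ^ (s n - k n) * n.size ^ 2 * (s n + 1) ^ 5) := by
  obtain ⟨w, b, hr, body, v, t, hb, he, rfl, ht⟩ := setup_run (P := algorithm) hV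
  refine ⟨1 + t + 1, ⟨w, b, hr, .call (.var _ 0) hb he⟩, ?_⟩
  have := totalT_le hV
  omega

/-- `2 ^ (-min (s, k)) (log n) ^ 6` -/
noncomputable def bound (n : ℕ) : ℝ := (2 : ℝ) ^ (-(min (s n) (k n) : ℤ)) * Real.logb 2 n ^ 6

/-- With truncated subtraction `s - k = s - min s k`. The powers `2 ^ s` are at most `2 * (log n) ^
2` and the bit length is at most `2 * log n`; the constant is `2 * 2 * 4`. -/
theorem two_pow_mul_le_bound {n a : ℕ} (hV : (n, a) ∈ Valid) :
    (2 : ℝ) ^ s n * 2 ^ (s n - k n) * n.size ^ 2 ≤ 16 * bound n := by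
  have h1 := two_lt_logb hV
  have h2 := two_pow_s_le hV
  have h3 := size_le_logb hV
  have h4 : (2 : ℝ) ^ (s n - k n) = 2 ^ s n * 2 ^ (-(min (s n) (k n) : ℤ)) := by
    rw [← zpow_natCast, ← zpow_natCast, ← zpow_add₀ (by norm_num)]
    congr 1
    omega
  rw [h4, bound]
  calc _ ≤ (2 * Real.logb 2 n ^ 2) * ((2 * Real.logb 2 n ^ 2) * 2 ^ (-(min (s n) (k n) : ℤ))) *
        (2 * Real.logb 2 n) ^ 2 := by gcongr; linarith
    _ = _ := by ring

/-- A soft estimate allows powers of the logarithm of the bound, not of `n`. Because `min s k ≤ s`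
and `2 ^ s ≤ 2 * (log n) ^ 2`, the bound is large enough for its logarithm to dominate `s`. -/
theorem le_bound {n a : ℕ} (hV : (n, a) ∈ Valid) : Real.logb 2 n ^ 4 / 2 ≤ bound n := by
  have h1 := two_lt_logb hV
  have h2 := two_pow_s_le hV
  have h3 : (2 * Real.logb 2 n ^ 2)⁻¹ ≤ (2 : ℝ) ^ (-(min (s n) (k n) : ℤ)) := by
    calc _ ≤ ((2 : ℝ) ^ s n)⁻¹ := by gcongr
      _ = (2 : ℝ) ^ (-(s n : ℤ)) := by rw [zpow_neg, zpow_natCast]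
      _ ≤ _ := by gcongr <;> simp
  calc Real.logb 2 n ^ 4 / 2 = (2 * Real.logb 2 n ^ 2)⁻¹ * Real.logb 2 n ^ 6 := by
        field_simp
    _ ≤ _ := by rw [bound]; gcongr

theorem bound_le {n a : ℕ} (hV : (n, a) ∈ Valid) : bound n ≤ Real.logb 2 n ^ 6 := by
  have h1 := two_lt_logb hV
  exact mul_le_of_le_one_left (by positivity)
    (zpow_le_one_of_nonpos₀ (by norm_num) (by simp))

theorem bound_le_of_le {n a : ℕ} (hV : (n, a) ∈ Valid) (h : s n ≤ k n) :
    bound n ≤ Real.logb 2 n ^ 4 := by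
  have h1 := two_lt_logb hV
  have h2 := logb_sq_le hV
  rw [bound, min_eq_left (by exact_mod_cast h), zpow_neg, zpow_natCast, inv_mul_le_iff₀ (by positivity)]
  calc Real.logb 2 n ^ 6 = Real.logb 2 n ^ 2 * Real.logb 2 n ^ 4 := by ring
    _ ≤ _ := by gcongr

/-- A majorant of the bound which is not much smaller than `(log n) ^ 4` gives a soft estimate. -/
theorem softO_of_le {D : Set (ℕ × ℕ)} {T : ℕ × ℕ → ℕ} {g : ℕ × ℕ → ℝ} (hD : D ⊆ Valid)
    (hT : ∀ x ∈ D, T x ≤ 10 ^ 16 * (2 ^ s x.1 * 2 ^ (s x.1 - k x.1) * x.1.size ^ 2 *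
      (s x.1 + 1) ^ 5))
    (hg : ∀ x ∈ D, bound x.1 ≤ g x) (hg' : ∀ x ∈ D, Real.logb 2 x.1 ^ 4 / 2 ≤ g x) :
    SoftO D T g := by
  -- The polynomial comes from `s + 1 ≤ 2 * log log n + 2` and `log g ≥ 4 * log log n - 1`, which
  -- give `s + 1 ≤ log g + 3`.
  refine ⟨C (16 * 10 ^ 16) * (X + 3) ^ 5, fun x hx => ?_⟩
  have hV : (x.1, x.2) ∈ Valid := hD hx
  have h1 := two_lt_logb hV
  have h0 : 0 < Real.logb 2 x.1 ^ 4 / 2 := by positivity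
  have h2 : (T x : ℝ) ≤ 10 ^ 16 * (2 ^ s x.1 * 2 ^ (s x.1 - k x.1) * x.1.size ^ 2 *
      (s x.1 + 1) ^ 5) := by exact_mod_cast hT x hx
  have h3 : 4 * Real.logb 2 (Real.logb 2 x.1) - 1 ≤ Real.logb 2 (g x) := by
    calc _ = Real.logb 2 (Real.logb 2 x.1 ^ 4 / 2) := by
          rw [Real.logb_div (by positivity) (by norm_num), Real.logb_pow,
            Real.logb_self_eq_one (by norm_num)]
          norm_num
      _ ≤ _ := Real.logb_le_logb_of_le (by norm_num) h0 (hg' x hx)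
  have h4 := s_le hV
  have h5 : 0 ≤ Real.logb 2 (Real.logb 2 x.1) := Real.logb_nonneg (by norm_num) (by linarith)
  have h6 : (s x.1 + 1 : ℝ) ≤ Real.logb 2 (g x) + 3 := by linarith
  have h7 := two_pow_mul_le_bound hV
  have h8 := hg x hx
  have h9 : 0 ≤ g x := h0.le.trans (hg' x hx)
  calc (T x : ℝ) ≤ _ := h2
    _ ≤ 10 ^ 16 * ((16 * g x) * (Real.logb 2 (g x) + 3) ^ 5) := by
        refine mul_le_mul_of_nonneg_left ?_ (by norm_num)
        exact mul_le_mul (h7.trans (by linarith)) (by gcongr) (by positivity) (by linarith)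
    _ = _ := by simp; ring

end AlgOne

theorem theorem3p2 :
    ∃ (P : Lisp.Program) (T : ℕ × ℕ → ℕ), AlgOne.Implements P T ∧
      SoftO AlgOne.Valid T
        (fun x => (2 : ℝ) ^ (-(min (AlgOne.s x.1) (AlgOne.k x.1) : ℤ)) * Real.logb 2 x.1 ^ 6) ∧
      SoftO {x ∈ AlgOne.Valid | AlgOne.k x.1 = 2} T (fun x => Real.logb 2 x.1 ^ 6) ∧
      SoftO {x ∈ AlgOne.Valid | AlgOne.s x.1 ≤ AlgOne.k x.1} T (fun x => Real.logb 2 x.1 ^ 4) := by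
  classical
  choose! t ht using fun (x : ℕ × ℕ) (hx : x ∈ AlgOne.Valid) =>
    AlgOne.exists_haltsWith (n := x.1) (a := x.2) hx
  have hlog (x : ℕ × ℕ) (hx : x ∈ AlgOne.Valid) : 2 < Real.logb 2 x.1 :=
    AlgOne.two_lt_logb (n := x.1) (a := x.2) hx
  refine ⟨Lisp.algorithm, t, fun n a hV => (ht (n, a) hV).1, ?_, ?_, ?_⟩
  · exact AlgOne.softO_of_le subset_rfl (fun x hx => (ht x hx).2) (fun x _ => le_rfl)
      fun x hx => AlgOne.le_bound (n := x.1) (a := x.2) hx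
  -- For `k = 2` the factor `2 ^ (-min s k)` is a constant, and estimating it by `1` is enough.
  · refine AlgOne.softO_of_le (fun x hx => hx.1) (fun x hx => (ht x hx.1).2)
      (fun x hx => AlgOne.bound_le (n := x.1) (a := x.2) hx.1) fun x hx => ?_
    exact (AlgOne.le_bound (n := x.1) (a := x.2) hx.1).trans (AlgOne.bound_le (a := x.2) hx.1)
  · refine AlgOne.softO_of_le (fun x hx => hx.1) (fun x hx => (ht x hx.1).2)
      (fun x hx => AlgOne.bound_le_of_le (n := x.1) (a := x.2) hx.1 hx.2) fun x hx => ?_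
    exact half_le_self (by have := hlog x hx.1; positivity)
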